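/- Let $F$ be a finite extension of some $\mathbb{Q}_p$, with ring of integers $\mathfrak{o}$, maximal ideal $\mathfrak{p}=\varpi\mathfrak{o}$, residue field $\mathbb{F}_q=\mathfrak{o}/\mathfrak{p}$ and normalized absolute value $\nu=|\cdot|$. All representations are complex. Let $G=\mathrm{GSp}(4,F)$ be the group of $g\in\mathrm{GL}(4,F)$ with $gJg^{t}=\mathrm{sim}(g)J$ for some $\mathrm{sim}(g)\in F^\times$, where $J=\left(\begin{smallmatrix}0&I_2\\-I_2&0\end{smallmatrix}\right)$. The standard paramodular subgroup and its pro-unipotent radical are $$\mathscr{J}=\mathrm{sim}^{-1}(\mathfrak{o}^\times)\cap\begin{pmatrix}\mathfrak{o}&\mathfrak{o}&\mathfrak{p}^{-1}&\mathfrak{o}\\\mathfrak{p}&\mathfrak{o}&\mathfrak{o}&\mathfrak{o}\\\mathfrak{p}&\mathfrak{p}&\mathfrak{o}&\mathfrak{p}\\\mathfrak{p}&\mathfrak{o}&\mathfrak{o}&\mathfrak{o}\end{pmatrix},\qquad \mathscr{J}^+=\mathscr{J}\cap\begin{pmatrix}1+\mathfrak{p}&\mathfrak{o}&\mathfrak{o}&\mathfrak{o}\\\mathfrak{p}&1+\mathfrak{p}&\mathfrak{o}&\mathfrak{p}\\\mathfrak{p}^2&\mathfrak{p}&1+\mathfrak{p}&\mathfrak{p}\\\mathfrak{p}&\mathfrak{p}&\mathfrak{o}&1+\mathfrak{p}\end{pmatrix},$$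 and $\mathscr{J}/\mathscr{J}^+$ is identified with $(\mathrm{GL}(2,q)^2)^0=\{(a,b)\in\mathrm{GL}(2,q)^2:\det a=\det b\}$ via $$x\mapsto\left(\begin{pmatrix}x_{11}&x_{13}\varpi\\x_{31}\varpi^{-1}&x_{33}\end{pmatrix},\begin{pmatrix}x_{22}&x_{24}\\x_{42}&x_{44}\end{pmatrix}\right)\bmod\mathfrak{p}.$$ The parahoric restriction $\mathbf{r}_{\mathscr{J}}(\rho)$ of a representation $(\rho,V)$ of $G$ is the representation of $\mathscr{J}/\mathscr{J}^+\cong(\mathrm{GL}(2,q)^2)^0$ on the space of invariants $V^{\mathscr{J}^+}$. For a smooth character $\mu$ of $F^\times$ let $\widetilde\mu$ be the representation of $\mathbb{F}_q^\times\cong\mathfrak{o}^\times/(1+\mathfrak{p})$ on the $(1+\mathfrak{p})$-invariants of $\mu$; that is, the character induced by $\mu|_{\mathfrak{o}^\times}$ if $\mu$ is trivial on $1+\mathfrak{p}$, and $\widetilde\mu=0$ otherwise. For representations $\chi_1,\chi_2$ of $\mathbb{F}_q^\times$ (characters or zero) let $\chi_1\times\chi_2$ be the representation of $\mathrm{GL}(2,q)$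 induced from the character $\chi_1\boxtimes\chi_2$ of the upper triangular Borel. For representations $\sigma_1,\sigma_2$ of $\mathrm{GL}(2,q)$ let $[\sigma_1,\sigma_2]$ be the restriction of $\sigma_1\boxtimes\sigma_2$ to $(\mathrm{GL}(2,q)^2)^0$, and put $\widetilde\mu[\sigma_1,\sigma_2]=[(\widetilde\mu\circ\det)\otimes\sigma_1,\sigma_2]$. Over $F$, let $\mu_1\times\mu_2$ be the representation of $\mathrm{GL}(2,F)$ obtained by normalized induction from the upper triangular Borel, let $\mu_1\mathbf{1}=\mu_1\circ\det$, let $\mathrm{St}$ be the quotient of $\nu^{-1/2}\times\nu^{1/2}$ by the constant functions, and let $\mu_1\mathrm{St}=(\mu_1\circ\det)\otimes\mathrm{St}$. For a representation $\sigma$ of $\mathrm{GL}(2,F)$ let $\sigma\rtimes\mu_0$ be the representation of $G$ obtained by normalized induction of $\left(\begin{smallmatrix}A&*\\0&\lambda A^{-t}\end{smallmatrix}\right)\mapsto\mu_0(\lambda)\,\sigma(A)$ from the Siegel parabolic. **Proposition.** Let $\mu_0,\mu_1,\mu_2$ be smooth characters of $F^\times$ and let $\sigma$ be an irreducible admissible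 representation of $\mathrm{GL}(2,F)$. Then $$\mathbf{r}_{\mathscr{J}}(\sigma\rtimes\mu_0)\;\cong\;\begin{cases}\widetilde{\mu_0}[1\times\widetilde{\mu_1},1\times\widetilde{\mu_2}]\oplus\widetilde{\mu_0}[1\times\widetilde{\mu_2},1\times\widetilde{\mu_1}]&\text{if }\sigma\cong\mu_1\times\mu_2,\\ \widetilde{\mu_0}[1\times\widetilde{\mu_1},1\times\widetilde{\mu_1}]&\text{if }\sigma\cong\mu_1\mathrm{St}\text{ or }\sigma\cong\mu_1\mathbf{1},\\0&\text{if }\sigma\text{ is cuspidal.}\end{cases}$$ -/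

import Mathlib

open ValuativeRel
open scoped Matrix TensorProduct

set_option linter.unusedSectionVars false

noncomputable section

namespace ParahoricRes

/-! ### Smooth, admissible and induced representations -/

section Generic

variable {G : Type*} [Group G] {V : Type*} [AddCommGroup V] [Module ℂ V]

/-- A character is smooth if its kernel is open. -/
def IsSmoothChar [TopologicalSpace G] (χ : G →* ℂˣ) : Prop :=
  IsOpen (χ.ker : Set G)

/-- A representation is smooth if every vector is fixed by an open subgroup. -/
def IsSmooth [TopologicalSpace G] (ρ : Representation ℂ G V) : Prop :=
  ∀ v : V, ∃ U : Subgroup G, IsOpen (U : Set G) ∧ ∀ u ∈ U, ρ u v = v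

/-- A representation is admissible if it is smooth and every compact open subgroup has a
finite-dimensional space of invariants. -/
def IsAdmissible [TopologicalSpace G] (ρ : Representation ℂ G V) : Prop :=
  IsSmooth ρ ∧ ∀ U : Subgroup G, IsOpen (U : Set G) → IsCompact (U : Set G) →
    FiniteDimensional ℂ (Representation.invariants (ρ.comp U.subtype))

/-- The twist `χ ⊗ ρ` of a representation by a character. -/
def twist (χ : G →* ℂˣ) (ρ : Representation ℂ G V) : Representation ℂ G V where
  toFun g := (χ g : ℂ) • ρ g
  map_one' := by simp
  map_mul' g h := by
    ext v
    simp only [map_mul, Units.val_mul, LinearMap.smul_apply, Module.End.mul_apply, map_smul,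
      mul_smul]
    rw [smul_comm]

/-- A character, as a one-dimensional representation. -/
def charRep (χ : G →* ℂˣ) : Representation ℂ G ℂ :=
  twist χ (Representation.trivial ℂ G ℂ)

/-- The space of the smooth (unnormalized) induction of `τ` from a subgroup `H` of `G`: functions
`f : G → V` with `f (h * g) = τ h (f g)` that are right invariant under some open subgroup. -/
def smoothIndV [TopologicalSpace G] (H : Subgroup G) (τ : Representation ℂ H V) :
    Submodule ℂ (G → V) where
  carrier := {f | (∀ (h : H) (g : G), f (h * g) = τ h (f g)) ∧
    ∃ U : Subgroup G, IsOpen (U : Set G) ∧ ∀ u ∈ U, ∀ g : G, f (g * u) = f g}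
  add_mem' := by
    rintro f f' ⟨hf, U, hU, hfU⟩ ⟨hf', U', hU', hfU'⟩
    refine ⟨fun h g => by simp [hf, hf'], U ⊓ U', hU.inter hU', fun u hu g => ?_⟩
    simp [hfU u hu.1, hfU' u hu.2]
  zero_mem' := ⟨by simp, ⊤, isOpen_univ, by simp⟩
  smul_mem' := by
    rintro c f ⟨hf, U, hU, hfU⟩
    exact ⟨fun h g => by simp [hf], U, hU, fun u hu g => by simp [hfU u hu]⟩

/-- The smooth (unnormalized) induction: `G` acts on `smoothIndV H τ` by right translation. -/
def smoothInd [TopologicalSpace G] [ContinuousMul G] (H : Subgroup G) (τ : Representation ℂ H V) :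
    Representation ℂ G (smoothIndV H τ) where
  toFun g :=
    { toFun := fun f => ⟨fun x => f.1 (x * g), by
        obtain ⟨f, hf, U, hU, hfU⟩ := f
        refine ⟨fun h x => by simp [mul_assoc, hf],
          U.comap (MulAut.conj g⁻¹).toMonoidHom, ?_, fun u hu x => ?_⟩
        · refine hU.preimage (f := fun x => g⁻¹ * x * g⁻¹⁻¹) ?_
          fun_prop
        · have := hfU _ hu (x * g)
          simpa [mul_assoc] using this⟩
      map_add' := fun _ _ => rfl
      map_smul' := fun _ _ => rfl }
  map_one' := by
    ext f x
    simp
  map_mul' g h := by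
    ext f x
    simp [mul_assoc]

/-- Parahoric restriction. For a homomorphism `ι : P → G` (typically the inclusion of a parahoric
subgroup `P`) and a surjection `π : P → L` with kernel `Pplus`, the group `L ≅ P / Pplus` acts on
the space of `Pplus`-invariants of a representation `ρ` of `G`. -/
def parRes {P L : Type*} [Group P] [Group L] (ι : P →* G) (Pplus : Subgroup P) (π : P →* L)
    (hπ : Function.Surjective π) (hker : π.ker = Pplus) (ρ : Representation ℂ G V) :
    Representation ℂ L (Representation.invariants ((ρ.comp ι).comp Pplus.subtype)) :=
  haveI : Pplus.Normal := hker ▸ inferInstance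
  (Representation.quotientToInvariants (ρ.comp ι) Pplus).comp
    (((QuotientGroup.quotientMulEquivOfEq hker.symm).trans
      (QuotientGroup.quotientKerEquivOfSurjective π hπ)).symm : L →* P ⧸ Pplus)

theorem parRes_apply {P L : Type*} [Group P] [Group L] (ι : P →* G) (Pplus : Subgroup P)
    (π : P →* L) (hπ : Function.Surjective π) (hker : π.ker = Pplus) (ρ : Representation ℂ G V)
    (x : P) (v : Representation.invariants ((ρ.comp ι).comp Pplus.subtype)) :
    ((parRes ι Pplus π hπ hker ρ (π x) v : _) : V) = ρ (ι x) v := by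
  have : Pplus.Normal := hker ▸ inferInstance
  have h : ((QuotientGroup.quotientMulEquivOfEq hker.symm).trans
      (QuotientGroup.quotientKerEquivOfSurjective π hπ)).symm (π x) = (x : P ⧸ Pplus) := by
    rw [MulEquiv.symm_apply_eq]
    rfl
  simp only [parRes, MonoidHom.comp_apply, MonoidHom.coe_coe]
  rw [h]
  rfl

end Generic

/-! ### The group `GL(2)` over a field -/

section GL2

variable (K : Type*) [Field K]

/-- The group `GL(2, K)`. -/
abbrev GL2 := Matrix.GeneralLinearGroup (Fin 2) K

variable {K}

theorem mul_entry_of_lower_zero {g h : GL2 K} (hg : g.1 1 0 = 0) (hh : h.1 1 0 = 0) :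
    (g * h).1 1 0 = 0 ∧ (g * h).1 0 0 = g.1 0 0 * h.1 0 0 ∧
      (g * h).1 1 1 = g.1 1 1 * h.1 1 1 := by
  simp [Matrix.mul_apply, Fin.sum_univ_two, hg, hh]

theorem det_of_lower_zero {g : GL2 K} (hg : g.1 1 0 = 0) : g.1 0 0 * g.1 1 1 ≠ 0 := by
  have h : g.1.det ≠ 0 := ((Matrix.isUnit_iff_isUnit_det _).1 g.isUnit).ne_zero
  rw [Matrix.det_fin_two] at h
  simpa [hg] using h

variable (K)

/-- The standard Borel subgroup of upper triangular matrices in `GL(2, K)`. -/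
def borel : Subgroup (GL2 K) where
  carrier := {g | g.1 1 0 = 0}
  mul_mem' := fun hg hh => (mul_entry_of_lower_zero hg hh).1
  one_mem' := by simp
  inv_mem' := by
    intro g hg
    have h1 : (g⁻¹ * g).1 1 0 = 0 := by simp
    have hg' : g.1 1 0 = 0 := hg
    have h0 := (mul_ne_zero_iff.1 (det_of_lower_zero hg')).1
    rw [Units.val_mul, Matrix.mul_apply, Fin.sum_univ_two, hg', mul_zero, add_zero] at h1
    exact (mul_eq_zero.1 h1).resolve_right h0

/-- The upper left entry of an upper triangular matrix. -/
def borelFst : borel K →* Kˣ where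
  toFun b := Units.mk0 (b.1.1 0 0) (mul_ne_zero_iff.1 (det_of_lower_zero b.2)).1
  map_one' := by ext; simp
  map_mul' b c := by
    ext
    exact (mul_entry_of_lower_zero b.2 c.2).2.1

/-- The lower right entry of an upper triangular matrix. -/
def borelSnd : borel K →* Kˣ where
  toFun b := Units.mk0 (b.1.1 1 1) (mul_ne_zero_iff.1 (det_of_lower_zero b.2)).2
  map_one' := by ext; simp
  map_mul' b c := by
    ext
    exact (mul_entry_of_lower_zero b.2 c.2).2.2

/-- The unipotent radical of the standard Borel, as a subgroup of the Borel. -/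
def borelUnipotent : Subgroup (borel K) := (borelFst K).ker ⊓ (borelSnd K).ker

end GL2

/-! ### The group `GSp(4)` over a field -/

section GSp4

variable (K : Type*) [Field K]

/-- The standard symplectic form. -/
def Jform : Matrix (Fin 4) (Fin 4) K :=
  !![0, 0, 1, 0; 0, 0, 0, 1; -1, 0, 0, 0; 0, -1, 0, 0]

theorem Jform_mul_neg : Jform K * (-Jform K) = 1 := by
  ext i j
  fin_cases i <;> fin_cases j <;> simp [Jform, Matrix.mul_apply, Fin.sum_univ_four]

/-- The group `GSp(4, K)` of pairs `(g, ν)` in `GL(4, K) × GL(1, K)` with `g J gᵗ = ν J`. The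
similitude factor `ν` is determined by `g`. -/
def GSp4 : Subgroup (Matrix.GeneralLinearGroup (Fin 4) K × Kˣ) where
  carrier := {x | x.1.1 * Jform K * x.1.1ᵀ = (x.2 : K) • Jform K}
  one_mem' := by simp
  mul_mem' := by
    intro x y hx hy
    simp only [Set.mem_ofPred_eq] at hx hy ⊢
    calc (x * y).1.1 * Jform K * (x * y).1.1ᵀ
        = x.1.1 * (y.1.1 * Jform K * y.1.1ᵀ) * x.1.1ᵀ := by
          simp [Matrix.transpose_mul, Matrix.mul_assoc]
      _ = (x * y).2.1 • Jform K := by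
          rw [hy, Matrix.mul_smul, Matrix.smul_mul, hx, smul_smul]
          simp [mul_comm]
  inv_mem' := by
    intro x hx
    simp only [Set.mem_ofPred_eq] at hx ⊢
    have h1 : x.1⁻¹.1 * x.1.1 = 1 := by rw [← Units.val_mul]; simp
    have h2 : x.1.1ᵀ * x.1⁻¹.1ᵀ = 1 := by rw [← Matrix.transpose_mul, h1, Matrix.transpose_one]
    have h3 : x.1⁻¹.1 * (x.1.1 * Jform K * x.1.1ᵀ) * x.1⁻¹.1ᵀ = Jform K := by
      calc _ = (x.1⁻¹.1 * x.1.1) * Jform K * (x.1.1ᵀ * x.1⁻¹.1ᵀ) := by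
            simp only [Matrix.mul_assoc]
        _ = _ := by rw [h1, h2, Matrix.one_mul, Matrix.mul_one]
    rw [hx, Matrix.mul_smul, Matrix.smul_mul] at h3
    calc (x⁻¹).1.1 * Jform K * (x⁻¹).1.1ᵀ
        = (x.2⁻¹ : Kˣ).1 • (x.2.1 • (x.1⁻¹.1 * Jform K * x.1⁻¹.1ᵀ)) := by
          rw [smul_smul, ← Units.val_mul, inv_mul_cancel, Units.val_one, one_smul]
          rfl
      _ = _ := by rw [h3]; rfl

variable {K}

/-- The underlying matrix of an element of `GSp(4, K)`. -/
def mat (x : GSp4 K) : Matrix (Fin 4) (Fin 4) K := x.1.1.1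

theorem mat_one : mat (1 : GSp4 K) = 1 := rfl

theorem mat_mul (x y : GSp4 K) : mat (x * y) = mat x * mat y := rfl

/-- The similitude character. -/
def simi : GSp4 K →* Kˣ := (MonoidHom.snd _ _).comp (GSp4 K).subtype

theorem mat_rel (x : GSp4 K) : mat x * Jform K * (mat x)ᵀ = (simi x : K) • Jform K := x.2

theorem mat_inv (x : GSp4 K) :
    mat x⁻¹ = ((simi x)⁻¹ : Kˣ).1 • (Jform K * (mat x)ᵀ * (-Jform K)) := by
  have h1 : mat x⁻¹ * mat x = 1 := by rw [← mat_mul, inv_mul_cancel, mat_one]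
  have h2 : mat x * (((simi x)⁻¹ : Kˣ).1 • (Jform K * (mat x)ᵀ * (-Jform K))) = 1 := by
    rw [Matrix.mul_smul, ← Matrix.mul_assoc, ← Matrix.mul_assoc, mat_rel, Matrix.smul_mul,
      Jform_mul_neg, smul_smul, ← Units.val_mul, inv_mul_cancel, Units.val_one, one_smul]
  exact left_inv_eq_right_inv h1 h2

/-- The involution of the indices with `J i (dualIdx i) ≠ 0`. -/
def dualIdx : Fin 4 → Fin 4 := ![2, 3, 0, 1]

theorem mat_inv_apply (x : GSp4 K) (i j : Fin 4) :
    ∃ e : K, (e = 1 ∨ e = -1) ∧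
      mat x⁻¹ i j = ((simi x)⁻¹ : Kˣ).1 * (e * mat x (dualIdx j) (dualIdx i)) := by
  rw [mat_inv]
  simp only [Matrix.smul_apply, Matrix.mul_apply, Fin.sum_univ_four, Matrix.neg_apply,
    Matrix.transpose_apply, smul_eq_mul]
  fin_cases i <;> fin_cases j <;>
    first
    | (refine ⟨1, Or.inl rfl, ?_⟩; simp [Jform, dualIdx]; done)
    | (refine ⟨-1, Or.inr rfl, ?_⟩; simp [Jform, dualIdx])

/-- The element of `GSp(4, K)` given by a matrix and its similitude factor. -/
def mkGSp4 (M : Matrix (Fin 4) (Fin 4) K) (c : Kˣ) (h : M * Jform K * Mᵀ = (c : K) • Jform K) :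
    GSp4 K :=
  have h1 : M * ((c⁻¹ : Kˣ).1 • (Jform K * Mᵀ * (-Jform K))) = 1 := by
    rw [Matrix.mul_smul, ← Matrix.mul_assoc, ← Matrix.mul_assoc, h, Matrix.smul_mul,
      Jform_mul_neg, smul_smul, ← Units.val_mul, inv_mul_cancel, Units.val_one, one_smul]
  ⟨(⟨M, (c⁻¹ : Kˣ).1 • (Jform K * Mᵀ * (-Jform K)), h1, mul_eq_one_comm.1 h1⟩, c), h⟩

theorem mat_mkGSp4 (M : Matrix (Fin 4) (Fin 4) K) (c : Kˣ)
    (h : M * Jform K * Mᵀ = (c : K) • Jform K) : mat (mkGSp4 M c h) = M := rfl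

theorem simi_mkGSp4 (M : Matrix (Fin 4) (Fin 4) K) (c : Kˣ)
    (h : M * Jform K * Mᵀ = (c : K) • Jform K) : simi (mkGSp4 M c h) = c := rfl

variable (K)

/-- The standard Siegel parabolic subgroup of `GSp(4, K)`: the lower left `2 × 2`-block is zero. -/
def siegel : Subgroup (GSp4 K) where
  carrier := {x | mat x 2 0 = 0 ∧ mat x 2 1 = 0 ∧ mat x 3 0 = 0 ∧ mat x 3 1 = 0}
  one_mem' := by simp [mat_one]
  mul_mem' := by
    rintro x y ⟨h1, h2, h3, h4⟩ ⟨k1, k2, k3, k4⟩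
    simp [mat_mul, Matrix.mul_apply, Fin.sum_univ_four, h1, h2, h3, h4, k1, k2, k3, k4]
  inv_mem' := by
    rintro x ⟨h1, h2, h3, h4⟩
    have key : ∀ i j : Fin 4, mat x (dualIdx j) (dualIdx i) = 0 → mat x⁻¹ i j = 0 := by
      intro i j h
      obtain ⟨e, -, he⟩ := mat_inv_apply x i j
      rw [he, h, mul_zero, mul_zero]
    exact ⟨key 2 0 h1, key 2 1 h3, key 3 0 h2, key 3 1 h4⟩

/-- The projection of the Siegel parabolic to `GL(2, K)`, given by the upper left block. -/
def siegelLevi : siegel K →* GL2 K :=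
  MonoidHom.toHomUnits
    { toFun := fun p => !![mat p.1 0 0, mat p.1 0 1; mat p.1 1 0, mat p.1 1 1]
      map_one' := by
        ext i j
        fin_cases i <;> fin_cases j <;> simp [mat_one]
      map_mul' := by
        rintro ⟨x, hx⟩ ⟨y, k1, k2, k3, k4⟩
        ext i j
        fin_cases i <;> fin_cases j <;>
          simp [mat_mul, Matrix.mul_apply, Fin.sum_univ_four, Fin.sum_univ_two, k1, k2, k3, k4] }

end GSp4

/-! ### Representations of finite groups of Lie type -/

section Finite

variable (k : Type*) [Field k]

/-- The group `(GL(2, k)²)⁰` of pairs with equal determinant. -/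
def GL2sq0 : Subgroup (GL2 k × GL2 k) where
  carrier := {x | Matrix.GeneralLinearGroup.det x.1 = Matrix.GeneralLinearGroup.det x.2}
  one_mem' := by simp
  mul_mem' := by
    intro x y hx hy
    simp only [Set.mem_ofPred_eq] at hx hy ⊢
    simp [hx, hy]
  inv_mem' := by
    intro x hx
    simp only [Set.mem_ofPred_eq] at hx ⊢
    simp [hx]

variable {k} {A B W : Type*} [AddCommGroup A] [Module ℂ A] [AddCommGroup B] [Module ℂ B]
  [AddCommGroup W] [Module ℂ W]

/-- The induced representation `χ₁ × χ₂` of `GL(2, k)`, where `χ₁`, `χ₂` are representations of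
`kˣ`: right translation on the functions `f : GL(2, k) → A ⊗ B` with
`f (b * g) = (χ₁ b₁₁ ⊗ χ₂ b₂₂) (f g)` for upper triangular `b`. -/
abbrev finInd (χ₁ : Representation ℂ kˣ A) (χ₂ : Representation ℂ kˣ B) :
    Representation ℂ (GL2 k)
      (Representation.coindV (borel k).subtype
        (Representation.tprod (χ₁.comp (borelFst k)) (χ₂.comp (borelSnd k)))) :=
  Representation.coind (borel k).subtype
    (Representation.tprod (χ₁.comp (borelFst k)) (χ₂.comp (borelSnd k)))

/-- The restriction `[σ₁, σ₂]` of the exterior tensor product `σ₁ ⊠ σ₂` to `(GL(2, k)²)⁰`. -/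
abbrev bracket (σ₁ : Representation ℂ (GL2 k) A) (σ₂ : Representation ℂ (GL2 k) B) :
    Representation ℂ (GL2sq0 k) (A ⊗[ℂ] B) :=
  Representation.tprod (σ₁.comp ((MonoidHom.fst _ _).comp (GL2sq0 k).subtype))
    (σ₂.comp ((MonoidHom.snd _ _).comp (GL2sq0 k).subtype))

/-- The twist `(χ ∘ det) ⊗ σ` of a representation of `GL(2, k)` by a representation of `kˣ`. -/
abbrev detTwist (χ : Representation ℂ kˣ W) (σ : Representation ℂ (GL2 k) A) :
    Representation ℂ (GL2 k) (W ⊗[ℂ] A) :=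
  Representation.tprod (χ.comp Matrix.GeneralLinearGroup.det) σ

/-- The representation `χ₀[1 × χ₁, 1 × χ₂] = [(χ₀ ∘ det) ⊗ (1 × χ₁), 1 × χ₂]` of
`(GL(2, k)²)⁰`. -/
abbrev bracketInd {A₀ A₁ A₂ : Type*} [AddCommGroup A₀] [Module ℂ A₀] [AddCommGroup A₁]
    [Module ℂ A₁] [AddCommGroup A₂] [Module ℂ A₂] (χ₀ : Representation ℂ kˣ A₀)
    (χ₁ : Representation ℂ kˣ A₁) (χ₂ : Representation ℂ kˣ A₂) :=
  bracket (detTwist χ₀ (finInd (Representation.trivial ℂ kˣ ℂ) χ₁))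
    (finInd (Representation.trivial ℂ kˣ ℂ) χ₂)

end Finite

/-! ### Representations over a local field -/

section Local

variable (F : Type*) [Field F] [ValuativeRel F] [TopologicalSpace F] [IsNonarchimedeanLocalField F]

/-- The order `q` of the residue field. -/
def resCard : NNReal := Nat.card 𝓀[F]

theorem resCard_ne_zero : resCard F ≠ 0 := by
  simp only [resCard, ne_eq, Nat.cast_eq_zero]
  exact Nat.card_pos.ne'

/-- The normalized absolute value `ν = |·|`, with `|ϖ| = q⁻¹`. -/
def nabs (x : F) : NNReal :=
  WithZeroMulInt.toNNReal (resCard_ne_zero F)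
    (IsNonarchimedeanLocalField.valueGroupWithZeroIsoInt F (valuation F x))

/-- The character `ν ^ s` of `Fˣ`, for real `s`. -/
def nuPow (s : ℝ) : Fˣ →* ℂˣ :=
  MonoidHom.toHomUnits
    { toFun := fun x => (((nabs F (x : F) : ℝ) ^ s : ℝ) : ℂ)
      map_one' := by simp [nabs]
      map_mul' := by
        intro x y
        simp only [nabs, Units.val_mul, map_mul, NNReal.coe_mul]
        rw [Real.mul_rpow (NNReal.coe_nonneg _) (NNReal.coe_nonneg _), Complex.ofReal_mul] }

variable {F}

/-- The normalized induction `μ₁ × μ₂` of a pair of characters from the standard Borel of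
`GL(2, F)`; the modulus character of the Borel is `δ(b) = |b₁₁ / b₂₂|`. -/
abbrev principalSeries (μ₁ μ₂ : Fˣ →* ℂˣ) :
    Representation ℂ (GL2 F)
      (smoothIndV (borel F) (charRep ((nuPow F (1 / 2)).comp (borelFst F / borelSnd F) *
        (μ₁.comp (borelFst F) * μ₂.comp (borelSnd F))))) :=
  smoothInd (borel F) (charRep ((nuPow F (1 / 2)).comp (borelFst F / borelSnd F) *
    (μ₁.comp (borelFst F) * μ₂.comp (borelSnd F))))

/-- The one-dimensional representation `μ · 1 = μ ∘ det` of `GL(2, F)`. -/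
abbrev detRep (μ : Fˣ →* ℂˣ) : Representation ℂ (GL2 F) ℂ :=
  charRep (μ.comp Matrix.GeneralLinearGroup.det)

variable (F)

/-- The representation `ν^{-1/2} × ν^{1/2}` of `GL(2, F)`, i.e. right translation on the smooth
functions on `GL(2, F)` that are left invariant under the Borel subgroup. -/
abbrev borelFunctions : Representation ℂ (GL2 F)
    (smoothIndV (borel F) (Representation.trivial ℂ (borel F) ℂ)) :=
  smoothInd (borel F) (Representation.trivial ℂ (borel F) ℂ)

/-- The subspace of constant functions. -/
def constFunctions : Submodule ℂ (smoothIndV (borel F) (Representation.trivial ℂ (borel F) ℂ)) where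
  carrier := {f | ∃ c : ℂ, ∀ g, f.1 g = c}
  add_mem' := by
    rintro f f' ⟨c, hc⟩ ⟨c', hc'⟩
    exact ⟨c + c', fun g => by simp [hc, hc']⟩
  zero_mem' := ⟨0, by simp⟩
  smul_mem' := by
    rintro a f ⟨c, hc⟩
    exact ⟨a * c, fun g => by simp [hc]⟩

/-- The Steinberg representation of `GL(2, F)`: the quotient of `ν^{-1/2} × ν^{1/2}` by the
constant functions. -/
def steinberg : Representation ℂ (GL2 F)
    (smoothIndV (borel F) (Representation.trivial ℂ (borel F) ℂ) ⧸ constFunctions F) :=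
  (borelFunctions F).quotient (constFunctions F) (by
    rintro g f ⟨c, hc⟩
    exact ⟨c, fun x => hc (x * g)⟩)

variable {F}

/-- The twist `μ St = (μ ∘ det) ⊗ St` of the Steinberg representation. -/
abbrev twistedSteinberg (μ : Fˣ →* ℂˣ) : Representation ℂ (GL2 F)
    (smoothIndV (borel F) (Representation.trivial ℂ (borel F) ℂ) ⧸ constFunctions F) :=
  twist (μ.comp Matrix.GeneralLinearGroup.det) (steinberg F)

variable {V : Type*} [AddCommGroup V] [Module ℂ V]

/-- A representation of `GL(2, F)` is cuspidal if its Jacquet module, the space of coinvariants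
under the unipotent radical of the Borel, vanishes. -/
def IsCuspidal (σ : Representation ℂ (GL2 F) V) : Prop :=
  Subsingleton (Representation.Coinvariants
    (σ.comp ((borel F).subtype.comp (borelUnipotent F).subtype)))

/-- The Siegel induced representation `σ ⋊ μ₀` of `GSp(4, F)`: the normalized induction of the
representation `p ↦ μ₀(simi p) σ(A)` of the Siegel parabolic, where `A` is the upper left block
of `p`. The modulus character is `δ(p) = |det A / simi p| ^ 3`. -/
abbrev siegelInd (σ : Representation ℂ (GL2 F) V) (μ₀ : Fˣ →* ℂˣ) :
    Representation ℂ (GSp4 F)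
      (smoothIndV (siegel F) (twist
        ((nuPow F (3 / 2)).comp (Matrix.GeneralLinearGroup.det.comp (siegelLevi F) /
            simi.comp (siegel F).subtype) * μ₀.comp (simi.comp (siegel F).subtype))
        (σ.comp (siegelLevi F)))) :=
  smoothInd (siegel F) (twist
    ((nuPow F (3 / 2)).comp (Matrix.GeneralLinearGroup.det.comp (siegelLevi F) /
        simi.comp (siegel F).subtype) * μ₀.comp (simi.comp (siegel F).subtype))
    (σ.comp (siegelLevi F)))

/-! ### Parahoric restriction for `GL(1)` -/

variable (F)

/-- The inclusion of the units of the ring of integers into `Fˣ`. -/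
def unitsIncl : 𝒪[F]ˣ →* Fˣ := Units.map (𝒪[F]).subtype.toMonoidHom

/-- The reduction map from the units of the ring of integers to the units of the residue field. -/
def unitsRed : 𝒪[F]ˣ →* 𝓀[F]ˣ := Units.map (IsLocalRing.residue 𝒪[F]).toMonoidHom

/-- The group `1 + 𝔭` of principal units. -/
def principalUnits : Subgroup 𝒪[F]ˣ where
  carrier := {u | (u : 𝒪[F]) - 1 ∈ IsLocalRing.maximalIdeal 𝒪[F]}
  one_mem' := by simp
  mul_mem' := by
    intro u w hu hw
    simp only [Set.mem_ofPred_eq, ← IsLocalRing.residue_eq_zero_iff, map_sub, map_one, Units.val_mul,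
      map_mul, sub_eq_zero] at *
    simp [hu, hw]
  inv_mem' := by
    intro u hu
    simp only [Set.mem_ofPred_eq, ← IsLocalRing.residue_eq_zero_iff, map_sub, map_one,
      sub_eq_zero] at *
    have h : IsLocalRing.residue 𝒪[F] (u * (u⁻¹ : 𝒪[F]ˣ)) = 1 := by simp
    rw [map_mul, hu, one_mul] at h
    exact h

theorem unitsRed_surjective : Function.Surjective (unitsRed F) := by
  exact IsLocalRing.surjective_units_map_of_local_ringHom _ IsLocalRing.residue_surjective
    inferInstance

theorem unitsRed_ker : (unitsRed F).ker = principalUnits F := by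
  ext u
  rw [MonoidHom.mem_ker, Units.ext_iff]
  change IsLocalRing.residue 𝒪[F] u = 1 ↔ (u : 𝒪[F]) - 1 ∈ IsLocalRing.maximalIdeal 𝒪[F]
  rw [← IsLocalRing.residue_eq_zero_iff, map_sub, map_one, sub_eq_zero]

variable {F}

/-- The parahoric restriction `μ̃` of a smooth character `μ` of `Fˣ`: the action of
`𝓀[F]ˣ ≅ 𝒪ˣ / (1 + 𝔭)` on the `(1 + 𝔭)`-invariants of `μ`. It is one-dimensional if `μ` is
unramified or tamely ramified, and zero otherwise. -/
abbrev tameRes (μ : Fˣ →* ℂˣ) : Representation ℂ 𝓀[F]ˣ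
    (Representation.invariants
      (((charRep μ).comp (unitsIncl F)).comp (principalUnits F).subtype)) :=
  parRes (unitsIncl F) (principalUnits F) (unitsRed F) (unitsRed_surjective F) (unitsRed_ker F)
    (charRep μ)

/-! ### The standard paramodular subgroup -/

variable (F)

/-- A uniformizing element of `F`. -/
abbrev Uniformizer := {ϖ : 𝒪[F] // Irreducible ϖ}

variable {F}

/-- The fractional ideal `𝔭 ^ n`. -/
def pIdeal (ϖ : Uniformizer F) (n : ℤ) : Set F :=
  {x | valuation F x ≤ valuation F (ϖ.1 : F) ^ n}

/-- The exponents of the powers of `𝔭` that define the paramodular group. -/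
def expJ : Matrix (Fin 4) (Fin 4) ℤ :=
  !![0, 0, -1, 0; 1, 0, 0, 0; 1, 1, 0, 1; 1, 0, 0, 0]

/-- The exponents of the powers of `𝔭` that define the pro-unipotent radical of the paramodular
group. -/
def expJplus : Matrix (Fin 4) (Fin 4) ℤ :=
  !![1, 0, 0, 0; 1, 1, 0, 1; 2, 1, 1, 1; 1, 1, 0, 1]

theorem mem_pIdeal_zero {ϖ : Uniformizer F} {x : F} :
    x ∈ pIdeal ϖ 0 ↔ valuation F x ≤ 1 := by
  simp [pIdeal]

theorem val_pos (ϖ : Uniformizer F) : 0 < valuation F (ϖ.1 : F) :=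
  Valuation.integer.v_irreducible_pos ϖ.2

theorem val_lt_one (ϖ : Uniformizer F) : valuation F (ϖ.1 : F) < 1 :=
  Valuation.integer.v_irreducible_lt_one ϖ.2

theorem coe_ne_zero (ϖ : Uniformizer F) : (ϖ.1 : F) ≠ 0 := by
  intro h
  have := val_pos ϖ
  simp [h] at this

theorem mem_pIdeal_one {ϖ : Uniformizer F} {x : F} :
    x ∈ pIdeal ϖ 1 ↔ valuation F x < 1 := by
  simp only [pIdeal, zpow_one, Set.mem_ofPred_eq]
  refine ⟨fun h => h.trans_lt (val_lt_one ϖ), fun h => ?_⟩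
  have hx : (⟨x, h.le⟩ : 𝒪[F]) ∈ IsLocalRing.maximalIdeal 𝒪[F] := by
    rw [IsLocalRing.mem_maximalIdeal, mem_nonunits_iff, Valuation.Integer.not_isUnit_iff_valuation_lt_one]
    exact h
  rw [(IsDiscreteValuationRing.irreducible_iff_uniformizer _).1 ϖ.2,
    Ideal.mem_span_singleton] at hx
  exact (Valuation.integer.integers (valuation F)).le_of_dvd hx

theorem pIdeal_add {ϖ : Uniformizer F} {n : ℤ} {x y : F} (hx : x ∈ pIdeal ϖ n)
    (hy : y ∈ pIdeal ϖ n) : x + y ∈ pIdeal ϖ n :=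
  show valuation F (x + y) ≤ _ from Valuation.map_add_le _ hx hy

theorem pIdeal_mul {ϖ : Uniformizer F} {m n : ℤ} {x y : F} (hx : x ∈ pIdeal ϖ m)
    (hy : y ∈ pIdeal ϖ n) : x * y ∈ pIdeal ϖ (m + n) := by
  simp only [pIdeal, Set.mem_ofPred_eq, map_mul] at *
  rw [zpow_add₀ (val_pos ϖ).ne']
  exact mul_le_mul' hx hy

theorem pIdeal_anti {ϖ : Uniformizer F} {m n : ℤ} (h : m ≤ n) {x : F} (hx : x ∈ pIdeal ϖ n) :
    x ∈ pIdeal ϖ m :=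
  show valuation F x ≤ _ from
    le_trans hx (zpow_le_zpow_right_of_le_one₀ (val_pos ϖ) (val_lt_one ϖ).le h)

/-- The standard paramodular subgroup of `GSp(4, F)`: the similitude factor is a unit and the
entries lie in the prescribed powers of `𝔭`. -/
def paramodular (ϖ : Uniformizer F) : Subgroup (GSp4 F) where
  carrier := {x | valuation F (simi x : F) = 1 ∧ ∀ i j, mat x i j ∈ pIdeal ϖ (expJ i j)}
  one_mem' := by
    refine ⟨by simp, fun i j => ?_⟩
    rw [mat_one]
    fin_cases i <;> fin_cases j <;> simp [pIdeal, expJ]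
  mul_mem' := by
    rintro x y ⟨hx, hx'⟩ ⟨hy, hy'⟩
    refine ⟨by simp [hx, hy], fun i j => ?_⟩
    have key : ∀ l, mat x i l * mat y l j ∈ pIdeal ϖ (expJ i j) := fun l =>
      pIdeal_anti (by revert i j l; decide) (pIdeal_mul (hx' i l) (hy' l j))
    rw [mat_mul, Matrix.mul_apply, Fin.sum_univ_four]
    exact pIdeal_add (pIdeal_add (pIdeal_add (key 0) (key 1)) (key 2)) (key 3)
  inv_mem' := by
    rintro x ⟨hx, hx'⟩
    refine ⟨by simp [hx], fun i j => ?_⟩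
    obtain ⟨e, he, h⟩ := mat_inv_apply x i j
    have h1 : valuation F e = 1 := by
      rcases he with rfl | rfl <;> simp
    have h2 : ∀ i j, expJ (dualIdx j) (dualIdx i) = expJ i j := by
      intro i j
      fin_cases i <;> fin_cases j <;> rfl
    have h3 := hx' (dualIdx j) (dualIdx i)
    rw [h2 i j] at h3
    simpa [h, pIdeal, h1, hx] using h3

/-- The reduction modulo `𝔭` of an element of `F`, with junk value zero outside `𝒪[F]`. -/
def red (x : F) : 𝓀[F] := by
  classical
  exact if h : valuation F x ≤ 1 then IsLocalRing.residue 𝒪[F] ⟨x, h⟩ else 0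

theorem red_of_le {x : F} (h : valuation F x ≤ 1) :
    red x = IsLocalRing.residue 𝒪[F] ⟨x, h⟩ := by
  simp [red, h]

theorem red_coe (x : 𝒪[F]) : red (x : F) = IsLocalRing.residue 𝒪[F] x := red_of_le x.2

theorem red_one : red (1 : F) = 1 := by
  rw [red_of_le (by simp)]
  exact map_one (IsLocalRing.residue 𝒪[F])

theorem red_add {x y : F} (hx : valuation F x ≤ 1) (hy : valuation F y ≤ 1) :
    red (x + y) = red x + red y := by
  rw [red_of_le hx, red_of_le hy, ← map_add]
  exact red_of_le (Valuation.map_add_le _ hx hy)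

theorem red_neg {x : F} (hx : valuation F x ≤ 1) : red (-x) = -red x := by
  rw [red_of_le hx, ← map_neg]
  exact red_of_le (by simpa using hx)

theorem red_mul {x y : F} (hx : valuation F x ≤ 1) (hy : valuation F y ≤ 1) :
    red (x * y) = red x * red y := by
  rw [red_of_le hx, red_of_le hy, ← map_mul]
  exact red_of_le (by simpa using mul_le_one' hx hy)

theorem red_eq_zero {x : F} (hx : valuation F x < 1) : red x = 0 := by
  rw [red_of_le hx.le, IsLocalRing.residue_eq_zero_iff, IsLocalRing.mem_maximalIdeal,
    mem_nonunits_iff, Valuation.Integer.not_isUnit_iff_valuation_lt_one]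
  exact hx

theorem red_eq_zero_iff {x : F} (hx : valuation F x ≤ 1) : red x = 0 ↔ valuation F x < 1 := by
  refine ⟨fun h => ?_, red_eq_zero⟩
  rwa [red_of_le hx, IsLocalRing.residue_eq_zero_iff, IsLocalRing.mem_maximalIdeal,
    mem_nonunits_iff, Valuation.Integer.not_isUnit_iff_valuation_lt_one] at h

/-- Exponents of the diagonal matrix `diag(1, 1, ϖ, 1)`, conjugation by which moves the
paramodular group into the integral matrices. -/
def expD : Fin 4 → ℤ := ![0, 0, 1, 0]

/-- The diagonal entries of `diag(1, 1, ϖ, 1)`. -/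
def scal (ϖ : Uniformizer F) (i : Fin 4) : F := (ϖ.1 : F) ^ expD i

/-- The conjugate of a matrix by `diag(1, 1, ϖ, 1)`. -/
def conjD (ϖ : Uniformizer F) (M : Matrix (Fin 4) (Fin 4) F) (i j : Fin 4) : F :=
  (scal ϖ i)⁻¹ * M i j * scal ϖ j

theorem scal_ne_zero (ϖ : Uniformizer F) (i : Fin 4) : scal ϖ i ≠ 0 :=
  zpow_ne_zero _ (coe_ne_zero ϖ)

theorem conjD_mul (ϖ : Uniformizer F) (M N : Matrix (Fin 4) (Fin 4) F) (i j : Fin 4) :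
    conjD ϖ (M * N) i j = conjD ϖ M i 0 * conjD ϖ N 0 j + conjD ϖ M i 1 * conjD ϖ N 1 j +
      conjD ϖ M i 2 * conjD ϖ N 2 j + conjD ϖ M i 3 * conjD ϖ N 3 j := by
  have key : ∀ l, conjD ϖ M i l * conjD ϖ N l j =
      (scal ϖ i)⁻¹ * (M i l * N l j) * scal ϖ j := by
    intro l
    have := scal_ne_zero ϖ l
    simp only [conjD]
    field_simp
  rw [key, key, key, key, conjD, Matrix.mul_apply, Fin.sum_univ_four]
  ring

theorem conjD_mem_iff {ϖ : Uniformizer F} {M : Matrix (Fin 4) (Fin 4) F} {i j : Fin 4} {n : ℤ} :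
    conjD ϖ M i j ∈ pIdeal ϖ n ↔ M i j ∈ pIdeal ϖ (n + expD i - expD j) := by
  have h0 := (val_pos ϖ).ne'
  have hs : ∀ i, scal ϖ i ∈ pIdeal ϖ (expD i) ∧ (scal ϖ i)⁻¹ ∈ pIdeal ϖ (-expD i) := by
    intro i
    simp [scal, pIdeal]
  constructor
  · intro h
    have := pIdeal_mul (pIdeal_mul (hs i).1 h) (hs j).2
    have e : scal ϖ i * conjD ϖ M i j * (scal ϖ j)⁻¹ = M i j := by
      have h1 := scal_ne_zero ϖ i
      have h2 := scal_ne_zero ϖ j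
      simp only [conjD]
      field_simp
    rw [e] at this
    convert this using 2
    ring
  · intro h
    have := pIdeal_mul (pIdeal_mul (hs i).2 h) (hs j).1
    have e : -expD i + (n + expD i - expD j) + expD j = n := by ring
    rwa [e] at this

theorem conjD_le (ϖ : Uniformizer F) (x : paramodular ϖ) (i j : Fin 4) :
    valuation F (conjD ϖ (mat x.1) i j) ≤ 1 := by
  rw [← mem_pIdeal_zero (ϖ := ϖ), conjD_mem_iff]
  refine pIdeal_anti ?_ (x.2.2 i j)
  fin_cases i <;> fin_cases j <;> simp [expD, expJ]

theorem conjD_lt (ϖ : Uniformizer F) (x : paramodular ϖ) (i j : Fin 4)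
    (hi : i = 1 ∨ i = 3) (hj : j = 0 ∨ j = 2) :
    red (conjD ϖ (mat x.1) i j) = 0 := by
  apply red_eq_zero
  rw [← mem_pIdeal_one (ϖ := ϖ), conjD_mem_iff]
  refine pIdeal_anti ?_ (x.2.2 i j)
  rcases hi with rfl | rfl <;> rcases hj with rfl | rfl <;> simp [expD, expJ]

theorem red_conjD_mul (ϖ : Uniformizer F) (x y : paramodular ϖ) (i j : Fin 4) :
    red (conjD ϖ (mat (x * y).1) i j) =
      red (conjD ϖ (mat x.1) i 0) * red (conjD ϖ (mat y.1) 0 j) +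
      red (conjD ϖ (mat x.1) i 1) * red (conjD ϖ (mat y.1) 1 j) +
      red (conjD ϖ (mat x.1) i 2) * red (conjD ϖ (mat y.1) 2 j) +
      red (conjD ϖ (mat x.1) i 3) * red (conjD ϖ (mat y.1) 3 j) := by
  have h : ∀ l, valuation F (conjD ϖ (mat x.1) i l * conjD ϖ (mat y.1) l j) ≤ 1 := fun l => by
    rw [map_mul]
    exact mul_le_one' (conjD_le ϖ x i l) (conjD_le ϖ y l j)
  rw [Subgroup.coe_mul, mat_mul, conjD_mul,
    red_add (Valuation.map_add_le _ (Valuation.map_add_le _ (h 0) (h 1)) (h 2)) (h 3),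
    red_add (Valuation.map_add_le _ (h 0) (h 1)) (h 2), red_add (h 0) (h 1)]
  simp only [red_mul (conjD_le ϖ x i _) (conjD_le ϖ y _ j)]

theorem conjD_one (ϖ : Uniformizer F) (i j : Fin 4) :
    conjD ϖ (1 : Matrix (Fin 4) (Fin 4) F) i j = (1 : Matrix (Fin 4) (Fin 4) F) i j := by
  by_cases h : i = j
  · subst h
    simp [conjD, scal_ne_zero]
  · simp [conjD, h]

/-- The first component `(x₁₁, x₁₃ ϖ; x₃₁ ϖ⁻¹, x₃₃)` of the projection of the paramodular group to
its Levi quotient. -/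
def leviFstMat (ϖ : Uniformizer F) (x : GSp4 F) : Matrix (Fin 2) (Fin 2) 𝓀[F] :=
  !![red (mat x 0 0), red (mat x 0 2 * ϖ.1); red (mat x 2 0 * (ϖ.1 : F)⁻¹), red (mat x 2 2)]

/-- The second component `(x₂₂, x₂₄; x₄₂, x₄₄)` of the projection of the paramodular group to its
Levi quotient. -/
def leviSndMat (x : GSp4 F) : Matrix (Fin 2) (Fin 2) 𝓀[F] :=
  !![red (mat x 1 1), red (mat x 1 3); red (mat x 3 1), red (mat x 3 3)]

theorem leviFstMat_eq (ϖ : Uniformizer F) (x : GSp4 F) : leviFstMat ϖ x =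
    !![red (conjD ϖ (mat x) 0 0), red (conjD ϖ (mat x) 0 2);
      red (conjD ϖ (mat x) 2 0), red (conjD ϖ (mat x) 2 2)] := by
  have h := coe_ne_zero ϖ
  have h1 : (ϖ.1 : F)⁻¹ * mat x 2 2 * ϖ.1 = mat x 2 2 := by field_simp
  simp [leviFstMat, conjD, scal, expD, h1, mul_comm]

theorem leviSndMat_eq (ϖ : Uniformizer F) (x : GSp4 F) : leviSndMat x =
    !![red (conjD ϖ (mat x) 1 1), red (conjD ϖ (mat x) 1 3);
      red (conjD ϖ (mat x) 3 1), red (conjD ϖ (mat x) 3 3)] := by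
  simp [leviSndMat, conjD, scal, expD]

/-- The first component of the projection to the Levi quotient, as a homomorphism. -/
def leviFst (ϖ : Uniformizer F) : paramodular ϖ →* GL2 𝓀[F] :=
  MonoidHom.toHomUnits
    { toFun := fun x => leviFstMat ϖ x.1
      map_one' := by
        rw [leviFstMat_eq, Subgroup.coe_one, mat_one]
        simp only [conjD_one]
        ext i j
        fin_cases i <;> fin_cases j <;> simp [red_one, red_eq_zero]
      map_mul' := by
        intro x y
        simp only [leviFstMat_eq, red_conjD_mul]
        ext i j
        fin_cases i <;> fin_cases j <;>
          simp [Matrix.mul_apply, Fin.sum_univ_two, conjD_lt] }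

/-- The second component of the projection to the Levi quotient, as a homomorphism. -/
def leviSnd (ϖ : Uniformizer F) : paramodular ϖ →* GL2 𝓀[F] :=
  MonoidHom.toHomUnits
    { toFun := fun x => leviSndMat x.1
      map_one' := by
        rw [leviSndMat_eq ϖ, Subgroup.coe_one, mat_one]
        simp only [conjD_one]
        ext i j
        fin_cases i <;> fin_cases j <;> simp [red_one, red_eq_zero]
      map_mul' := by
        intro x y
        simp only [leviSndMat_eq ϖ, red_conjD_mul]
        ext i j
        fin_cases i <;> fin_cases j <;>
          simp [Matrix.mul_apply, Fin.sum_univ_two, conjD_lt] }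

theorem val_sub_le {x y : F} (hx : valuation F x ≤ 1) (hy : valuation F y ≤ 1) :
    valuation F (x - y) ≤ 1 :=
  (Valuation.map_sub _ x y).trans (max_le hx hy)

theorem red_sub {x y : F} (hx : valuation F x ≤ 1) (hy : valuation F y ≤ 1) :
    red (x - y) = red x - red y := by
  rw [sub_eq_add_neg, red_add hx (by simpa using hy), red_neg hy, sub_eq_add_neg]

theorem red_of_sub_lt {x y z : F} (hx : valuation F x ≤ 1) (hy : valuation F y ≤ 1)
    {s t : F} (hz : z = x - y + (s - t)) (hs : valuation F s < 1) (ht : valuation F t < 1) :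
    red z = red x - red y := by
  have h1 : valuation F (s - t) < 1 := Valuation.map_sub_lt _ hs ht
  rw [hz, red_add (val_sub_le hx hy) h1.le, red_eq_zero h1, add_zero, red_sub hx hy]

theorem simi_eq_fst (x : GSp4 F) : (simi x : F) =
    mat x 0 0 * mat x 2 2 - mat x 0 2 * mat x 2 0 +
      (mat x 0 1 * mat x 2 3 - mat x 0 3 * mat x 2 1) := by
  have h := congrFun (congrFun (mat_rel x) 0) 2
  simp only [Matrix.mul_apply, Fin.sum_univ_four, Matrix.transpose_apply, Matrix.smul_apply] at h
  simp [Jform] at h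
  rw [← h]
  ring

theorem simi_eq_snd (x : GSp4 F) : (simi x : F) =
    mat x 1 1 * mat x 3 3 - mat x 1 3 * mat x 3 1 +
      (mat x 1 0 * mat x 3 2 - mat x 1 2 * mat x 3 0) := by
  have h := congrFun (congrFun (mat_rel x) 1) 3
  simp only [Matrix.mul_apply, Fin.sum_univ_four, Matrix.transpose_apply, Matrix.smul_apply] at h
  simp [Jform] at h
  rw [← h]
  ring

theorem entry_mul_mem (ϖ : Uniformizer F) (x : paramodular ϖ) (i j k l : Fin 4) (n : ℤ)
    (h : n ≤ expJ i j + expJ k l) : mat x.1 i j * mat x.1 k l ∈ pIdeal ϖ n :=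
  pIdeal_anti h (pIdeal_mul (x.2.2 i j) (x.2.2 k l))

theorem det_leviFstMat (ϖ : Uniformizer F) (x : paramodular ϖ) :
    (leviFstMat ϖ x.1).det = red (simi x.1 : F) := by
  have h := coe_ne_zero ϖ
  have hc := fun i j => conjD_le ϖ x i j
  rw [leviFstMat_eq, Matrix.det_fin_two_of, ← red_mul (hc _ _) (hc _ _),
    ← red_mul (hc _ _) (hc _ _), simi_eq_fst]
  have e1 : conjD ϖ (mat x.1) 0 0 * conjD ϖ (mat x.1) 2 2 = mat x.1 0 0 * mat x.1 2 2 := by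
    simp only [conjD, scal, expD, Matrix.cons_val, zpow_zero, zpow_one]
    field_simp
  have e2 : conjD ϖ (mat x.1) 0 2 * conjD ϖ (mat x.1) 2 0 = mat x.1 0 2 * mat x.1 2 0 := by
    simp only [conjD, scal, expD, Matrix.cons_val, zpow_zero, zpow_one]
    field_simp
  rw [e1, e2]
  refine (red_of_sub_lt (mem_pIdeal_zero.1 (entry_mul_mem ϖ x _ _ _ _ _ ?_))
    (mem_pIdeal_zero.1 (entry_mul_mem ϖ x _ _ _ _ _ ?_)) rfl
    (mem_pIdeal_one.1 (entry_mul_mem ϖ x _ _ _ _ _ ?_))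
    (mem_pIdeal_one.1 (entry_mul_mem ϖ x _ _ _ _ _ ?_))).symm <;> simp [expJ]

theorem det_leviSndMat (ϖ : Uniformizer F) (x : paramodular ϖ) :
    (leviSndMat x.1).det = red (simi x.1 : F) := by
  have hc := fun i j (h : expJ i j = 0) => mem_pIdeal_zero.1 (h ▸ x.2.2 i j)
  rw [leviSndMat, Matrix.det_fin_two_of, ← red_mul (hc _ _ rfl) (hc _ _ rfl),
    ← red_mul (hc _ _ rfl) (hc _ _ rfl), simi_eq_snd]
  refine (red_of_sub_lt (mem_pIdeal_zero.1 (entry_mul_mem ϖ x _ _ _ _ _ ?_))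
    (mem_pIdeal_zero.1 (entry_mul_mem ϖ x _ _ _ _ _ ?_)) rfl
    (mem_pIdeal_one.1 (entry_mul_mem ϖ x _ _ _ _ _ ?_))
    (mem_pIdeal_one.1 (entry_mul_mem ϖ x _ _ _ _ _ ?_))).symm <;> simp [expJ]

/-- The projection of the paramodular group to its Levi quotient `(GL(2, 𝓀[F])²)⁰`. -/
def leviMap (ϖ : Uniformizer F) : paramodular ϖ →* GL2sq0 𝓀[F] :=
  MonoidHom.codRestrict ((leviFst ϖ).prod (leviSnd ϖ)) (GL2sq0 𝓀[F]) (by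
    intro x
    apply Units.ext
    exact (det_leviFstMat ϖ x).trans (det_leviSndMat ϖ x).symm)

theorem red_conjD_eq_iff (ϖ : Uniformizer F) (x : paramodular ϖ) (i j : Fin 4) :
    red (conjD ϖ (mat x.1) i j) = (1 : Matrix (Fin 4) (Fin 4) 𝓀[F]) i j ↔
      mat x.1 i j - (1 : Matrix (Fin 4) (Fin 4) F) i j ∈ pIdeal ϖ (1 + expD i - expD j) := by
  have h1 : red ((1 : Matrix (Fin 4) (Fin 4) F) i j) = (1 : Matrix (Fin 4) (Fin 4) 𝓀[F]) i j := by
    by_cases h : i = j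
    · subst h
      simp [red_one]
    · simp [h, red_eq_zero]
  have h2 : valuation F ((1 : Matrix (Fin 4) (Fin 4) F) i j) ≤ 1 := by
    by_cases h : i = j
    · subst h
      simp
    · simp [h]
  have h3 : conjD ϖ (mat x.1) i j - (1 : Matrix (Fin 4) (Fin 4) F) i j =
      conjD ϖ (mat x.1 - 1) i j := by
    rw [← conjD_one ϖ]
    simp only [conjD, Matrix.sub_apply]
    ring
  rw [← h1, ← sub_eq_zero, ← red_sub (conjD_le ϖ x i j) h2,
    red_eq_zero_iff (val_sub_le (conjD_le ϖ x i j) h2), h3,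
    ← mem_pIdeal_one (ϖ := ϖ), conjD_mem_iff, Matrix.sub_apply]

theorem mem_ker_leviMap (ϖ : Uniformizer F) (x : paramodular ϖ) : x ∈ (leviMap ϖ).ker ↔
    ∀ i j, mat x.1 i j - (1 : Matrix (Fin 4) (Fin 4) F) i j ∈ pIdeal ϖ (expJplus i j) := by
  have h1 : x ∈ (leviMap ϖ).ker ↔ leviFstMat ϖ x.1 = 1 ∧ leviSndMat x.1 = 1 := by
    rw [MonoidHom.mem_ker, Subtype.ext_iff, Prod.ext_iff, Units.ext_iff, Units.ext_iff]
    rfl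
  have hin : ∀ i j, expJplus i j = 1 + expD i - expD j →
      (mat x.1 i j - (1 : Matrix (Fin 4) (Fin 4) F) i j ∈ pIdeal ϖ (expJplus i j) ↔
        red (conjD ϖ (mat x.1) i j) = (1 : Matrix (Fin 4) (Fin 4) 𝓀[F]) i j) := by
    intro i j h
    rw [h, red_conjD_eq_iff]
  have hoff : ∀ i j, i ≠ j → expJplus i j = expJ i j →
      mat x.1 i j - (1 : Matrix (Fin 4) (Fin 4) F) i j ∈ pIdeal ϖ (expJplus i j) := by
    intro i j hij h
    rw [h, Matrix.one_apply_ne hij, sub_zero]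
    exact x.2.2 i j
  rw [h1, leviFstMat_eq, leviSndMat_eq ϖ]
  constructor
  · rintro ⟨ha, hb⟩ i j
    have ha' := fun i j => congrFun (congrFun ha i) j
    have hb' := fun i j => congrFun (congrFun hb i) j
    have p00 := (hin 0 0 (by simp [expD, expJplus])).2 (by simpa using ha' 0 0)
    have p01 := hoff 0 1 (by decide) (by simp [expJ, expJplus])
    have p02 := (hin 0 2 (by simp [expD, expJplus])).2 (by simpa using ha' 0 1)
    have p03 := hoff 0 3 (by decide) (by simp [expJ, expJplus])
    have p10 := hoff 1 0 (by decide) (by simp [expJ, expJplus])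
    have p11 := (hin 1 1 (by simp [expD, expJplus])).2 (by simpa using hb' 0 0)
    have p12 := hoff 1 2 (by decide) (by simp [expJ, expJplus])
    have p13 := (hin 1 3 (by simp [expD, expJplus])).2 (by simpa using hb' 0 1)
    have p20 := (hin 2 0 (by simp [expD, expJplus])).2 (by simpa using ha' 1 0)
    have p21 := hoff 2 1 (by decide) (by simp [expJ, expJplus])
    have p22 := (hin 2 2 (by simp [expD, expJplus])).2 (by simpa using ha' 1 1)
    have p23 := hoff 2 3 (by decide) (by simp [expJ, expJplus])
    have p30 := hoff 3 0 (by decide) (by simp [expJ, expJplus])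
    have p31 := (hin 3 1 (by simp [expD, expJplus])).2 (by simpa using hb' 1 0)
    have p32 := hoff 3 2 (by decide) (by simp [expJ, expJplus])
    have p33 := (hin 3 3 (by simp [expD, expJplus])).2 (by simpa using hb' 1 1)
    fin_cases i <;> fin_cases j <;> assumption
  · intro h
    have h' := fun i j e => (hin i j e).1 (h i j)
    constructor
    · rw [h' 0 0 (by simp [expD, expJplus]), h' 0 2 (by simp [expD, expJplus]), h' 2 0 (by simp [expD, expJplus]), h' 2 2 (by simp [expD, expJplus])]
      ext i j
      fin_cases i <;> fin_cases j <;> simp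
    · rw [h' 1 1 (by simp [expD, expJplus]), h' 1 3 (by simp [expD, expJplus]), h' 3 1 (by simp [expD, expJplus]), h' 3 3 (by simp [expD, expJplus])]
      ext i j
      fin_cases i <;> fin_cases j <;> simp

/-- The pro-unipotent radical of the paramodular group. -/
def paramodularPlus (ϖ : Uniformizer F) : Subgroup (paramodular ϖ) :=
  (leviMap ϖ).ker.copy
    {x | ∀ i j, mat x.1 i j - (1 : Matrix (Fin 4) (Fin 4) F) i j ∈ pIdeal ϖ (expJplus i j)}
    (Set.ext fun x => (mem_ker_leviMap ϖ x).symm)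

theorem leviMap_ker (ϖ : Uniformizer F) : (leviMap ϖ).ker = paramodularPlus ϖ :=
  (Subgroup.copy_eq _ _ _).symm

theorem exists_lift (a : GL2 𝓀[F]) : ∃ A : Matrix (Fin 2) (Fin 2) 𝒪[F],
    (∀ i j, IsLocalRing.residue 𝒪[F] (A i j) = a.1 i j) ∧ IsUnit A.det := by
  choose A hA using fun i j => IsLocalRing.residue_surjective (R := 𝒪[F]) (a.1 i j)
  refine ⟨Matrix.of A, hA, ?_⟩
  have h : IsLocalRing.residue 𝒪[F] (Matrix.of A).det = a.1.det := by
    simp [Matrix.det_fin_two, hA]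
  by_contra hu
  have h0 : IsLocalRing.residue 𝒪[F] (Matrix.of A).det = 0 :=
    (IsLocalRing.residue_eq_zero_iff _).2 ((IsLocalRing.mem_maximalIdeal _).2 hu)
  exact ((Matrix.isUnit_iff_isUnit_det _).1 a.isUnit).ne_zero (h ▸ h0)

theorem exists_lift_pair (x : GL2sq0 𝓀[F]) : ∃ A B : Matrix (Fin 2) (Fin 2) 𝒪[F],
    (∀ i j, IsLocalRing.residue 𝒪[F] (A i j) = x.1.1.1 i j) ∧
    (∀ i j, IsLocalRing.residue 𝒪[F] (B i j) = x.1.2.1 i j) ∧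
    A.det = B.det ∧ IsUnit A.det := by
  obtain ⟨A, hA, u, hu⟩ := exists_lift x.1.1
  obtain ⟨B, hB, w, hw⟩ := exists_lift x.1.2
  have hdet : x.1.1.1.det = x.1.2.1.det := congrArg Units.val x.2
  have h1 : IsLocalRing.residue 𝒪[F] u = x.1.1.1.det := by
    simp [hu, Matrix.det_fin_two, hA]
  have h2 : IsLocalRing.residue 𝒪[F] w = x.1.1.1.det := by
    rw [hdet]
    simp [hw, Matrix.det_fin_two, hB]
  have h3 : IsLocalRing.residue 𝒪[F] ((u * w⁻¹ : 𝒪[F]ˣ) : 𝒪[F]) = 1 := by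
    have h4 : IsLocalRing.residue 𝒪[F] ((u * w⁻¹ : 𝒪[F]ˣ) : 𝒪[F]) *
        IsLocalRing.residue 𝒪[F] w = IsLocalRing.residue 𝒪[F] w := by
      rw [← map_mul, ← Units.val_mul, inv_mul_cancel_right, h1, h2]
    refine mul_right_cancel₀ ?_ (h4.trans (one_mul _).symm)
    rw [h2]
    exact ((Matrix.isUnit_iff_isUnit_det _).1 x.1.1.isUnit).ne_zero
  refine ⟨A, !![(u * w⁻¹ : 𝒪[F]ˣ) * B 0 0, (u * w⁻¹ : 𝒪[F]ˣ) * B 0 1; B 1 0, B 1 1], hA,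
    ?_, ?_, ⟨u, hu⟩⟩
  · intro i j
    rw [← hB]
    fin_cases i <;> fin_cases j <;> simp [-Units.val_mul, h3]
  · rw [Matrix.det_fin_two_of, ← hu]
    have h5 : ((u * w⁻¹ : 𝒪[F]ˣ) : 𝒪[F]) * B.det = u := by
      rw [← hw, ← Units.val_mul, inv_mul_cancel_right]
    rw [Matrix.det_fin_two] at h5
    rw [← h5]
    ring

theorem leviMap_surjective (ϖ : Uniformizer F) : Function.Surjective (leviMap ϖ) := by
  intro y
  obtain ⟨A, B, hA, hB, hdet, c, hc⟩ := exists_lift_pair y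
  have h0 := coe_ne_zero ϖ
  have hv0 := (val_pos ϖ).ne'
  have hle : ∀ a : 𝒪[F], valuation F (a : F) ≤ 1 := fun a => a.2
  have hcA : ((unitsIncl F c : Fˣ) : F) = A 0 0 * A 1 1 - A 0 1 * A 1 0 := by
    have : (c : 𝒪[F]) = A 0 0 * A 1 1 - A 0 1 * A 1 0 := by rw [hc, Matrix.det_fin_two]
    exact congrArg Subtype.val this
  have hcB : ((unitsIncl F c : Fˣ) : F) = B 0 0 * B 1 1 - B 0 1 * B 1 0 := by
    have : (c : 𝒪[F]) = B 0 0 * B 1 1 - B 0 1 * B 1 0 := by rw [hc, hdet, Matrix.det_fin_two]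
    exact congrArg Subtype.val this
  let M : Matrix (Fin 4) (Fin 4) F :=
    !![A 0 0, 0, A 0 1 * (ϖ.1 : F)⁻¹, 0;
      0, B 0 0, 0, B 0 1;
      A 1 0 * ϖ.1, 0, A 1 1, 0;
      0, B 1 0, 0, B 1 1]
  have hM : M * Jform F * Mᵀ = ((unitsIncl F c : Fˣ) : F) • Jform F := by
    ext i j
    simp only [Matrix.smul_apply, Matrix.mul_apply, Fin.sum_univ_four, Matrix.transpose_apply,
      smul_eq_mul]
    fin_cases i <;> fin_cases j <;> simp [M, Jform]
    · ring
    · rw [hcA]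
      field_simp
      ring
    · ring
    · rw [hcB]
      ring
    · rw [hcA]
      field_simp
      ring
    · ring
    · rw [hcB]
      ring
    · ring
  have hmem : mkGSp4 M (unitsIncl F c) hM ∈ paramodular ϖ := by
    refine ⟨?_, fun i j => ?_⟩
    · rw [simi_mkGSp4]
      exact (Valuation.integer.integers (valuation F)).valuation_unit c
    · rw [mat_mkGSp4]
      fin_cases i <;> fin_cases j <;>
        simp [M, pIdeal, expJ, hle]
      · exact mul_le_of_le_one_left' (hle _)
      · exact mul_le_of_le_one_left' (hle _)
  refine ⟨⟨_, hmem⟩, Subtype.ext (Prod.ext (Units.ext ?_) (Units.ext ?_))⟩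
  · change leviFstMat ϖ (mkGSp4 M (unitsIncl F c) hM) = _
    rw [leviFstMat, mat_mkGSp4]
    ext i j
    rw [← hA]
    fin_cases i <;> fin_cases j <;> simp [M, h0, red_coe]
  · change leviSndMat (mkGSp4 M (unitsIncl F c) hM) = _
    rw [leviSndMat, mat_mkGSp4]
    ext i j
    rw [← hB]
    fin_cases i <;> fin_cases j <;> simp [M, red_coe]

/-- The parahoric restriction of a representation of `GSp(4, F)` at the standard paramodular
subgroup: the action of its Levi quotient `(GL(2, 𝓀[F])²)⁰` on the invariants under its
pro-unipotent radical. -/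
abbrev paramodularRes (ϖ : Uniformizer F) (ρ : Representation ℂ (GSp4 F) V) :
    Representation ℂ (GL2sq0 𝓀[F])
      (Representation.invariants
        ((ρ.comp (paramodular ϖ).subtype).comp (paramodularPlus ϖ).subtype)) :=
  parRes (paramodular ϖ).subtype (paramodularPlus ϖ) (leviMap ϖ) (leviMap_surjective ϖ)
    (leviMap_ker ϖ) ρ

end Local

end ParahoricRes

end

/-! Write P for the Siegel parabolic, J for the paramodular group and I⁺ for the pro-unipotent
radical of the Iwahori subgroup of GL(2,F). Since G = PJ (`exists_siegel_mul_paramodular`), Mackey's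
formula has a single term: the parahoric restriction of σ ⋊ μ₀ is coinduced from the inducing
representation of P ∩ J along P ∩ J → J/J⁺ (`isParamodularRes_siegelParInd`). The image of this map
is the group B of pairs of upper triangular matrices, and the functions take values in vectors fixed
by its kernel, hence in the I⁺-fixed vectors of σ.

If the upper left block of an element of P ∩ J has diagonal (a, b) modulo I⁺, then a and b reduce to
the upper left entries of the two components in J/J⁺, and the similitude reduces to their common
determinant (`siegelPar_decomp`). The modulus character is trivial on P ∩ J. So a basis of torus
eigenvectors in the I⁺-fixed vectors, with characters (χ₁, χ₂), decomposes the restriction into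
representations induced from the character χ₀(det) χ₁(a₁₁) χ₂(b₁₁) of B
(`nonempty_equiv_of_eigenvectors`, `nonempty_equiv_of_eigenvector`). Such a representation is χ₀[χ₁
× 1, χ₂ × 1], and χ × 1 ≅ 1 × χ over a finite field by the standard intertwining operator
(`nonempty_bracketInd_equiv`, `nonempty_prinInd_equiv_swap`).

It remains to find the I⁺-fixed vectors. As GL(2,F) is covered by the double cosets of 1 and w for
the Borel subgroup and I⁺, a tame principal series has two eigenvectors, with characters (χ₁, χ₂)
and (χ₂, χ₁). A tame twist of St or of the trivial representation has one, with characters (χ, χ).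
If μ₁ or μ₂ is not tame there are none, and if μ₀ is not tame the scalars diag(1, 1, c, c) kill
everything; then both sides vanish.

For cuspidal σ there are no I⁺-fixed vectors (`IsCuspidal.eq_zero_of_fixed`). The Hecke operator U
of diag(ϖ, 1) is injective on them. Let v be I⁺-fixed and N_m the group of unipotents with entry in
ϖ⁻ᵐ𝒪. Since the Jacquet module vanishes, v dies in the N_m-coinvariants for some m. But diag(ϖ⁻ᵐ, 1)
Uᵐ v is N_m-fixed and has the same class as qᵐ v, so averaging over N_m shows that it is zero,
whence v = 0. -/

noncomputable section

namespace ParahoricRes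

/-! ### Coinduced representations and coset representatives -/

section Coinduction

variable {G H : Type*} [Group G] [Group H]

theorem charRep_apply (χ : G →* ℂˣ) (g : G) (z : ℂ) : charRep χ g z = χ g * z := rfl

/-- An intertwining bijection, as an equivalence of representations. -/
def equivOfBijective {G : Type*} [Monoid G] {V W : Type*} [AddCommMonoid V] [Module ℂ V]
    [AddCommMonoid W] [Module ℂ W] {ρ : Representation ℂ G V} {σ : Representation ℂ G W} (f : V →ₗ[ℂ] W)
    (hf : Function.Bijective f) (h : ∀ g v, f (ρ g v) = σ g (f v)) : ρ.Equiv σ :=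
  Representation.Equiv.mk (LinearEquiv.ofBijective f hf) fun g => LinearMap.ext fun v => h g v

/-- Coinduction preserves equivalences. -/
def coindEquiv {V W : Type*} [AddCommGroup V] [Module ℂ V] [AddCommGroup W] [Module ℂ W]
    (φ : G →* H) {ρ : Representation ℂ G V} {σ : Representation ℂ G W} (e : ρ.Equiv σ) :
    (Representation.coind φ ρ).Equiv (Representation.coind φ σ) :=
  equivOfBijective (Representation.coindMap φ e.toIntertwiningMap).toLinearMap (by
    constructor
    · intro f f' h
      ext x
      exact e.injective (congrFun (congrArg Subtype.val h) x)
    · intro f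
      refine ⟨Representation.coindMap φ e.symm.toIntertwiningMap f, ?_⟩
      ext x
      exact e.toLinearEquiv.apply_symm_apply (f.1 x))
    fun g v => (Representation.coindMap φ e.toIntertwiningMap).isIntertwining _ _ g v

variable {ι : Type*} (K : Subgroup G) (ψ : K →* ℂˣ) (r : ι → G)

/-- Evaluation of the functions in a coinduced representation at coset representatives. -/
def coindEval : Representation.coindV K.subtype (charRep ψ) →ₗ[ℂ] (ι → ℂ) :=
  (LinearMap.funLeft ℂ ℂ r).comp (Submodule.subtype _)

/-- A function with the transformation law is the same as free values on representatives: `hinj`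
makes the index in g = h rᵢ unique, and cancellation then makes h unique. -/
theorem coindEval_bijective (hr : ∀ g, ∃ (i : ι) (h : K), g = h * r i)
    (hinj : ∀ i j (h : K), r i = h * r j → i = j) :
    Function.Bijective (coindEval K ψ r) := by
  choose p q hpq using hr
  constructor
  · intro f f' h
    ext x
    rw [hpq x]
    have h1 := f.2 (q x) (r (p x))
    have h2 := f'.2 (q x) (r (p x))
    refine h1.trans (Eq.trans ?_ h2.symm)
    exact congrArg _ (congrFun h (p x))
  · intro φ
    -- The chosen decomposition is equivariant, which is what makes g ↦ ψ(q g) φ(p g) transform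
    -- correctly under K.
    have huniq : ∀ (h : K) (g : G), p (h * g) = p g ∧ q (h * g) = h * q g := by
      intro h g
      have e : r (p (h * g)) = ((q (h * g))⁻¹ * (h * q g) : K) * r (p g) := by
        have e1 := hpq (h * g)
        have e2 := hpq g
        push_cast
        rw [mul_assoc, mul_assoc, ← e2, eq_inv_mul_iff_mul_eq]
        exact e1.symm
      have e3 := hinj _ _ _ e
      refine ⟨e3, ?_⟩
      have e1 := hpq (h * g)
      rw [e3] at e1
      nth_rewrite 1 [hpq g] at e1
      rw [← mul_assoc] at e1
      exact (Subtype.ext (mul_right_cancel e1)).symm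
    refine ⟨⟨fun g => ψ (q g) * φ (p g), ?_⟩, ?_⟩
    · intro h g
      change (ψ (q (h * g)) : ℂ) * φ (p (h * g)) = _
      rw [(huniq h g).1, (huniq h g).2, charRep_apply, map_mul, Units.val_mul, mul_assoc]
    · ext i
      change (ψ (q (r i)) : ℂ) * φ (p (r i)) = φ i
      have e := hpq (r i)
      have e1 := hinj _ _ _ e
      have e2 : q (r i) = 1 := by
        rw [← e1] at e
        exact Subtype.ext (mul_eq_right.1 e.symm)
      rw [e2, ← e1]
      simp

end Coinduction

/-! ### Matrix identities and the Bruhat decomposition in GL(2) -/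

section GL2Elements

variable {K : Type*} [Field K]

/-- The unipotent matrix `(1, x; 0, 1)`. -/
def upperUnip (x : K) : GL2 K := Matrix.GeneralLinearGroup.mkOfDetNeZero !![1, x; 0, 1] (by simp)

/-- The unipotent matrix `(1, 0; x, 1)`. -/
def lowerUnip (x : K) : GL2 K := Matrix.GeneralLinearGroup.mkOfDetNeZero !![1, 0; x, 1] (by simp)

/-- The diagonal matrix `(a, 0; 0, b)`. -/
def diagGL (a b : Kˣ) : GL2 K := Matrix.GeneralLinearGroup.mkOfDetNeZero !![(a : K), 0; 0, b]
  (by simp)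

variable (K) in
/-- The Weyl element `(0, 1; -1, 0)`. -/
def weyl : GL2 K := Matrix.GeneralLinearGroup.mkOfDetNeZero !![0, 1; -1, 0] (by simp)

@[simp] theorem val_upperUnip (x : K) : (upperUnip x).1 = !![1, x; 0, 1] := rfl
@[simp] theorem val_lowerUnip (x : K) : (lowerUnip x).1 = !![1, 0; x, 1] := rfl
@[simp] theorem val_diagGL (a b : Kˣ) : (diagGL a b).1 = !![(a : K), 0; 0, b] := rfl
@[simp] theorem val_weyl : (weyl K).1 = !![0, 1; -1, 0] := rfl

theorem GL2_ext {g h : GL2 K} (h00 : g.1 0 0 = h.1 0 0) (h01 : g.1 0 1 = h.1 0 1)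
    (h10 : g.1 1 0 = h.1 1 0) (h11 : g.1 1 1 = h.1 1 1) : g = h := by
  apply Units.ext
  ext i j
  fin_cases i <;> fin_cases j <;> assumption

theorem upperUnip_mem (x : K) : upperUnip x ∈ borel K := rfl

theorem diagGL_mem (a b : Kˣ) : diagGL a b ∈ borel K := rfl

theorem upperUnip_add (x y : K) : upperUnip (x + y) = upperUnip x * upperUnip y := by
  apply GL2_ext <;> simp [add_comm]

theorem upperUnip_zero : upperUnip (0 : K) = 1 := by
  apply GL2_ext <;> simp

theorem diagGL_mul (a b c d : Kˣ) : diagGL (a * c) (b * d) = diagGL a b * diagGL c d := by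
  apply GL2_ext <;> simp

theorem diagGL_one : diagGL (1 : Kˣ) 1 = 1 := by
  apply GL2_ext <;> simp

theorem upperUnip_mul_diagGL (a b : Kˣ) (x : K) :
    upperUnip x * diagGL a b = diagGL a b * upperUnip (x * b * (a : K)⁻¹) := by
  apply GL2_ext <;> simp
  field_simp

theorem weyl_mul_diagGL (a b : Kˣ) : weyl K * diagGL a b = diagGL b a * weyl K := by
  apply GL2_ext <;> simp

/-- The Bruhat decomposition of w n(c) w for c ≠ 0. This rank one relation drives both the finite
intertwining operator and the injectivity of the Hecke operator `weylSum`. -/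
theorem weyl_mul_upperUnip_mul_weyl (c : Kˣ) :
    weyl K * upperUnip (c : K) * weyl K =
      upperUnip (-(c : K)⁻¹) * diagGL (-c⁻¹) (-c) * weyl K * upperUnip (-(c : K)⁻¹) := by
  apply GL2_ext <;> simp

theorem weyl_mul_weyl : weyl K * weyl K = diagGL (-1) (-1) := by
  apply GL2_ext <;> simp

theorem mem_borel {g : GL2 K} : g ∈ borel K ↔ g.1 1 0 = 0 := Iff.rfl

theorem borel_decomp (b : borel K) : (b : GL2 K) =
    diagGL (borelFst K b) (borelSnd K b) * upperUnip (b.1.1 0 1 * (b.1.1 0 0)⁻¹) := by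
  have h := mem_borel.1 b.2
  have h0 := (mul_ne_zero_iff.1 (det_of_lower_zero h)).1
  apply GL2_ext <;> simp [borelFst, borelSnd, h]
  field_simp

theorem borelFst_eq {b : borel K} {a d : Kˣ} {x : K} (h : (b : GL2 K) = diagGL a d * upperUnip x) :
    borelFst K b = a ∧ borelSnd K b = d := by
  constructor <;> ext <;> simp [borelFst, borelSnd, h]

theorem det_diagGL (a b : Kˣ) : Matrix.GeneralLinearGroup.det (diagGL a b) = a * b := by
  ext; simp

theorem det_upperUnip (x : K) : Matrix.GeneralLinearGroup.det (upperUnip x) = 1 := by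
  ext; simp

theorem det_weyl : Matrix.GeneralLinearGroup.det (weyl K) = 1 := by
  ext; simp

/-- Representatives, of determinant one, of the cosets of the Borel subgroup. -/
def bruhatRep : Option K → GL2 K
  | none => 1
  | some x => weyl K * upperUnip x

/-- Determinant one lets any two representatives form an element of `GL2sq0`, and makes twists by a
character of the determinant invisible on representatives. -/
theorem det_bruhatRep (i : Option K) : Matrix.GeneralLinearGroup.det (bruhatRep i) = 1 := by
  cases i <;> simp [bruhatRep, det_weyl, det_upperUnip]

theorem exists_bruhat (g : GL2 K) : ∃ (i : Option K) (b : borel K), g = b * bruhatRep i := by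
  by_cases h : g.1 1 0 = 0
  · exact ⟨none, ⟨g, h⟩, by simp [bruhatRep]⟩
  -- The bottom row of w n(x) is (-1, -x); this x makes it proportional to the bottom row of g.
  · refine ⟨some (g.1 1 1 * (g.1 1 0)⁻¹), ⟨g * (weyl K * upperUnip (g.1 1 1 * (g.1 1 0)⁻¹))⁻¹, ?_⟩,
      by rw [bruhatRep, inv_mul_cancel_right]⟩
    rw [mem_borel]
    have e : (weyl K * upperUnip (g.1 1 1 * (g.1 1 0)⁻¹))⁻¹ =
        upperUnip (-(g.1 1 1 * (g.1 1 0)⁻¹)) * weyl K * diagGL (-1) (-1) := by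
      rw [inv_eq_iff_mul_eq_one]
      apply GL2_ext <;> simp
    rw [e]
    simp only [Units.val_mul, val_upperUnip, val_weyl, val_diagGL, Matrix.mul_apply,
      Fin.sum_univ_two]
    simp
    field_simp
    ring

/-- Left multiplication by the Borel only rescales the bottom row, and the bottom rows of distinct
representatives are distinct points of the projective line. -/
theorem bruhatRep_inj {i j : Option K} {b : borel K} (h : bruhatRep i = b * bruhatRep j) :
    i = j := by
  have hb := mem_borel.1 b.2
  have hd := mul_ne_zero_iff.1 (det_of_lower_zero hb)
  have h0 := congrArg (fun g : GL2 K => g.1 1 0) h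
  have h1 := congrArg (fun g : GL2 K => g.1 1 1) h
  rcases i with _ | x <;> rcases j with _ | y <;>
    simp [bruhatRep, Matrix.mul_apply, Fin.sum_univ_two, hb] at h0 h1 ⊢
  · exact hd.2 h0
  · rw [← h0] at h1
    simpa using h1

end GL2Elements

/-! ### Principal series of GL(2) over a finite field and the swap of characters -/

section FinitePrincipalSeries

variable {k : Type*} [Field k]

/-- The function space of the representation of `GL(2, k)` induced from a pair of characters. -/
abbrev prinIndV (α β : kˣ →* ℂˣ) : Submodule ℂ (GL2 k → ℂ) :=
  Representation.coindV (borel k).subtype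
    (charRep (α.comp (borelFst k) * β.comp (borelSnd k)))

/-- The representation of `GL(2, k)` induced from a pair of characters of the Borel subgroup. -/
abbrev prinInd (α β : kˣ →* ℂˣ) : Representation ℂ (GL2 k) (prinIndV α β) :=
  Representation.coind (borel k).subtype
    (charRep (α.comp (borelFst k) * β.comp (borelSnd k)))

theorem prinInd_borel {α β : kˣ →* ℂˣ} (f : prinIndV α β) (b : borel k) (g : GL2 k) :
    f.1 (b * g) = α (borelFst k b) * β (borelSnd k b) * f.1 g := by
  refine (f.2 b g).trans ?_
  rw [charRep_apply]
  simp

theorem prinInd_diag_unip {α β : kˣ →* ℂˣ} (f : prinIndV α β) (a d : kˣ) (x : k) (g : GL2 k) :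
    f.1 (diagGL a d * upperUnip x * g) = α a * β d * f.1 g := by
  have h := prinInd_borel f ⟨_, mul_mem (diagGL_mem a d) (upperUnip_mem x)⟩ g
  rw [(borelFst_eq rfl).1, (borelFst_eq rfl).2] at h
  exact h

theorem prinInd_diag {α β : kˣ →* ℂˣ} (f : prinIndV α β) (a d : kˣ) (g : GL2 k) :
    f.1 (diagGL a d * g) = α a * β d * f.1 g := by
  simpa [upperUnip_zero] using prinInd_diag_unip f a d 0 g

theorem prinInd_unip {α β : kˣ →* ℂˣ} (f : prinIndV α β) (x : k) (g : GL2 k) :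
    f.1 (upperUnip x * g) = f.1 g := by
  simpa [diagGL_one] using prinInd_diag_unip f 1 1 x g

variable [Fintype k]

/-- The standard intertwining operator between principal series of `GL(2, k)`. -/
def prinIndSwap (α β : kˣ →* ℂˣ) : prinIndV α β →ₗ[ℂ] prinIndV β α where
  toFun f := ⟨fun g => ∑ c : k, f.1 (weyl k * upperUnip c * g), by
    intro b g
    rw [charRep_apply, Finset.mul_sum]
    have hb := borel_decomp b
    set a := borelFst k b
    set d := borelSnd k b
    set x := b.1.1 0 1 * (b.1.1 0 0)⁻¹
    -- Moving b to the left through n(c) and w swaps its diagonal entries and changes c by this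
    -- affine bijection, so the sum is only reindexed.
    have hbij : Function.Bijective (fun c : k => c * d * (a : k)⁻¹ + x) := by
      constructor
      · intro c c' h
        simpa using h
      · intro c
        refine ⟨(c - x) * a * (d : k)⁻¹, ?_⟩
        simp
    rw [← Function.Bijective.sum_comp hbij
      (fun c => ((_ : ℂˣ) : ℂ) * f.1 (weyl k * upperUnip c * g))]
    refine Finset.sum_congr rfl fun c _ => ?_
    have e : weyl k * upperUnip c * ((borel k).subtype b * g) =
        diagGL d a * (weyl k * upperUnip (c * d * (a : k)⁻¹ + x) * g) := by
      rw [Subgroup.subtype_apply, hb, upperUnip_add]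
      simp only [mul_assoc]
      rw [← mul_assoc (upperUnip c), upperUnip_mul_diagGL]
      simp only [← mul_assoc]
      rw [weyl_mul_diagGL]
    rw [e, prinInd_diag]
    simp only [MonoidHom.mul_apply, MonoidHom.comp_apply, Units.val_mul]
    ring⟩
  map_add' f f' := by
    ext g
    simp [Finset.sum_add_distrib]
  map_smul' c f := by
    ext g
    simp [Finset.mul_sum]

theorem prinIndSwap_apply {α β : kˣ →* ℂˣ} (f : prinIndV α β) (g : GL2 k) :
    (prinIndSwap α β f).1 g = ∑ c : k, f.1 (weyl k * upperUnip c * g) := rfl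

theorem prinIndSwap_comm (α β : kˣ →* ℂˣ) (g : GL2 k) (f : prinIndV α β) :
    prinIndSwap α β (prinInd α β g f) = prinInd β α g (prinIndSwap α β f) := by
  ext x
  change ∑ c : k, f.1 (weyl k * upperUnip c * x * g) = ∑ c : k, f.1 (weyl k * upperUnip c * (x * g))
  simp only [mul_assoc]

/-- Orthogonality: translating the variable by some u with α u ≠ β u multiplies the sum by a scalar
other than one. -/
theorem sum_char_eq_zero {α β : kˣ →* ℂˣ} (h : α ≠ β) [Fintype kˣ] :
    ∑ c : kˣ, (α (-c⁻¹) * β (-c) : ℂ) = 0 := by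
  obtain ⟨u, hu⟩ : ∃ u, α u ≠ β u := by
    by_contra! h'
    exact h (MonoidHom.ext h')
  have e : ∑ c : kˣ, (α (-c⁻¹) * β (-c) : ℂ) =
      (α u⁻¹ * β u : ℂ) * ∑ c : kˣ, (α (-c⁻¹) * β (-c) : ℂ) := by
    rw [Finset.mul_sum, ← Equiv.sum_comp (Equiv.mulLeft u)]
    refine Finset.sum_congr rfl fun c _ => ?_
    have e1 : -(u * c)⁻¹ = u⁻¹ * -c⁻¹ := by simp [mul_comm]
    have e2 : -(u * c) = u * -c := by simp
    rw [Equiv.coe_mulLeft, e1, e2]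
    simp only [map_mul, Units.val_mul]
    ring
  by_contra h0
  have h1 : (α u⁻¹ * β u : ℂ) = 1 := mul_right_cancel₀ h0 (by rw [← e, one_mul])
  apply hu
  rw [map_inv, ← Units.val_mul, Units.val_eq_one, inv_mul_eq_one] at h1
  exact h1

/-- In the double sum over w n(c) w n(c'), the terms with c = 0 are all equal because w² = -1, while
those with c ≠ 0 combine by the rank one relation into a vanishing character sum times one
application of the operator. -/
theorem prinIndSwap_swap {α β : kˣ →* ℂˣ} (h : α ≠ β) (f : prinIndV α β) :
    prinIndSwap β α (prinIndSwap α β f) = (Fintype.card k * (α (-1) * β (-1)) : ℂ) • f := by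
  classical
  ext g
  -- The rank one relation leaves a unipotent factor -c⁻¹ on the right of w, absorbed by translating
  -- c'.
  have key : ∀ c : kˣ, ∑ c' : k, f.1 (weyl k * upperUnip (c : k) * (weyl k * upperUnip c' * g)) =
      (α (-c⁻¹) * β (-c) : ℂ) * (prinIndSwap α β f).1 g := by
    intro c
    rw [prinIndSwap_apply, Finset.mul_sum,
      ← Equiv.sum_comp (Equiv.addLeft (-(c : k)⁻¹)) fun c' =>
        (_ : ℂ) * f.1 (weyl k * upperUnip c' * g)]
    refine Finset.sum_congr rfl fun c' _ => ?_
    have e : weyl k * upperUnip (c : k) * (weyl k * upperUnip c' * g) =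
        upperUnip (-(c : k)⁻¹) * (diagGL (-c⁻¹) (-c) *
          (weyl k * upperUnip (-(c : k)⁻¹ + c') * g)) := by
      rw [upperUnip_add]
      simp only [← mul_assoc]
      rw [weyl_mul_upperUnip_mul_weyl]
    rw [e, prinInd_unip, prinInd_diag]
    rfl
  have h0 : ∀ c' : k, f.1 (weyl k * upperUnip 0 * (weyl k * upperUnip c' * g)) =
      (α (-1) * β (-1) : ℂ) * f.1 g := by
    intro c'
    have e : weyl k * upperUnip 0 * (weyl k * upperUnip c' * g) =
        diagGL (-1) (-1) * (upperUnip c' * g) := by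
      rw [upperUnip_zero, mul_one, ← weyl_mul_weyl]
      simp only [mul_assoc]
    rw [e, prinInd_diag, prinInd_unip]
  change ∑ c' : k, ∑ c : k, f.1 (weyl k * upperUnip c * (weyl k * upperUnip c' * g)) = _
  rw [Finset.sum_comm, ← Finset.sum_erase_add _ _ (Finset.mem_univ (0 : k))]
  simp only [h0, Finset.sum_const, Finset.card_univ, nsmul_eq_mul]
  have e : ∑ c ∈ Finset.univ.erase (0 : k),
      ∑ c' : k, f.1 (weyl k * upperUnip c * (weyl k * upperUnip c' * g)) = 0 := by
    have e1 : ∑ c : kˣ, ∑ c' : k,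
        f.1 (weyl k * upperUnip (c : k) * (weyl k * upperUnip c' * g)) = 0 := by
      simp only [key, ← Finset.sum_mul]
      rw [sum_char_eq_zero h, zero_mul]
    rw [← e1]
    symm
    refine Finset.sum_bij' (fun c _ => (c : k))
      (fun c hc => Units.mk0 c (Finset.ne_of_mem_erase hc)) ?_ ?_ ?_ ?_ ?_ <;> simp
  rw [e, zero_add]
  change _ = (Fintype.card k * (α (-1) * β (-1)) : ℂ) * f.1 g
  rw [mul_assoc, mul_assoc, mul_assoc]

/-- The principal series of `GL(2, k)` induced from a pair of characters is, up to equivalence,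
independent of their order. -/
theorem nonempty_prinInd_equiv_swap (α β : kˣ →* ℂˣ) :
    Nonempty ((prinInd α β).Equiv (prinInd β α)) := by
  by_cases h : α = β
  · subst h
    exact ⟨Representation.Equiv.refl _⟩
  -- For distinct characters the two operators are inverse to each other up to this nonzero scalar.
  · have hne : ∀ α β : kˣ →* ℂˣ, (Fintype.card k * (α (-1) * β (-1)) : ℂ) ≠ 0 := fun α β => by
      simp
    refine ⟨equivOfBijective (prinIndSwap α β) ⟨?_, ?_⟩ (prinIndSwap_comm α β)⟩
    · intro f f' hf
      have h1 := prinIndSwap_swap h f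
      rw [hf, prinIndSwap_swap h f'] at h1
      exact (smul_right_injective _ (hne α β) h1).symm
    · intro f
      refine ⟨(Fintype.card k * (β (-1) * α (-1)) : ℂ)⁻¹ • prinIndSwap β α f, ?_⟩
      rw [map_smul, prinIndSwap_swap (Ne.symm h), smul_smul, inv_mul_cancel₀ (hne β α), one_smul]

/-- The representation `1 × χ`, for a one-dimensional representation `χ` given abstractly. -/
def finIndEquiv {A : Type*} [AddCommGroup A] [Module ℂ A] (ρ : Representation ℂ kˣ A)
    (χ : kˣ →* ℂˣ) (e : A ≃ₗ[ℂ] ℂ) (he : ∀ u a, e (ρ u a) = χ u * e a) :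
    (finInd (Representation.trivial ℂ kˣ ℂ) ρ).Equiv (prinInd 1 χ) :=
  coindEquiv _ (Representation.Equiv.mk ((TensorProduct.lid ℂ A).trans e) fun b => by
    ext a
    simp [charRep_apply, he])

end FinitePrincipalSeries

/-! ### Induction from the Borel subgroup of pairs with equal determinant -/

section Pairs

variable (k : Type*) [Field k]

/-- The subgroup of pairs of upper triangular matrices in `(GL(2, k)²)⁰`. -/
def pairBorel : Subgroup (GL2sq0 k) := ((borel k).prod (borel k)).comap (GL2sq0 k).subtype

/-- The first component of a pair of upper triangular matrices. -/
def pairBorelFst : pairBorel k →* borel k where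
  toFun x := ⟨x.1.1.1, x.2.1⟩
  map_one' := rfl
  map_mul' _ _ := rfl

/-- The second component of a pair of upper triangular matrices. -/
def pairBorelSnd : pairBorel k →* borel k where
  toFun x := ⟨x.1.1.2, x.2.2⟩
  map_one' := rfl
  map_mul' _ _ := rfl

variable {k}

/-- The character `(a, b) ↦ χ₀(det a) χ₁(a₁₁) χ₂(b₁₁)` of the Borel subgroup of
`(GL(2, k)²)⁰`. -/
def pairChar (χ₀ χ₁ χ₂ : kˣ →* ℂˣ) : pairBorel k →* ℂˣ :=
  χ₀.comp (Matrix.GeneralLinearGroup.det.comp ((borel k).subtype.comp (pairBorelFst k))) *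
    (χ₁.comp ((borelFst k).comp (pairBorelFst k)) * χ₂.comp ((borelFst k).comp (pairBorelSnd k)))

/-- The function space of the representation of `(GL(2, k)²)⁰` induced from `pairChar`. -/
abbrev pairIndV (χ₀ χ₁ χ₂ : kˣ →* ℂˣ) : Submodule ℂ (GL2sq0 k → ℂ) :=
  Representation.coindV (pairBorel k).subtype (charRep (pairChar χ₀ χ₁ χ₂))

/-- The representation of `(GL(2, k)²)⁰` induced from `pairChar`. -/
abbrev pairInd (χ₀ χ₁ χ₂ : kˣ →* ℂˣ) : Representation ℂ (GL2sq0 k) (pairIndV χ₀ χ₁ χ₂) :=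
  Representation.coind (pairBorel k).subtype (charRep (pairChar χ₀ χ₁ χ₂))

/-- Representatives of the cosets of the Borel subgroup of `(GL(2, k)²)⁰`. -/
def pairRep (x : Option k × Option k) : GL2sq0 k :=
  ⟨(bruhatRep x.1, bruhatRep x.2), (det_bruhatRep _).trans (det_bruhatRep _).symm⟩

theorem exists_pairRep (g : GL2sq0 k) :
    ∃ (i : Option k × Option k) (h : pairBorel k), g = h * pairRep i := by
  obtain ⟨i, a, ha⟩ := exists_bruhat g.1.1
  obtain ⟨j, b, hb⟩ := exists_bruhat g.1.2
  have ea : (g * (pairRep (i, j))⁻¹).1.1 = a := by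
    change g.1.1 * (bruhatRep i)⁻¹ = a
    rw [ha, mul_inv_cancel_right]
  have eb : (g * (pairRep (i, j))⁻¹).1.2 = b := by
    change g.1.2 * (bruhatRep j)⁻¹ = b
    rw [hb, mul_inv_cancel_right]
  exact ⟨(i, j), ⟨g * (pairRep (i, j))⁻¹, ea ▸ a.2, eb ▸ b.2⟩, by simp⟩

theorem pairRep_inj (i j : Option k × Option k) (h : pairBorel k) (e : pairRep i = h * pairRep j) :
    i = j := by
  have e1 := congrArg (fun g : GL2sq0 k => g.1.1) e
  have e2 := congrArg (fun g : GL2sq0 k => g.1.2) e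
  exact Prod.ext (bruhatRep_inj (b := pairBorelFst k h) e1)
    (bruhatRep_inj (b := pairBorelSnd k h) e2)

/-- Pointwise multiplication of functions of two variables, as a linear equivalence. -/
theorem exists_piTensor (ι κ : Type*) [Finite ι] [Finite κ] :
    ∃ E : ((ι → ℂ) ⊗[ℂ] (κ → ℂ)) ≃ₗ[ℂ] (ι × κ → ℂ),
      ∀ x y p, E (x ⊗ₜ y) p = x p.1 * y p.2 := by
  classical
  have := Fintype.ofFinite ι
  have := Fintype.ofFinite κ
  refine ⟨((Pi.basisFun ℂ ι).tensorProduct (Pi.basisFun ℂ κ)).equivFun, fun x y p => ?_⟩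
  rw [Module.Basis.equivFun_apply]
  refine (Module.Basis.tensorProduct_repr_tmul_apply _ _ x y p.1 p.2).trans ?_
  simp [mul_comm]

section PairMul

variable {A₀ : Type*} [AddCommGroup A₀] [Module ℂ A₀] {χ₀ χ₁ χ₂ : kˣ →* ℂˣ}
  {X₁ X₂ : Type*} [AddCommGroup X₁] [Module ℂ X₁] [AddCommGroup X₂] [Module ℂ X₂]

/-- The product of functions on the two factors, twisted by a character of the determinant. -/
def pairMul (χ₀ χ₁ χ₂ : kˣ →* ℂˣ) :
    ℂ →ₗ[ℂ] prinIndV χ₁ 1 →ₗ[ℂ] prinIndV χ₂ 1 →ₗ[ℂ] pairIndV χ₀ χ₁ χ₂ :=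
  LinearMap.mk₂ ℂ (fun z f₁ =>
    ({ toFun := fun f₂ => ⟨fun l => z * χ₀ (Matrix.GeneralLinearGroup.det l.1.1) *
          (f₁.1 l.1.1 * f₂.1 l.1.2), by
          intro h l
          have h1 := prinInd_borel f₁ (pairBorelFst k h) l.1.1
          have h2 := prinInd_borel f₂ (pairBorelSnd k h) l.1.2
          have e1 : ((pairBorel k).subtype h * l).1.1 = pairBorelFst k h * l.1.1 := rfl
          have e2 : ((pairBorel k).subtype h * l).1.2 = pairBorelSnd k h * l.1.2 := rfl
          rw [charRep_apply]
          beta_reduce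
          rw [e1, e2, h1, h2]
          simp [pairChar]
          ring⟩
       map_add' := fun f f' => by
          ext l
          simp
          ring
       map_smul' := fun c f => by
          ext l
          simp
          ring } : prinIndV χ₂ 1 →ₗ[ℂ] pairIndV χ₀ χ₁ χ₂))
    (fun z z' f => by
      ext f' l
      simp
      ring)
    (fun c z f => by
      ext f' l
      simp
      ring)
    (fun z f f' => by
      ext f'' l
      simp
      ring)
    (fun c z f => by
      ext f' l
      simp
      ring)

theorem pairMul_apply (z : ℂ) (f₁ : prinIndV χ₁ 1) (f₂ : prinIndV χ₂ 1) (l : GL2sq0 k) :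
    (pairMul χ₀ χ₁ χ₂ z f₁ f₂).1 l =
      z * χ₀ (Matrix.GeneralLinearGroup.det l.1.1) * (f₁.1 l.1.1 * f₂.1 l.1.2) := rfl

end PairMul

/-- The representation `χ₀[1 × χ₁, 1 × χ₂]` of `(GL(2, k)²)⁰`, as induced from a character. -/
theorem nonempty_bracketInd_equiv [Finite k] {A₀ A₁ A₂ : Type*} [AddCommGroup A₀] [Module ℂ A₀]
    [AddCommGroup A₁] [Module ℂ A₁] [AddCommGroup A₂] [Module ℂ A₂]
    {ρ₀ : Representation ℂ kˣ A₀} {ρ₁ : Representation ℂ kˣ A₁} {ρ₂ : Representation ℂ kˣ A₂}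
    {χ₀ χ₁ χ₂ : kˣ →* ℂˣ} (e₀ : A₀ ≃ₗ[ℂ] ℂ) (he₀ : ∀ u a, e₀ (ρ₀ u a) = χ₀ u * e₀ a)
    (e₁ : A₁ ≃ₗ[ℂ] ℂ) (he₁ : ∀ u a, e₁ (ρ₁ u a) = χ₁ u * e₁ a)
    (e₂ : A₂ ≃ₗ[ℂ] ℂ) (he₂ : ∀ u a, e₂ (ρ₂ u a) = χ₂ u * e₂ a) :
    Nonempty ((bracketInd ρ₀ ρ₁ ρ₂).Equiv (pairInd χ₀ χ₁ χ₂)) := by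
  have := Fintype.ofFinite k
  -- `pairChar` sees the upper left entries, whereas 1 × χ carries χ on the lower right one, so both
  -- factors are swapped first.
  obtain ⟨s₁⟩ := nonempty_prinInd_equiv_swap 1 χ₁
  obtain ⟨s₂⟩ := nonempty_prinInd_equiv_swap 1 χ₂
  let E₁ := (finIndEquiv ρ₁ χ₁ e₁ he₁).trans s₁
  let E₂ := (finIndEquiv ρ₂ χ₂ e₂ he₂).trans s₂
  obtain ⟨E, hE⟩ := exists_piTensor (Option k) (Option k)
  let ev (χ : kˣ →* ℂˣ) : prinIndV χ 1 ≃ₗ[ℂ] (Option k → ℂ) :=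
    LinearEquiv.ofBijective _ (coindEval_bijective _ _ bruhatRep exists_bruhat
      fun _ _ _ => bruhatRep_inj)
  let evp : pairIndV χ₀ χ₁ χ₂ ≃ₗ[ℂ] (Option k × Option k → ℂ) :=
    LinearEquiv.ofBijective _ (coindEval_bijective _ _ pairRep exists_pairRep pairRep_inj)
  -- Pairs of representatives represent the cosets of the pair Borel, so in coordinates given by
  -- values at representatives the multiplication map is the isomorphism of a tensor product of
  -- function spaces with functions on the product.
  let Λ := ((TensorProduct.congr ((TensorProduct.congr e₀ (E₁.toLinearEquiv.trans (ev χ₁))).trans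
    (TensorProduct.lid ℂ _)) (E₂.toLinearEquiv.trans (ev χ₂))).trans E).trans evp.symm
  have hΛ : ∀ z f₁ f₂, Λ ((z ⊗ₜ f₁) ⊗ₜ f₂) = pairMul χ₀ χ₁ χ₂ (e₀ z) (E₁ f₁) (E₂ f₂) := by
    intro z f₁ f₂
    refine evp.symm_apply_eq.2 (funext fun p => ?_)
    refine (hE _ _ p).trans ?_
    change e₀ z * (E₁ f₁).1 (bruhatRep p.1) * (E₂ f₂).1 (bruhatRep p.2) =
      (pairMul χ₀ χ₁ χ₂ (e₀ z) (E₁ f₁) (E₂ f₂)).1 (pairRep p)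
    rw [pairMul_apply]
    change _ = e₀ z * (χ₀ (Matrix.GeneralLinearGroup.det (bruhatRep p.1)) : ℂ) *
      ((E₁ f₁).1 (bruhatRep p.1) * (E₂ f₂).1 (bruhatRep p.2))
    rw [det_bruhatRep]
    simp [mul_assoc]
  -- Bijectivity is built into Λ; equivariance only needs the formula for Λ on pure tensors.
  refine ⟨Representation.Equiv.mk Λ fun g => ?_⟩
  apply TensorProduct.ext
  apply TensorProduct.ext
  ext z f₁ f₂ : 3
  have e1 := E₁.toIntertwiningMap.isIntertwining _ _ g.1.1 f₁
  have e2 := E₂.toIntertwiningMap.isIntertwining _ _ g.1.2 f₂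
  change Λ ((ρ₀ (Matrix.GeneralLinearGroup.det g.1.1) z ⊗ₜ _) ⊗ₜ _) =
    pairInd χ₀ χ₁ χ₂ g (Λ ((z ⊗ₜ f₁) ⊗ₜ f₂))
  rw [hΛ, hΛ]
  have e1' : E₁ (finInd (Representation.trivial ℂ kˣ ℂ) ρ₁ g.1.1 f₁) =
    prinInd χ₁ 1 g.1.1 (E₁ f₁) := e1
  have e2' : E₂ (finInd (Representation.trivial ℂ kˣ ℂ) ρ₂ g.1.2 f₂) =
    prinInd χ₂ 1 g.1.2 (E₂ f₂) := e2
  ext l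
  rw [pairMul_apply]
  erw [e1', e2']
  rw [he₀]
  change _ = e₀ z * (χ₀ (Matrix.GeneralLinearGroup.det (l.1.1 * g.1.1)) : ℂ) *
      ((E₁ f₁).1 (l.1.1 * g.1.1) * (E₂ f₂).1 (l.1.2 * g.1.2))
  rw [map_mul, map_mul, Units.val_mul]
  change _ * ((E₁ f₁).1 (l.1.1 * g.1.1) * (E₂ f₂).1 (l.1.2 * g.1.2)) = _
  ring

end Pairs

/-! ### Mackey's formula for a single double coset -/

section Mackey

variable {G : Type*} [Group G] [TopologicalSpace G] [ContinuousMul G] {V : Type*} [AddCommGroup V]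
  [Module ℂ V] {L : Type*} [Group L]

/-- Mackey's formula for the parahoric restriction of an induced representation, in the case of a
single double coset. -/
theorem nonempty_parRes_smoothInd_equiv (P : Subgroup G) (τ : Representation ℂ P V)
    (J : Subgroup G) (Jplus : Subgroup J) (π : J →* L) (hπ : Function.Surjective π)
    (hker : π.ker = Jplus) (hopen : IsOpen (Jplus.map J.subtype : Set G))
    (hPJ : ∀ g : G, ∃ (p : P) (j : J), g = (p : G) * (j : G)) :
    Nonempty ((parRes J.subtype Jplus π hπ hker (smoothInd P τ)).Equiv
      (Representation.coind (π.comp (Subgroup.inclusion (inf_le_right : P ⊓ J ≤ J)))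
        (τ.comp (Subgroup.inclusion (inf_le_left : P ⊓ J ≤ P))))) := by
  -- Invariance under the kernel of π makes the restriction of f to J factor through π.
  have hinv : ∀ (f : Representation.invariants
      (((smoothInd P τ).comp J.subtype).comp Jplus.subtype)) (x y : J), π x = π y →
      f.1.1 x = f.1.1 y := by
    intro f x y hxy
    have hu : y⁻¹ * x ∈ Jplus := by
      rw [← hker, MonoidHom.mem_ker, map_mul, map_inv, hxy, inv_mul_cancel]
    have h := congrFun (congrArg Subtype.val (f.2 ⟨_, hu⟩)) y
    have e : (y : G) * ((y⁻¹ * x : J) : G) = x := by simp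
    rw [← h]
    exact congrArg f.1.1 e.symm
  let s := Function.surjInv hπ
  have hs : ∀ l, π (s l) = l := Function.surjInv_eq hπ
  let Φ : Representation.invariants (((smoothInd P τ).comp J.subtype).comp Jplus.subtype) →ₗ[ℂ]
      Representation.coindV (π.comp (Subgroup.inclusion (inf_le_right : P ⊓ J ≤ J)))
        (τ.comp (Subgroup.inclusion (inf_le_left : P ⊓ J ≤ P))) :=
    { toFun := fun f => ⟨fun l => f.1.1 (s l), by
        intro q l
        have e := f.1.2.1 ⟨q.1, q.2.1⟩ (s l)
        refine Eq.trans ?_ e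
        refine hinv f (s _) (⟨q.1, q.2.2⟩ * s l) ?_
        rw [hs, map_mul, hs]
        rfl⟩
      map_add' := fun _ _ => rfl
      map_smul' := fun _ _ => rfl }
  have hΦ : ∀ f l, (Φ f).1 l = f.1.1 (s l) := fun _ _ => rfl
  refine ⟨equivOfBijective Φ ⟨?_, ?_⟩ ?_⟩
  · intro f f' h
    ext g
    obtain ⟨p, j, rfl⟩ := hPJ g
    have e := congrFun (congrArg Subtype.val h) (π j)
    rw [hΦ, hΦ, hinv f _ j (hs _), hinv f' _ j (hs _)] at e
    rw [f.1.2.1, f'.1.2.1, e]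
  · intro φ
    choose pp jj hpj using hPJ
    -- The inverse map: φ is pulled back to J and extended to G = PJ by the transformation law under
    -- P.
    let F : G → V := fun g => τ (pp g) (φ.1 (π (jj g)))
    have hF : ∀ (p : P) (j : J), F (p * j) = τ p (φ.1 (π j)) := by
      intro p j
      have e := hpj (p * j)
      have hq : ((pp (p * j))⁻¹ * p : P) = ((jj (p * j) * j⁻¹ : J) : G) := by
        push_cast
        rw [inv_mul_eq_iff_eq_mul, ← mul_assoc, ← e, mul_inv_cancel_right]
      -- Two decompositions of the same element differ by an element of P ∩ J, and there the law for
      -- φ says exactly that F is well defined.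
      have hmem : (((pp (p * j))⁻¹ * p : P) : G) ∈ P ⊓ J := ⟨SetLike.coe_mem _, by
        rw [hq]
        exact SetLike.coe_mem _⟩
      have h1 := φ.2 ⟨_, hmem⟩ (π j)
      have e2 : (Subgroup.inclusion (inf_le_right : P ⊓ J ≤ J)) ⟨_, hmem⟩ = jj (p * j) * j⁻¹ :=
        Subtype.ext hq
      have e3 : (Subgroup.inclusion (inf_le_left : P ⊓ J ≤ P)) ⟨_, hmem⟩ = (pp (p * j))⁻¹ * p :=
        rfl
      rw [MonoidHom.comp_apply, MonoidHom.comp_apply, e2, e3, ← map_mul, inv_mul_cancel_right,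
        map_mul, Module.End.mul_apply] at h1
      change τ (pp (p * j)) (φ.1 (π (jj (p * j)))) = _
      rw [h1, ← Module.End.mul_apply, ← map_mul, mul_inv_cancel, map_one, Module.End.one_apply]
    have hFmul : ∀ (h : P) (g : G), F (h * g) = τ h (F g) := by
      intro h g
      obtain ⟨p, j, hg⟩ : ∃ (p : P) (j : J), g = (p : G) * (j : G) := ⟨_, _, hpj g⟩
      rw [hg, ← mul_assoc, ← Subgroup.coe_mul, hF, hF, map_mul, Module.End.mul_apply]
    have hFinv : ∀ u ∈ Jplus, ∀ g : G, F (g * (u : J)) = F g := by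
      intro u hu g
      obtain ⟨p, j, hg⟩ : ∃ (p : P) (j : J), g = (p : G) * (j : G) := ⟨_, _, hpj g⟩
      rw [← hker, MonoidHom.mem_ker] at hu
      rw [hg, mul_assoc, ← Subgroup.coe_mul, hF, hF, map_mul, hu, mul_one]
    -- Smoothness of F is witnessed by the open subgroup `Jplus` itself.
    refine ⟨⟨⟨F, hFmul, Jplus.map J.subtype, hopen, ?_⟩, ?_⟩, ?_⟩
    · rintro _ ⟨u, hu, rfl⟩ g
      exact hFinv u hu g
    · intro u
      ext g
      exact hFinv u.1 u.2 g
    · ext l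
      rw [hΦ]
      have := hF 1 (s l)
      rw [Subgroup.coe_one, one_mul, map_one, Module.End.one_apply, hs] at this
      exact this
  · intro l f
    obtain ⟨x, rfl⟩ := hπ l
    ext l'
    rw [hΦ, parRes_apply]
    change f.1.1 ((s l' : G) * x) = (Φ f).1 (l' * π x)
    rw [hΦ, ← Subgroup.coe_mul]
    exact hinv f _ _ (by rw [map_mul, hs, hs])

end Mackey

/-! ### Openness of the paramodular groups; explicit elements of GSp(4) -/

section Paramodular

variable {F : Type*} [Field F] [ValuativeRel F] [TopologicalSpace F]
  [IsNonarchimedeanLocalField F]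

theorem isOpen_valuation_le {γ : ValueGroupWithZero F} (hγ : γ ≠ 0) (a : F) :
    IsOpen {x : F | valuation F (x - a) ≤ γ} := by
  rw [isOpen_iff_mem_nhds]
  intro x hx
  rw [IsValuativeTopology.mem_nhds_iff']
  refine ⟨Units.mk0 γ hγ, fun y hy => ?_⟩
  have e : y - a = (y - x) + (x - a) := by ring
  simp only [Set.mem_ofPred_eq] at hx ⊢
  rw [e]
  exact Valuation.map_add_le _ (le_of_lt hy) hx

theorem isOpen_pIdeal (ϖ : Uniformizer F) (n : ℤ) (a : F) :
    IsOpen {x : F | x - a ∈ pIdeal ϖ n} :=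
  isOpen_valuation_le (zpow_ne_zero _ (val_pos ϖ).ne') a

theorem continuous_mat_apply (i j : Fin 4) : Continuous fun x : GSp4 F => mat x i j := by
  have h : Continuous fun x : GSp4 F => mat x :=
    Units.continuous_val.comp (continuous_fst.comp continuous_subtype_val)
  exact h.matrix_elem i j

theorem continuous_simi : Continuous fun x : GSp4 F => (simi x : F) :=
  Units.continuous_val.comp (continuous_snd.comp continuous_subtype_val)

theorem isOpen_paramodular (ϖ : Uniformizer F) : IsOpen (paramodular ϖ : Set (GSp4 F)) := by
  -- The unit condition on the similitude is rewritten as two inequalities, for it and for its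
  -- inverse, so that only closed balls, which are open, occur.
  have e : (paramodular ϖ : Set (GSp4 F)) =
      ({x | valuation F (simi x : F) ≤ 1} ∩ {x | valuation F ((simi x⁻¹ : Fˣ) : F) ≤ 1}) ∩
        ⋂ i, ⋂ j, {x | mat x i j ∈ pIdeal ϖ (expJ i j)} := by
    ext x
    simp only [SetLike.mem_coe, Set.mem_inter_iff, Set.mem_iInter, Set.mem_ofPred_eq]
    refine and_congr ?_ Iff.rfl
    rw [map_inv, Units.val_inv_eq_inv_val, map_inv₀, inv_le_one₀ (by simp [zero_lt_iff])]
    exact le_antisymm_iff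
  rw [e]
  have h1 : IsOpen {x : F | valuation F x ≤ 1} := by
    simpa using isOpen_valuation_le (F := F) one_ne_zero 0
  refine ((h1.preimage continuous_simi).inter ?_).inter ?_
  · refine h1.preimage ?_
    simp only [map_inv]
    exact Units.continuous_val.comp
      (continuous_snd.comp continuous_subtype_val : Continuous fun x : GSp4 F => simi x).inv
  · refine isOpen_iInter_of_finite fun i => isOpen_iInter_of_finite fun j => ?_
    have := (isOpen_pIdeal ϖ (expJ i j) 0).preimage (continuous_mat_apply i j)
    simp only [sub_zero] at this
    exact this

theorem isOpen_paramodularPlus (ϖ : Uniformizer F) :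
    IsOpen ((paramodularPlus ϖ).map (paramodular ϖ).subtype : Set (GSp4 F)) := by
  have e : ((paramodularPlus ϖ).map (paramodular ϖ).subtype : Set (GSp4 F)) =
      (paramodular ϖ : Set (GSp4 F)) ∩ ⋂ i, ⋂ j,
        {x | mat x i j - (1 : Matrix (Fin 4) (Fin 4) F) i j ∈ pIdeal ϖ (expJplus i j)} := by
    ext x
    simp only [Subgroup.coe_map, Set.mem_image, Set.mem_inter_iff, Set.mem_iInter]
    constructor
    · rintro ⟨y, hy, rfl⟩
      exact ⟨y.2, hy⟩
    · rintro ⟨h1, h2⟩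
      exact ⟨⟨x, h1⟩, h2, rfl⟩
  rw [e]
  refine (isOpen_paramodular ϖ).inter ?_
  refine isOpen_iInter_of_finite fun i => isOpen_iInter_of_finite fun j => ?_
  exact (isOpen_pIdeal ϖ (expJplus i j) _).preimage (continuous_mat_apply i j)

/-- The element of `GSp(4, K)` given by a pair of `2 × 2`-matrices of the same determinant, acting
on the first and third and on the second and fourth coordinates. -/
def pairElt {K : Type*} [Field K] (a b : Matrix (Fin 2) (Fin 2) K) (c : Kˣ) (ha : a.det = c)
    (hb : b.det = c) : GSp4 K :=
  mkGSp4 !![a 0 0, 0, a 0 1, 0; 0, b 0 0, 0, b 0 1; a 1 0, 0, a 1 1, 0; 0, b 1 0, 0, b 1 1] c (by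
    rw [Matrix.det_fin_two] at ha hb
    ext i j
    simp only [Matrix.smul_apply, Matrix.mul_apply, Fin.sum_univ_four, Matrix.transpose_apply,
      smul_eq_mul]
    fin_cases i <;> fin_cases j <;> simp [Jform] <;> first
      | ring1
      | linear_combination ha
      | linear_combination hb
      | linear_combination -ha
      | linear_combination -hb)

theorem mat_pairElt {K : Type*} [Field K] (a b : Matrix (Fin 2) (Fin 2) K) (c : Kˣ)
    (ha : a.det = c) (hb : b.det = c) : mat (pairElt a b c ha hb) =
      !![a 0 0, 0, a 0 1, 0; 0, b 0 0, 0, b 0 1; a 1 0, 0, a 1 1, 0; 0, b 1 0, 0, b 1 1] := rfl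

/-- The element `diag(A, c A⁻ᵗ)` of the Siegel Levi subgroup. -/
def leviElt {K : Type*} [Field K] (A : GL2 K) (c : Kˣ) : GSp4 K :=
  mkGSp4 !![A.1 0 0, A.1 0 1, 0, 0; A.1 1 0, A.1 1 1, 0, 0;
      0, 0, c * A⁻¹.1 0 0, c * A⁻¹.1 1 0; 0, 0, c * A⁻¹.1 0 1, c * A⁻¹.1 1 1] c (by
    have h1 : A.1 * A⁻¹.1 = 1 := by rw [← Units.val_mul]; simp
    have h := fun i j => congrFun (congrFun h1 i) j
    have h00 := h 0 0
    have h01 := h 0 1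
    have h10 := h 1 0
    have h11 := h 1 1
    simp only [Matrix.mul_apply, Fin.sum_univ_two] at h00 h01 h10 h11
    simp only [Matrix.one_apply_eq] at h00 h11
    rw [Matrix.one_apply_ne (by decide)] at h01 h10
    ext i j
    simp only [Matrix.smul_apply, Matrix.mul_apply, Fin.sum_univ_four, Matrix.transpose_apply,
      smul_eq_mul]
    fin_cases i <;> fin_cases j <;> simp [Jform, -Matrix.coe_units_inv] <;> first
      | linear_combination (c : K) * h00
      | linear_combination (c : K) * h01
      | linear_combination (c : K) * h10
      | linear_combination (c : K) * h11
      | linear_combination -(c : K) * h00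
      | linear_combination -(c : K) * h01
      | linear_combination -(c : K) * h10
      | linear_combination -(c : K) * h11)

theorem mat_leviElt {K : Type*} [Field K] (A : GL2 K) (c : Kˣ) : mat (leviElt A c) =
    !![A.1 0 0, A.1 0 1, 0, 0; A.1 1 0, A.1 1 1, 0, 0;
      0, 0, c * A⁻¹.1 0 0, c * A⁻¹.1 1 0; 0, 0, c * A⁻¹.1 0 1, c * A⁻¹.1 1 1] := rfl

end Paramodular

/-! ### Units, reduction and the absolute value -/

section Units

variable {F : Type*} [Field F] [ValuativeRel F] [TopologicalSpace F]
  [IsNonarchimedeanLocalField F]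

theorem valuation_unitsIncl (u : 𝒪[F]ˣ) : valuation F (unitsIncl F u : F) = 1 :=
  (Valuation.integer.integers (valuation F)).valuation_unit u

theorem exists_unitsIncl {x : F} (hx : valuation F x = 1) : ∃ u : 𝒪[F]ˣ, (unitsIncl F u : F) = x := by
  have h : IsUnit (⟨x, hx.le⟩ : 𝒪[F]) :=
    (Valuation.integer.integers (valuation F)).isUnit_of_one
      (by
        rw [isUnit_iff_ne_zero]
        rintro h
        have h' : x = 0 := h
        simp [h'] at hx) hx
  obtain ⟨u, hu⟩ := h
  exact ⟨u, congrArg Subtype.val hu⟩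

theorem exists_unitsIncl_units {x : Fˣ} (hx : valuation F (x : F) = 1) :
    ∃ u : 𝒪[F]ˣ, unitsIncl F u = x := by
  obtain ⟨u, hu⟩ := exists_unitsIncl hx
  exact ⟨u, Units.ext hu⟩

theorem red_unitsIncl (u : 𝒪[F]ˣ) : red (unitsIncl F u : F) = (unitsRed F u : 𝓀[F]) :=
  red_coe _

theorem unitsRed_eq_of_red {u : 𝒪[F]ˣ} {y : 𝓀[F]ˣ} (h : red (unitsIncl F u : F) = y) :
    unitsRed F u = y :=
  Units.ext ((red_unitsIncl u).symm.trans h)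

theorem valuation_eq_one_of_red {x : F} (hx : valuation F x ≤ 1) (h : red x ≠ 0) :
    valuation F x = 1 :=
  le_antisymm hx (not_lt.1 fun h' => h (red_eq_zero h'))

theorem mem_principalUnits_iff {u : 𝒪[F]ˣ} : u ∈ principalUnits F ↔ red (unitsIncl F u : F) = 1 := by
  rw [← unitsRed_ker, MonoidHom.mem_ker, red_unitsIncl, Units.ext_iff]
  rfl

theorem red_zero : red (0 : F) = 0 := red_eq_zero (by simp)

theorem red_inv {x : F} (hx : valuation F x = 1) : red x⁻¹ = (red x)⁻¹ := by
  have h : red (x * x⁻¹) = red x * red x⁻¹ := red_mul hx.le (by simp [hx])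
  have h0 : x ≠ 0 := by
    rintro rfl
    simp at hx
  rw [mul_inv_cancel₀ h0, red_one] at h
  exact eq_inv_of_mul_eq_one_right h.symm

theorem exists_red_eq (y : 𝓀[F]) : ∃ x : F, valuation F x ≤ 1 ∧ red x = y := by
  obtain ⟨x, rfl⟩ := IsLocalRing.residue_surjective (R := 𝒪[F]) y
  exact ⟨x, x.2, red_coe x⟩

/-- This is why the normalizing factors of both inductions play no role on integral points. -/
theorem nuPow_eq_one (s : ℝ) {x : Fˣ} (hx : valuation F (x : F) = 1) : nuPow F s x = 1 := by
  ext
  simp [nuPow, nabs, hx]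

end Units

/-! ### The pro-unipotent radical of the Iwahori subgroup of GL(2,F) -/

section Iwahori

variable {F : Type*} [Field F] [ValuativeRel F] [TopologicalSpace F]
  [IsNonarchimedeanLocalField F]

theorem GL2_inv_val {K : Type*} [Field K] (A : GL2 K) : A⁻¹.1 =
    !![A.1.det⁻¹ * A.1 1 1, -(A.1.det⁻¹ * A.1 0 1); -(A.1.det⁻¹ * A.1 1 0), A.1.det⁻¹ * A.1 0 0] := by
  rw [Matrix.coe_units_inv, Matrix.inv_def, Matrix.adjugate_fin_two, Ring.inverse_eq_inv']
  ext i j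
  fin_cases i <;> fin_cases j <;> simp

theorem val_det_le {A : Matrix (Fin 2) (Fin 2) F} (h : ∀ i j, valuation F (A i j) ≤ 1) :
    valuation F (A 0 0 * A 1 1) ≤ 1 ∧ valuation F (A 0 1 * A 1 0) ≤ 1 := by
  simp only [map_mul]
  exact ⟨mul_le_one' (h _ _) (h _ _), mul_le_one' (h _ _) (h _ _)⟩

theorem red_det {A : Matrix (Fin 2) (Fin 2) F} (h : ∀ i j, valuation F (A i j) ≤ 1) :
    red A.det = red (A 0 0) * red (A 1 1) - red (A 0 1) * red (A 1 0) := by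
  rw [Matrix.det_fin_two, red_sub (val_det_le h).1 (val_det_le h).2, red_mul (h _ _) (h _ _),
    red_mul (h _ _) (h _ _)]

theorem val_mul_apply_le {A B : Matrix (Fin 2) (Fin 2) F} (hA : ∀ i j, valuation F (A i j) ≤ 1)
    (hB : ∀ i j, valuation F (B i j) ≤ 1) (i j : Fin 2) : valuation F ((A * B) i j) ≤ 1 := by
  rw [Matrix.mul_apply, Fin.sum_univ_two]
  refine Valuation.map_add_le _ ?_ ?_ <;> rw [map_mul] <;> exact mul_le_one' (hA _ _) (hB _ _)

theorem red_mul_apply {A B : Matrix (Fin 2) (Fin 2) F} (hA : ∀ i j, valuation F (A i j) ≤ 1)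
    (hB : ∀ i j, valuation F (B i j) ≤ 1) (i j : Fin 2) : red ((A * B) i j) =
      red (A i 0) * red (B 0 j) + red (A i 1) * red (B 1 j) := by
  rw [Matrix.mul_apply, Fin.sum_univ_two, red_add, red_mul (hA _ _) (hB _ _),
    red_mul (hA _ _) (hB _ _)] <;> rw [map_mul] <;> exact mul_le_one' (hA _ _) (hB _ _)

variable (F) in
/-- The pro-unipotent radical of the standard Iwahori subgroup of `GL(2, F)`. -/
def proIwahori : Subgroup (GL2 F) where
  carrier := {A | (∀ i j, valuation F (A.1 i j) ≤ 1) ∧ red (A.1 0 0) = 1 ∧ red (A.1 1 0) = 0 ∧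
    red (A.1 1 1) = 1}
  one_mem' := by
    refine ⟨fun i j => ?_, ?_, ?_, ?_⟩
    · by_cases h : i = j
      · subst h
        simp
      · simp [h]
    · simp [red_one]
    · simp [red_zero]
    · simp [red_one]
  mul_mem' := by
    rintro A B ⟨hA, a1, a2, a3⟩ ⟨hB, b1, b2, b3⟩
    refine ⟨val_mul_apply_le hA hB, ?_, ?_, ?_⟩ <;>
      simp [red_mul_apply hA hB, a1, a2, a3, b1, b2, b3]
  inv_mem' := by
    rintro A ⟨hA, a1, a2, a3⟩
    have hd : red A.1.det = 1 := by rw [red_det hA, a1, a2, a3]; simp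
    have hle : valuation F A.1.det ≤ 1 := by
      rw [Matrix.det_fin_two]
      exact val_sub_le (val_det_le hA).1 (val_det_le hA).2
    have hv : valuation F A.1.det = 1 := valuation_eq_one_of_red hle (by simp [hd])
    have hv' : valuation F A.1.det⁻¹ ≤ 1 := by simp [hv]
    have hr : red A.1.det⁻¹ = 1 := by rw [red_inv hv, hd, inv_one]
    have hm : ∀ i j, valuation F (A.1.det⁻¹ * A.1 i j) ≤ 1 := fun i j => by
      rw [map_mul]
      exact mul_le_one' hv' (hA i j)
    rw [Set.mem_ofPred_eq, GL2_inv_val]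
    refine ⟨fun i j => ?_, ?_, ?_, ?_⟩
    · fin_cases i <;> fin_cases j
      · exact hm 1 1
      · change valuation F (-(A.1.det⁻¹ * A.1 0 1)) ≤ 1
        rw [Valuation.map_neg]
        exact hm 0 1
      · change valuation F (-(A.1.det⁻¹ * A.1 1 0)) ≤ 1
        rw [Valuation.map_neg]
        exact hm 1 0
      · exact hm 0 0
    · change red (A.1.det⁻¹ * A.1 1 1) = 1
      rw [red_mul hv' (hA _ _), hr, a3, one_mul]
    · change red (-(A.1.det⁻¹ * A.1 1 0)) = 0
      rw [red_neg (hm _ _), red_mul hv' (hA _ _), hr, a2, one_mul, neg_zero]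
    · change red (A.1.det⁻¹ * A.1 0 0) = 1
      rw [red_mul hv' (hA _ _), hr, a1, one_mul]

theorem mem_proIwahori {A : GL2 F} : A ∈ proIwahori F ↔ (∀ i j, valuation F (A.1 i j) ≤ 1) ∧
    red (A.1 0 0) = 1 ∧ red (A.1 1 0) = 0 ∧ red (A.1 1 1) = 1 := Iff.rfl

theorem mem_proIwahori_of_entries {A : GL2 F} (h00 : valuation F (A.1 0 0 - 1) < 1)
    (h01 : valuation F (A.1 0 1) ≤ 1) (h10 : valuation F (A.1 1 0) < 1)
    (h11 : valuation F (A.1 1 1 - 1) < 1) : A ∈ proIwahori F := by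
  have key : ∀ x : F, valuation F (x - 1) < 1 → valuation F x ≤ 1 ∧ red x = 1 := by
    intro x hx
    have e : x = (x - 1) + 1 := by ring
    constructor
    · rw [e]
      exact Valuation.map_add_le _ hx.le (by simp)
    · rw [e, red_add hx.le (by simp), red_eq_zero hx, red_one, zero_add]
  refine ⟨fun i j => ?_, (key _ h00).2, red_eq_zero h10, (key _ h11).2⟩
  fin_cases i <;> fin_cases j
  exacts [(key _ h00).1, h01, h10.le, (key _ h11).1]

theorem upperUnip_mem_proIwahori {x : F} (hx : valuation F x ≤ 1) : upperUnip x ∈ proIwahori F :=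
  mem_proIwahori_of_entries (by simp) (by simpa using hx) (by simp) (by simp)

theorem lowerUnip_mem_proIwahori {x : F} (hx : valuation F x < 1) : lowerUnip x ∈ proIwahori F :=
  mem_proIwahori_of_entries (by simp) (by simp) (by simpa using hx) (by simp)

theorem diagGL_mem_proIwahori {a b : 𝒪[F]ˣ} (ha : a ∈ principalUnits F) (hb : b ∈ principalUnits F) :
    diagGL (unitsIncl F a) (unitsIncl F b) ∈ proIwahori F := by
  rw [mem_principalUnits_iff] at ha hb
  refine ⟨fun i j => ?_, ?_, ?_, ?_⟩
  · fin_cases i <;> fin_cases j <;> simp [valuation_unitsIncl]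
  · simpa using ha
  · simp [red_zero]
  · simpa using hb

theorem diagGL_inv {K : Type*} [Field K] (a b : Kˣ) : (diagGL a b)⁻¹ = diagGL a⁻¹ b⁻¹ := by
  rw [inv_eq_iff_mul_eq_one, ← diagGL_mul]
  simp [diagGL_one]

/-- Elements of the torus over the integers normalize the pro-unipotent radical of the Iwahori
subgroup. -/
theorem diagGL_conj_mem_proIwahori (a b : 𝒪[F]ˣ) {k : GL2 F} (hk : k ∈ proIwahori F) :
    diagGL (unitsIncl F a) (unitsIncl F b) * k * (diagGL (unitsIncl F a) (unitsIncl F b))⁻¹ ∈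
      proIwahori F := by
  obtain ⟨hk, h0, h1, h2⟩ := hk
  have ha := valuation_unitsIncl a
  have hb := valuation_unitsIncl b
  have ha0 := (unitsIncl F a).ne_zero
  have hb0 := (unitsIncl F b).ne_zero
  have e : (diagGL (unitsIncl F a) (unitsIncl F b) * k *
      (diagGL (unitsIncl F a) (unitsIncl F b))⁻¹).1 =
      !![k.1 0 0, unitsIncl F a * k.1 0 1 * (unitsIncl F b : F)⁻¹;
        unitsIncl F b * k.1 1 0 * (unitsIncl F a : F)⁻¹, k.1 1 1] := by
    rw [diagGL_inv]
    ext i j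
    simp only [Units.val_mul, Matrix.mul_apply, Fin.sum_univ_two, val_diagGL]
    fin_cases i <;> fin_cases j <;> simp <;> field_simp
  rw [mem_proIwahori, e]
  refine ⟨fun i j => ?_, h0, ?_, h2⟩
  · fin_cases i <;> fin_cases j <;> simp [ha, hb, hk]
  · change red (unitsIncl F b * k.1 1 0 * (unitsIncl F a : F)⁻¹) = 0
    rw [red_mul (by simp [hb, hk]) (by simp [ha]), red_mul hb.le (hk _ _), h1]
    simp

theorem continuous_GL2_apply (i j : Fin 2) : Continuous fun x : GL2 F => x.1 i j :=
  (Units.continuous_val : Continuous fun x : GL2 F => x.1).matrix_elem i j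

theorem isOpen_valuation_lt_one (a : F) : IsOpen {x : F | valuation F (x - a) < 1} := by
  rw [isOpen_iff_mem_nhds]
  intro x hx
  rw [IsValuativeTopology.mem_nhds_iff']
  refine ⟨1, fun y hy => ?_⟩
  have e : y - a = (y - x) + (x - a) := by ring
  simp only [Set.mem_ofPred_eq] at hx ⊢
  rw [e]
  exact Valuation.map_add_lt _ hy hx

theorem isOpen_proIwahori : IsOpen (proIwahori F : Set (GL2 F)) := by
  refine Subgroup.isOpen_of_mem_nhds _ (g := 1) ?_
  have h : IsOpen ((((fun x : GL2 F => x.1 0 0) ⁻¹' {x : F | valuation F (x - 1) < 1}) ∩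
      ((fun x : GL2 F => x.1 0 1) ⁻¹' {x : F | valuation F (x - 0) < 1})) ∩
      (((fun x : GL2 F => x.1 1 0) ⁻¹' {x : F | valuation F (x - 0) < 1}) ∩
      ((fun x : GL2 F => x.1 1 1) ⁻¹' {x : F | valuation F (x - 1) < 1}))) := by
    refine IsOpen.inter (IsOpen.inter ?_ ?_) (IsOpen.inter ?_ ?_) <;>
      exact (isOpen_valuation_lt_one _).preimage (continuous_GL2_apply _ _)
  refine Filter.mem_of_superset (h.mem_nhds ?_) ?_
  · simp
  · rintro x ⟨⟨h1, h2⟩, h3, h4⟩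
    simp only [Set.mem_preimage, Set.mem_ofPred_eq, sub_zero] at h1 h2 h3 h4
    exact mem_proIwahori_of_entries h1 h2.le h3 h4

/-- An integral matrix with unit diagonal whose lower left entry reduces to zero is the product of
a diagonal matrix and an element of the pro-unipotent radical of the Iwahori subgroup. -/
theorem exists_diagGL_mul {A : GL2 F} (h01 : valuation F (A.1 0 1) ≤ 1)
    (h10 : valuation F (A.1 1 0) < 1) {a b : 𝒪[F]ˣ} (ha : (unitsIncl F a : F) = A.1 0 0)
    (hb : (unitsIncl F b : F) = A.1 1 1) :
    ∃ k ∈ proIwahori F, A = diagGL (unitsIncl F a) (unitsIncl F b) * k := by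
  refine ⟨(diagGL (unitsIncl F a) (unitsIncl F b))⁻¹ * A, ?_, by group⟩
  have hva := valuation_unitsIncl a
  have hvb := valuation_unitsIncl b
  rw [diagGL_inv]
  refine mem_proIwahori_of_entries ?_ ?_ ?_ ?_
  · simp [Matrix.mul_apply, Fin.sum_univ_two, ← ha]
  · simpa [Matrix.mul_apply, Fin.sum_univ_two, hva] using h01
  · simpa [Matrix.mul_apply, Fin.sum_univ_two, hvb] using h10
  · simp [Matrix.mul_apply, Fin.sum_univ_two, ← hb]

end Iwahori

/-! ### The Iwasawa decomposition for the Siegel parabolic and the paramodular group -/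

section Iwasawa

variable {F : Type*} [Field F] [ValuativeRel F] [TopologicalSpace F]
  [IsNonarchimedeanLocalField F]

theorem valuation_div_le_one {x y : F} (h : valuation F x ≤ valuation F y) :
    valuation F (x / y) ≤ 1 := by
  rw [map_div₀]
  exact div_le_one_of_le₀ h zero_le

theorem valuation_div_lt_one {x y : F} (h : valuation F x < valuation F y) :
    valuation F (x / y) < 1 := by
  rw [map_div₀]
  exact (div_lt_one₀ (lt_of_le_of_lt zero_le h)).2 h

theorem ne_zero_of_valuation_lt {x y : F} (h : valuation F x < valuation F y) : y ≠ 0 := by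
  rintro rfl
  simp at h

/-- A row vector can be moved into the second coordinate by an integral matrix. -/
theorem exists_integral_reduce (x y : F) : ∃ h : Matrix (Fin 2) (Fin 2) F, h.det = 1 ∧
    (∀ i j, valuation F (h i j) ≤ 1) ∧ x * h 0 0 + y * h 1 0 = 0 := by
  -- The entry of smaller absolute value is divided by the other, so the quotient is integral.
  rcases le_or_gt (valuation F x) (valuation F y) with hxy | hxy
  · refine ⟨!![1, 0; -(x / y), 1], by simp [Matrix.det_fin_two], fun i j => ?_, ?_⟩
    · have := valuation_div_le_one hxy
      fin_cases i <;> fin_cases j <;> simp at this ⊢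
      exact this
    -- Here y = 0 forces x = 0, so the default value of x / y does no harm.
    · by_cases hy : y = 0
      · have hx : x = 0 := by simpa [hy] using hxy
        simp [hx, hy]
      · simp
        field_simp
        ring
  · have hx := ne_zero_of_valuation_lt hxy
    refine ⟨!![y / x, 1; -1, 0], by simp [Matrix.det_fin_two], fun i j => ?_, ?_⟩
    · have := valuation_div_le_one hxy.le
      fin_cases i <;> fin_cases j <;> simp at this ⊢
      exact this
    · simp
      field_simp
      ring

/-- A row vector can be moved into the second coordinate by a matrix in the conjugate of the
integral matrices by a uniformizer. -/
theorem exists_paramodular_reduce (ϖ : Uniformizer F) (x y : F) :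
    ∃ h : Matrix (Fin 2) (Fin 2) F, h.det = 1 ∧
      (h 0 0 ∈ pIdeal ϖ 0 ∧ h 0 1 ∈ pIdeal ϖ (-1) ∧ h 1 0 ∈ pIdeal ϖ 1 ∧ h 1 1 ∈ pIdeal ϖ 0) ∧
      x * h 0 0 + y * h 1 0 = 0 := by
  have h0 := coe_ne_zero ϖ
  -- Conjugation by a diagonal matrix with entries 1 and ϖ reduces to the integral case; on the row
  -- it scales y.
  obtain ⟨h, hd, hv, hr⟩ := exists_integral_reduce x (y * ϖ.1)
  have hm := fun i j => (mem_pIdeal_zero (ϖ := ϖ)).2 (hv i j)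
  have p1 : (ϖ.1 : F) ∈ pIdeal ϖ 1 := by simp [pIdeal]
  have p2 : (ϖ.1 : F)⁻¹ ∈ pIdeal ϖ (-1) := by simp [pIdeal]
  refine ⟨!![h 0 0, h 0 1 * (ϖ.1 : F)⁻¹; h 1 0 * ϖ.1, h 1 1], ?_,
    ⟨hm 0 0, by simpa using pIdeal_mul (hm 0 1) p2, by simpa using pIdeal_mul (hm 1 0) p1,
      hm 1 1⟩, ?_⟩
  · rw [Matrix.det_fin_two] at hd
    rw [Matrix.det_fin_two_of, ← hd]
    field_simp
  · simp only [Matrix.of_apply, Matrix.cons_val', Matrix.cons_val_zero, Matrix.cons_val_one,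
      Matrix.cons_val_fin_one]
    rw [← hr]
    ring

theorem pairElt_mem_paramodular (ϖ : Uniformizer F) {a b : Matrix (Fin 2) (Fin 2) F} {c : Fˣ}
    (ha : a.det = c) (hb : b.det = c) (hc : valuation F (c : F) = 1)
    (h : a 0 0 ∈ pIdeal ϖ 0 ∧ a 0 1 ∈ pIdeal ϖ (-1) ∧ a 1 0 ∈ pIdeal ϖ 1 ∧ a 1 1 ∈ pIdeal ϖ 0)
    (h' : ∀ i j, valuation F (b i j) ≤ 1) : pairElt a b c ha hb ∈ paramodular ϖ := by
  refine ⟨hc, fun i j => ?_⟩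
  have h'' := fun i j => (mem_pIdeal_zero (ϖ := ϖ)).2 (h' i j)
  have hz : ∀ n, (0 : F) ∈ pIdeal ϖ n := fun n => by simp [pIdeal]
  obtain ⟨h1, h2, h3, h4⟩ := h
  rw [mat_pairElt]
  fin_cases i <;> fin_cases j <;> first | exact hz _ | assumption | exact h'' _ _

/-- On the Siegel Levi the paramodular exponents are those of an Iwahori subgroup: they equal one
exactly where the lower left entries of A and A⁻¹ sit. -/
theorem leviElt_mem_paramodular (ϖ : Uniformizer F) {A : GL2 F} {c : Fˣ}
    (hc : valuation F (c : F) = 1) (hA : ∀ i j, valuation F (A.1 i j) ≤ 1)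
    (h10 : valuation F (A.1 1 0) < 1) (hA' : ∀ i j, valuation F (A⁻¹.1 i j) ≤ 1)
    (h10' : valuation F (A⁻¹.1 1 0) < 1) : leviElt A c ∈ paramodular ϖ := by
  refine ⟨hc, fun i j => ?_⟩
  have hz : ∀ n, (0 : F) ∈ pIdeal ϖ n := fun n => by simp [pIdeal]
  have h1 := fun i j => (mem_pIdeal_zero (ϖ := ϖ)).2 (hA i j)
  have h2 : ∀ i j, (c : F) * A⁻¹.1 i j ∈ pIdeal ϖ 0 := fun i j => by
    rw [mem_pIdeal_zero, map_mul, hc, one_mul]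
    exact hA' i j
  have h3 := (mem_pIdeal_one (ϖ := ϖ)).2 h10
  have h4 : (c : F) * A⁻¹.1 1 0 ∈ pIdeal ϖ 1 := by
    rw [mem_pIdeal_one, map_mul, hc, one_mul]
    exact h10'
  rw [mat_leviElt]
  fin_cases i <;> fin_cases j <;>
    first | exact hz _ | exact h3 | exact h4 | exact h1 _ _ | exact h2 _ _

theorem leviElt_mem_paramodular_of_proIwahori (ϖ : Uniformizer F) {A : GL2 F} {c : Fˣ}
    (hc : valuation F (c : F) = 1) (hA : A ∈ proIwahori F) : leviElt A c ∈ paramodular ϖ := by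
  have hA' := inv_mem hA
  exact leviElt_mem_paramodular ϖ hc hA.1 ((red_eq_zero_iff (hA.1 _ _)).1 hA.2.2.1) hA'.1
    ((red_eq_zero_iff (hA'.1 _ _)).1 hA'.2.2.1)

/-- The third and fourth rows are orthogonal for the symplectic form. -/
theorem siegel_orthogonality (g : GSp4 F) : mat g 2 0 * mat g 3 2 - mat g 2 2 * mat g 3 0 +
    (mat g 2 1 * mat g 3 3 - mat g 2 3 * mat g 3 1) = 0 := by
  have h := congrFun (congrFun (mat_rel g) 2) 3
  simp only [Matrix.mul_apply, Fin.sum_univ_four, Matrix.transpose_apply, Matrix.smul_apply] at h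
  simp [Jform] at h
  rw [← h]
  ring

theorem mat_row_ne_zero (g : GSp4 F) (i : Fin 4) (h : ∀ j, mat g i j = 0) : False := by
  have h1 : mat g * mat g⁻¹ = 1 := by rw [← mat_mul, mul_inv_cancel, mat_one]
  have h2 := congrFun (congrFun h1 i) i
  rw [Matrix.mul_apply, Fin.sum_univ_four] at h2
  simp [h] at h2

/-- Once the third row lives on one coordinate, orthogonality kills the dual coordinate of the
fourth row. The entry still to be cleared lies in the other symplectic plane, where an element of
determinant one acts without disturbing the third row. -/
theorem exists_mul_mem_siegel_of_coord (ϖ : Uniformizer F) (g : GSp4 F) (h0 : mat g 2 0 = 0)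
    (h1 : mat g 2 1 = 0) (h : mat g 2 2 = 0 ∨ mat g 2 3 = 0) :
    ∃ j ∈ paramodular ϖ, g * j ∈ siegel F := by
  have ho := siegel_orthogonality g
  rw [h0, h1] at ho
  have hone : valuation F ((1 : Fˣ) : F) = 1 := by simp
  rcases h with h | h
  · have h3 : mat g 2 3 ≠ 0 := fun h3 => mat_row_ne_zero g 2 fun j => by
      fin_cases j <;> assumption
    have h31 : mat g 3 1 = 0 := by simpa [h, h3] using ho
    obtain ⟨m, hd, hm, hr⟩ := exists_paramodular_reduce ϖ (mat g 3 0) (mat g 3 2)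
    refine ⟨pairElt m 1 1 (by simpa using hd) (by simp),
      pairElt_mem_paramodular ϖ _ _ hone hm fun i j => ?_, ?_⟩
    · by_cases hij : i = j
      · subst hij
        simp
      · simp [hij]
    · refine ⟨?_, ?_, ?_, ?_⟩ <;>
        simp [mat_mul, mat_pairElt, Matrix.mul_apply, Fin.sum_univ_four, h0, h1, h, h31, hr]
  · have h3 : mat g 2 2 ≠ 0 := fun h3 => mat_row_ne_zero g 2 fun j => by
      fin_cases j <;> assumption
    have h30 : mat g 3 0 = 0 := by simpa [h, h3] using ho
    obtain ⟨m, hd, hm, hr⟩ := exists_integral_reduce (mat g 3 1) (mat g 3 3)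
    refine ⟨pairElt 1 m 1 (by simp) (by simpa using hd),
      pairElt_mem_paramodular ϖ _ _ hone ?_ hm, ?_⟩
    · simp [pIdeal]
    · refine ⟨?_, ?_, ?_, ?_⟩ <;>
        simp [mat_mul, mat_pairElt, Matrix.mul_apply, Fin.sum_univ_four, h0, h1, h, h30, hr]

/-- A unipotent Levi element uses the larger of the two remaining entries of the third row to clear
the other. -/
theorem exists_mul_mem_siegel_of_row (ϖ : Uniformizer F) (g : GSp4 F) (h0 : mat g 2 0 = 0)
    (h1 : mat g 2 1 = 0) : ∃ j ∈ paramodular ϖ, g * j ∈ siegel F := by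
  have key : ∀ A ∈ proIwahori F, (mat (g * leviElt A 1) 2 2 = 0 ∨ mat (g * leviElt A 1) 2 3 = 0) →
      ∃ j ∈ paramodular ϖ, g * j ∈ siegel F := by
    intro A hA h
    have hA' := leviElt_mem_paramodular_of_proIwahori ϖ (c := 1) (by simp) hA
    obtain ⟨j, hj, hj'⟩ := exists_mul_mem_siegel_of_coord ϖ (g * leviElt A 1)
      (by simp [mat_mul, mat_leviElt, Matrix.mul_apply, Fin.sum_univ_four, h0, h1])
      (by simp [mat_mul, mat_leviElt, Matrix.mul_apply, Fin.sum_univ_four, h0, h1]) h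
    exact ⟨leviElt A 1 * j, mul_mem hA' hj, by rwa [← mul_assoc]⟩
  -- Equality belongs to the upper unipotent case: a lower unipotent lies in the Iwahori group only
  -- if the quotient is in the maximal ideal.
  rcases le_or_gt (valuation F (mat g 2 2)) (valuation F (mat g 2 3)) with hle | hlt
  · have h3 : mat g 2 3 ≠ 0 := fun h3 => mat_row_ne_zero g 2 fun j => by
      have h2 : mat g 2 2 = 0 := by simpa [h3] using hle
      fin_cases j <;> assumption
    refine key (upperUnip (mat g 2 2 / mat g 2 3))
      (upperUnip_mem_proIwahori (valuation_div_le_one hle)) (Or.inl ?_)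
    rw [mat_mul, mat_leviElt, GL2_inv_val]
    simp [Matrix.mul_apply, Fin.sum_univ_four]
    field_simp
    ring
  · have h2 := ne_zero_of_valuation_lt hlt
    refine key (lowerUnip (mat g 2 3 / mat g 2 2))
      (lowerUnip_mem_proIwahori (valuation_div_lt_one hlt)) (Or.inr ?_)
    rw [mat_mul, mat_leviElt, GL2_inv_val]
    simp [Matrix.mul_apply, Fin.sum_univ_four]
    field_simp
    ring

/-- The third row splits along the two symplectic planes, and a pair element clears its first entry
in each plane independently. -/
theorem exists_mul_mem_siegel (ϖ : Uniformizer F) (g : GSp4 F) :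
    ∃ j ∈ paramodular ϖ, g * j ∈ siegel F := by
  obtain ⟨a, had, ha, hra⟩ := exists_paramodular_reduce ϖ (mat g 2 0) (mat g 2 2)
  obtain ⟨b, hbd, hb, hrb⟩ := exists_integral_reduce (mat g 2 1) (mat g 2 3)
  have had' : a.det = ((1 : Fˣ) : F) := by simpa using had
  have hbd' : b.det = ((1 : Fˣ) : F) := by simpa using hbd
  have hmem := pairElt_mem_paramodular ϖ had' hbd' (by simp) ha hb
  obtain ⟨j, hj, hj'⟩ := exists_mul_mem_siegel_of_row ϖ (g * pairElt a b 1 had' hbd')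
    (by simp [mat_mul, mat_pairElt, Matrix.mul_apply, Fin.sum_univ_four, hra])
    (by simp [mat_mul, mat_pairElt, Matrix.mul_apply, Fin.sum_univ_four, hrb])
  exact ⟨_, mul_mem hmem hj, by rwa [← mul_assoc]⟩

/-- The Iwasawa decomposition of `GSp(4, F)` for the Siegel parabolic and the paramodular group. -/
theorem exists_siegel_mul_paramodular (ϖ : Uniformizer F) (g : GSp4 F) :
    ∃ (p : siegel F) (j : paramodular ϖ), g = (p : GSp4 F) * (j : GSp4 F) := by
  obtain ⟨j, hj, hp⟩ := exists_mul_mem_siegel ϖ g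
  exact ⟨⟨_, hp⟩, ⟨_, inv_mem hj⟩, by simp⟩

end Iwasawa

/-! ### Integral points of the Siegel parabolic and their image in the Levi quotient -/

section SiegelParamodular

variable {F : Type*} [Field F] [ValuativeRel F] [TopologicalSpace F]
  [IsNonarchimedeanLocalField F] {V : Type*} [AddCommGroup V] [Module ℂ V]

/-- The projection of the integral points of the Siegel parabolic to the Levi quotient of the
paramodular group. -/
abbrev siegelParMap (ϖ : Uniformizer F) :
    (siegel F ⊓ paramodular ϖ : Subgroup (GSp4 F)) →* GL2sq0 𝓀[F] :=
  (leviMap ϖ).comp (Subgroup.inclusion (inf_le_right : siegel F ⊓ paramodular ϖ ≤ paramodular ϖ))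

/-- The inducing representation of `siegelInd`, restricted to the integral points of the Siegel
parabolic. -/
abbrev siegelParRep (ϖ : Uniformizer F) (σ : Representation ℂ (GL2 F) V) (μ₀ : Fˣ →* ℂˣ) :
    Representation ℂ (siegel F ⊓ paramodular ϖ : Subgroup (GSp4 F)) V :=
  MonoidHom.comp (twist ((nuPow F (3 / 2)).comp (Matrix.GeneralLinearGroup.det.comp (siegelLevi F) /
      simi.comp (siegel F).subtype) * μ₀.comp (simi.comp (siegel F).subtype))
    (σ.comp (siegelLevi F)))
    (Subgroup.inclusion (inf_le_left : siegel F ⊓ paramodular ϖ ≤ siegel F))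

/-- The upper left block of an integral point of the Siegel parabolic. -/
abbrev siegelParLevi (ϖ : Uniformizer F) :
    (siegel F ⊓ paramodular ϖ : Subgroup (GSp4 F)) →* GL2 F :=
  (siegelLevi F).comp (Subgroup.inclusion (inf_le_left : siegel F ⊓ paramodular ϖ ≤ siegel F))

/-- A representation is a parahoric restriction of `σ ⋊ μ₀` if it is equivalent to it. -/
def IsParamodularRes (ϖ : Uniformizer F) (σ : Representation ℂ (GL2 F) V) (μ₀ : Fˣ →* ℂˣ)
    {W : Type*} [AddCommMonoid W] [Module ℂ W] (ρ : Representation ℂ (GL2sq0 𝓀[F]) W) : Prop :=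
  Nonempty ((paramodularRes ϖ (siegelInd σ μ₀)).Equiv ρ)

/-- Mackey's formula applies with one term by the Iwasawa decomposition. From here on only the
action of P ∩ J on the space of σ matters. -/
theorem isParamodularRes_siegelParInd (ϖ : Uniformizer F)
    (σ : Representation ℂ (GL2 F) V) (μ₀ : Fˣ →* ℂˣ) :
    IsParamodularRes ϖ σ μ₀
      (Representation.coind (siegelParMap ϖ) (siegelParRep ϖ σ μ₀)) :=
  nonempty_parRes_smoothInd_equiv _ _ _ _ _ (leviMap_surjective ϖ) (leviMap_ker ϖ)
    (isOpen_paramodularPlus ϖ) (exists_siegel_mul_paramodular ϖ)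

theorem left_ne_zero_of_det {K : Type*} [Field K] {a b c d : K} (h : a * d - b * c ≠ 0)
    (hc : c = 0) : a ≠ 0 := by
  rw [hc, mul_zero, sub_zero] at h
  exact left_ne_zero_of_mul h

theorem det_mul_inv_of_lower_zero {K : Type*} [Field K] {a b c d : K} (ha : a ≠ 0) (hc : c = 0) :
    (a * d - b * c) * a⁻¹ = d := by
  rw [hc]
  field_simp
  ring

theorem valuation_det_proIwahori {k : GL2 F} (hk : k ∈ proIwahori F) :
    valuation F k.1.det = 1 := by
  refine valuation_eq_one_of_red ?_ ?_
  · rw [Matrix.det_fin_two]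
    exact val_sub_le (val_det_le hk.1).1 (val_det_le hk.1).2
  · rw [red_det hk.1, hk.2.1, hk.2.2.1, hk.2.2.2]
    simp

/-- The integral points of the Siegel parabolic and their images in the Levi quotient of the
paramodular group. -/
theorem siegelPar_decomp (ϖ : Uniformizer F)
    (q : (siegel F ⊓ paramodular ϖ : Subgroup (GSp4 F))) :
    ∃ (a b c : 𝒪[F]ˣ) (β : pairBorel 𝓀[F]), (∃ k ∈ proIwahori F,
        siegelParLevi ϖ q = diagGL (unitsIncl F a) (unitsIncl F b) * k) ∧
      simi q.1 = unitsIncl F c ∧ siegelParMap ϖ q = β ∧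
      unitsRed F a = borelFst _ (pairBorelFst _ β) ∧ unitsRed F b = borelFst _ (pairBorelSnd _ β) ∧
      unitsRed F c = Matrix.GeneralLinearGroup.det β.1.1.1 := by
  obtain ⟨q, ⟨h20, h21, h30, h31⟩, hq⟩ := q
  have hle := fun i j (h : expJ i j = 0) => mem_pIdeal_zero.1 (h ▸ hq.2 i j)
  have hs : red (simi q : F) ≠ 0 := by
    rw [Ne, red_eq_zero_iff hq.1.le, hq.1]
    exact lt_irrefl _
  have h1 := det_leviFstMat ϖ ⟨q, hq⟩
  have h2 := det_leviSndMat ϖ ⟨q, hq⟩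
  have z1 : red (mat q 2 0 * (ϖ.1 : F)⁻¹) = 0 := by rw [h20, zero_mul, red_zero]
  have z2 : red (mat q 3 1) = 0 := by rw [h31, red_zero]
  have h1' := h1
  rw [leviFstMat, Matrix.det_fin_two_of] at h1
  rw [leviSndMat, Matrix.det_fin_two_of] at h2
  -- Both components reduce to upper triangular matrices with the unit similitude as determinant, so
  -- their upper left entries are units.
  have n1 := left_ne_zero_of_det (h1.trans_ne hs) z1
  have n2 := left_ne_zero_of_det (h2.trans_ne hs) z2
  obtain ⟨a, ha⟩ := exists_unitsIncl (valuation_eq_one_of_red (hle 0 0 rfl) n1)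
  obtain ⟨b, hb⟩ := exists_unitsIncl (valuation_eq_one_of_red (hle 1 1 rfl) n2)
  obtain ⟨c, hc⟩ := exists_unitsIncl_units hq.1
  refine ⟨a, b, c, ⟨leviMap ϖ ⟨q, hq⟩, ?_, ?_⟩, ?_, hc.symm, rfl, ?_, ?_, ?_⟩
  · exact z1
  · exact z2
  -- The paramodular exponent one at the lower left entry of the block makes it an Iwahori matrix,
  -- hence diagonal times pro-unipotent.
  · exact exists_diagGL_mul (A := siegelLevi F ⟨q, _⟩) (hle 0 1 rfl)
      (mem_pIdeal_one.1 (hq.2 1 0)) ha hb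
  · refine unitsRed_eq_of_red ?_
    rw [ha]
    rfl
  · refine unitsRed_eq_of_red ?_
    rw [hb]
    rfl
  · refine unitsRed_eq_of_red ?_
    rw [hc]
    exact h1'.symm

/-- The modulus factor disappears because both the determinant of the block and the similitude are
units. -/
theorem siegelParRep_apply (ϖ : Uniformizer F) (σ : Representation ℂ (GL2 F) V) (μ₀ : Fˣ →* ℂˣ)
    (q : (siegel F ⊓ paramodular ϖ : Subgroup (GSp4 F))) (v : V) :
    siegelParRep ϖ σ μ₀ q v = (μ₀ (simi q.1) : ℂ) • σ (siegelParLevi ϖ q) v := by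
  obtain ⟨a, b, c, -, ⟨k, hk, hA⟩, hc, -⟩ := siegelPar_decomp ϖ q
  have h1 : nuPow F (3 / 2) (Matrix.GeneralLinearGroup.det (siegelParLevi ϖ q) / simi q.1) = 1 := by
    refine nuPow_eq_one _ ?_
    rw [hA, hc, map_mul, det_diagGL, div_eq_mul_inv]
    simp only [Units.val_mul, map_mul, valuation_unitsIncl, Units.val_inv_eq_inv_val, map_inv₀,
      Matrix.GeneralLinearGroup.val_det_apply, valuation_det_proIwahori hk]
    simp
  change ((nuPow F (3 / 2) (Matrix.GeneralLinearGroup.det (siegelParLevi ϖ q) / simi q.1) *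
    μ₀ (simi q.1) : ℂˣ) : ℂ) • σ (siegelParLevi ϖ q) v = _
  rw [h1, one_mul]

/-- Upper triangular matrices over the residue field lift to upper triangular matrices. -/
theorem exists_borel_lift (β : borel 𝓀[F]) (c : 𝒪[F]ˣ)
    (hc : unitsRed F c = Matrix.GeneralLinearGroup.det β.1) :
    ∃ (a : 𝒪[F]ˣ) (u : F), unitsRed F a = borelFst _ β ∧ valuation F u ≤ 1 ∧
      red u = β.1.1 0 1 ∧ valuation F ((unitsIncl F c : F) * (unitsIncl F a : F)⁻¹) ≤ 1 ∧
      red ((unitsIncl F c : F) * (unitsIncl F a : F)⁻¹) = β.1.1 1 1 := by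
  obtain ⟨a, ha⟩ := unitsRed_surjective F (borelFst _ β)
  obtain ⟨u, hu, hu'⟩ := exists_red_eq (β.1.1 0 1)
  have hva := valuation_unitsIncl a
  have hvc := valuation_unitsIncl c
  have ra : red (unitsIncl F a : F) = β.1.1 0 0 := (red_unitsIncl a).trans (congrArg Units.val ha)
  have rc : red (unitsIncl F c : F) = β.1.1.det := (red_unitsIncl c).trans (congrArg Units.val hc)
  have h0 : β.1.1 0 0 ≠ 0 := (mul_ne_zero_iff.1 (det_of_lower_zero β.2)).1
  refine ⟨a, u, ha, hu, hu', by simp [hva, hvc], ?_⟩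
  rw [red_mul hvc.le (by simp [hva]), red_inv hva, rc, Matrix.det_fin_two, ra]
  exact det_mul_inv_of_lower_zero h0 β.2

/-- Pairs of upper triangular matrices lift to integral points of the Siegel parabolic. -/
theorem exists_siegelPar_lift (ϖ : Uniformizer F) (β : pairBorel 𝓀[F]) :
    ∃ q : (siegel F ⊓ paramodular ϖ : Subgroup (GSp4 F)), siegelParMap ϖ q = β := by
  have h0 := coe_ne_zero ϖ
  obtain ⟨c, hc⟩ := unitsRed_surjective F (Matrix.GeneralLinearGroup.det β.1.1.1)
  obtain ⟨a, u, ha, hu, hu', hca, rca⟩ := exists_borel_lift (pairBorelFst _ β) c hc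
  obtain ⟨b, v, hb, hv, hv', hcb, rcb⟩ := exists_borel_lift (pairBorelSnd _ β) c
    (hc.trans β.1.2)
  have ha0 := (unitsIncl F a).ne_zero
  have hb0 := (unitsIncl F b).ne_zero
  have hva := valuation_unitsIncl a
  have hvb := valuation_unitsIncl b
  have hvc := valuation_unitsIncl c
  -- The lower right entries c/a and c/b give both blocks the exact determinant c; the factor ϖ⁻¹
  -- undoes the scaling in the projection to the first component.
  let A : Matrix (Fin 2) (Fin 2) F := !![(unitsIncl F a : F), u * (ϖ.1 : F)⁻¹;
    0, (unitsIncl F c : F) * (unitsIncl F a : F)⁻¹]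
  let B : Matrix (Fin 2) (Fin 2) F := !![(unitsIncl F b : F), v;
    0, (unitsIncl F c : F) * (unitsIncl F b : F)⁻¹]
  have hA : A.det = unitsIncl F c := by
    simp only [A, Matrix.det_fin_two_of]
    field_simp
    ring
  have hB : B.det = unitsIncl F c := by
    simp only [B, Matrix.det_fin_two_of]
    field_simp
    ring
  have hmem : pairElt A B (unitsIncl F c) hA hB ∈ paramodular ϖ := by
    refine pairElt_mem_paramodular ϖ hA hB hvc ⟨?_, ?_, ?_, ?_⟩ ?_
    · exact mem_pIdeal_zero.2 hva.le
    · have p2 : (ϖ.1 : F)⁻¹ ∈ pIdeal ϖ (-1) := by simp [pIdeal]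
      have p3 := pIdeal_mul ((mem_pIdeal_zero (ϖ := ϖ)).2 hu) p2
      rwa [zero_add] at p3
    · simp [A, pIdeal]
    · exact mem_pIdeal_zero.2 hca
    · intro i j
      fin_cases i <;> fin_cases j
      exacts [hvb.le, hv, by simp [B], hcb]
  have hsie : pairElt A B (unitsIncl F c) hA hB ∈ siegel F := by
    refine ⟨?_, ?_, ?_, ?_⟩ <;> simp [mat_pairElt, A, B]
  refine ⟨⟨_, hsie, hmem⟩, ?_⟩
  · refine Subtype.ext (Prod.ext (GL2_ext ?_ ?_ ?_ ?_) (GL2_ext ?_ ?_ ?_ ?_))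
    · exact (red_unitsIncl a).trans (congrArg Units.val ha)
    · change red (u * (ϖ.1 : F)⁻¹ * ϖ.1) = _
      rw [inv_mul_cancel_right₀ h0]
      exact hu'
    · change red (0 * (ϖ.1 : F)⁻¹) = _
      rw [zero_mul, red_zero]
      exact (mem_borel.1 β.2.1).symm
    · exact rca
    · exact (red_unitsIncl b).trans (congrArg Units.val hb)
    · exact hv'
    · exact red_zero.trans (mem_borel.1 β.2.2).symm
    · exact rcb

/-- Elements of the pro-unipotent radical of the Iwahori subgroup, as integral points of the
Siegel parabolic. -/
theorem exists_siegelPar_of_proIwahori (ϖ : Uniformizer F) {k : GL2 F} (hk : k ∈ proIwahori F)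
    {c : 𝒪[F]ˣ} (hc : c ∈ principalUnits F) :
    ∃ q : (siegel F ⊓ paramodular ϖ : Subgroup (GSp4 F)), siegelParLevi ϖ q = k ∧
      simi q.1 = unitsIncl F c ∧ siegelParMap ϖ q = 1 := by
  have hk' := inv_mem hk
  rw [mem_principalUnits_iff] at hc
  have hvc := valuation_unitsIncl c
  have hmem := leviElt_mem_paramodular_of_proIwahori ϖ hvc hk
  have hsie : leviElt k (unitsIncl F c) ∈ siegel F := by
    refine ⟨?_, ?_, ?_, ?_⟩ <;> simp [mat_leviElt]
  refine ⟨⟨_, hsie, hmem⟩, ?_, rfl, ?_⟩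
  · apply GL2_ext <;> rfl
  · refine Subtype.ext (Prod.ext (GL2_ext ?_ ?_ ?_ ?_) (GL2_ext ?_ ?_ ?_ ?_))
    · exact hk.2.1
    · change red (0 * (ϖ.1 : F)) = 0
      rw [zero_mul, red_zero]
    · change red (0 * (ϖ.1 : F)⁻¹) = 0
      rw [zero_mul, red_zero]
    · change red ((unitsIncl F c : F) * k⁻¹.1 0 0) = 1
      rw [red_mul hvc.le (hk'.1 _ _), hc, hk'.2.1, one_mul]
    · exact hk.2.2.2
    · exact red_zero
    · exact red_zero
    · change red ((unitsIncl F c : F) * k⁻¹.1 1 1) = 1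
      rw [red_mul hvc.le (hk'.1 _ _), hc, hk'.2.2.2, one_mul]

end SiegelParamodular

/-! ### Tame characters and their restrictions to the residue field -/

section Tame

variable {F : Type*} [Field F] [ValuativeRel F] [TopologicalSpace F]
  [IsNonarchimedeanLocalField F]

/-- A character of `Fˣ` is tame if it is trivial on the principal units. -/
def IsTame (μ : Fˣ →* ℂˣ) : Prop := ∀ u ∈ principalUnits F, μ (unitsIncl F u) = 1

theorem IsTame.exists_char {μ : Fˣ →* ℂˣ} (h : IsTame μ) :
    ∃ χ : 𝓀[F]ˣ →* ℂˣ, ∀ u, χ (unitsRed F u) = μ (unitsIncl F u) :=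
  ⟨(unitsRed F).liftOfSurjective (unitsRed_surjective F)
    ⟨μ.comp (unitsIncl F), fun u hu => h u (unitsRed_ker F ▸ hu)⟩, fun u =>
    MonoidHom.liftOfRightInverse_comp_apply _ _ _ _ u⟩

theorem subsingleton_tameRes {μ : Fˣ →* ℂˣ} (h : ¬ IsTame μ) :
    Subsingleton (Representation.invariants
      (((charRep μ).comp (unitsIncl F)).comp (principalUnits F).subtype)) := by
  obtain ⟨u, hu, hne⟩ : ∃ u ∈ principalUnits F, μ (unitsIncl F u) ≠ 1 := by
    by_contra! h'
    exact h h'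
  refine subsingleton_of_forall_eq 0 fun v => Subtype.ext ?_
  have h1 : (μ (unitsIncl F u) : ℂ) * v.1 = v.1 := v.2 ⟨u, hu⟩
  by_contra h0
  exact hne (Units.ext (mul_right_cancel₀ h0 (h1.trans (one_mul _).symm)))

theorem exists_tameRes_equiv {μ : Fˣ →* ℂˣ} {χ : 𝓀[F]ˣ →* ℂˣ}
    (hχ : ∀ u, χ (unitsRed F u) = μ (unitsIncl F u)) :
    ∃ e : Representation.invariants
        (((charRep μ).comp (unitsIncl F)).comp (principalUnits F).subtype) ≃ₗ[ℂ] ℂ,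
      ∀ u a, e (tameRes μ u a) = χ u * e a := by
  have htop : Representation.invariants
      (((charRep μ).comp (unitsIncl F)).comp (principalUnits F).subtype) = ⊤ := by
    rw [eq_top_iff]
    rintro z - ⟨u, hu⟩
    change (μ (unitsIncl F u) : ℂ) * z = z
    rw [← unitsRed_ker, MonoidHom.mem_ker] at hu
    rw [← hχ, hu, map_one, Units.val_one, one_mul]
  refine ⟨LinearEquiv.ofTop _ htop, fun u a => ?_⟩
  obtain ⟨u, rfl⟩ := unitsRed_surjective F u
  rw [LinearEquiv.ofTop_apply, LinearEquiv.ofTop_apply, parRes_apply, hχ]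
  rfl

end Tame

/-! ### Decomposing coinduced representations by eigenvectors -/

section Eigenvectors

variable {Q L V : Type*} [Group Q] [Group L] [AddCommGroup V] [Module ℂ V] {π : Q →* L}
  {B : Subgroup L} {τ : Representation ℂ Q V} {ψ ψ' : B →* ℂˣ} {e e' : V}

/-- The map between coinduced representations that is given by an eigenvector. -/
def eigenMap (hB : ∀ q, ∃ β : B, π q = β)
    (he : ∀ q (β : B), π q = β → τ q e = (ψ β : ℂ) • e) :
    Representation.coindV B.subtype (charRep ψ) →ₗ[ℂ] Representation.coindV π τ where
  toFun φ := ⟨fun l => φ.1 l • e, by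
    intro q l
    obtain ⟨β, hβ⟩ := hB q
    have h1 : φ.1 (β.1 * l) = ψ β * φ.1 l := φ.2 β l
    beta_reduce
    rw [map_smul, he q β hβ, hβ, h1, smul_smul, mul_comm]⟩
  map_add' φ φ' := by
    ext l
    exact add_smul _ _ _
  map_smul' z φ := by
    ext l
    exact mul_smul _ _ _

/-- The transformation law at an element of the kernel of π compares φ l with itself, so the values
of coinduced functions are fixed by the kernel. -/
theorem coind_fixed (φ : Representation.coindV π τ) (l : L) {q : Q} (hq : π q = 1) :
    τ q (φ.1 l) = φ.1 l := by
  have h := φ.2 q l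
  rw [hq, one_mul] at h
  exact h.symm

/-- A coinduced representation for which the fixed vectors of the kernel are spanned by two
independent eigenvectors. -/
theorem nonempty_equiv_of_eigenvectors (hB : ∀ q, ∃ β : B, π q = β)
    (hsurj : ∀ β : B, ∃ q, π q = β) (he : ∀ q (β : B), π q = β → τ q e = (ψ β : ℂ) • e)
    (he' : ∀ q (β : B), π q = β → τ q e' = (ψ' β : ℂ) • e')
    (hspan : ∀ v : V, (∀ q, π q = 1 → τ q v = v) → ∃ z z' : ℂ, v = z • e + z' • e')
    (hind : ∀ z z' : ℂ, z • e + z' • e' = 0 → z = 0 ∧ z' = 0) :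
    Nonempty ((Representation.coind π τ).Equiv
      ((Representation.coind B.subtype (charRep ψ)).prod
        (Representation.coind B.subtype (charRep ψ')))) := by
  have huniq : ∀ z z' w w' : ℂ, z • e + z' • e' = w • e + w' • e' → z = w ∧ z' = w' := by
    intro z z' w w' h
    have h' := hind (z - w) (z' - w') (by
      rw [sub_smul, sub_smul, ← sub_eq_zero.2 h]
      abel)
    exact ⟨sub_eq_zero.1 h'.1, sub_eq_zero.1 h'.2⟩
  refine ⟨(equivOfBijective ((eigenMap hB he).coprod (eigenMap hB he')) ⟨?_, ?_⟩ ?_).symm⟩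
  · rintro ⟨φ, φ'⟩ ⟨ψ, ψ'⟩ h
    have h' := fun l => huniq _ _ _ _ (congrFun (congrArg Subtype.val h) l)
    exact Prod.ext (Subtype.ext (funext fun l => (h' l).1)) (Subtype.ext (funext fun l => (h' l).2))
  · intro φ
    -- The values lie in the span of e and e'; their coordinates are the two component functions.
    choose c c' hc using fun l => hspan (φ.1 l) fun q hq => coind_fixed φ l hq
    -- Lifting β to Q and comparing coordinates in the law for φ gives the law for each component.
    have hmem : ∀ (β : B) (l : L), c (β * l) = ψ β * c l ∧ c' (β * l) = ψ' β * c' l := by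
      intro β l
      obtain ⟨q, hβ⟩ := hsurj β
      have h1 := φ.2 q l
      rw [hβ, hc l, map_add, map_smul, map_smul, he q β hβ, he' q β hβ, hc] at h1
      apply huniq
      rw [h1, smul_smul, smul_smul, mul_comm, mul_comm (c' l)]
    refine ⟨⟨⟨c, fun β l => (hmem β l).1⟩, ⟨c', fun β l => (hmem β l).2⟩⟩, ?_⟩
    ext l
    exact (hc l).symm
  · rintro g ⟨φ, φ'⟩
    rfl

/-- A coinduced representation for which the fixed vectors of the kernel are spanned by an
eigenvector. -/
theorem nonempty_equiv_of_eigenvector (hB : ∀ q, ∃ β : B, π q = β)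
    (hsurj : ∀ β : B, ∃ q, π q = β) (he : ∀ q (β : B), π q = β → τ q e = (ψ β : ℂ) • e)
    (hspan : ∀ v : V, (∀ q, π q = 1 → τ q v = v) → ∃ z : ℂ, v = z • e) (hne : e ≠ 0) :
    Nonempty ((Representation.coind π τ).Equiv
      (Representation.coind B.subtype (charRep ψ))) := by
  have huniq : ∀ z w : ℂ, z • e = w • e → z = w := fun z w h => smul_left_injective ℂ hne h
  refine ⟨(equivOfBijective (eigenMap hB he) ⟨?_, ?_⟩ fun _ _ => rfl).symm⟩
  · intro φ ψ h
    exact Subtype.ext (funext fun l => huniq _ _ (congrFun (congrArg Subtype.val h) l))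
  · intro φ
    choose c hc using fun l => hspan (φ.1 l) fun q hq => coind_fixed φ l hq
    have hmem : ∀ (β : B) (l : L), c (β * l) = ψ β * c l := by
      intro β l
      obtain ⟨q, hβ⟩ := hsurj β
      have h1 := φ.2 q l
      rw [hβ, hc l, map_smul, he q β hβ, hc] at h1
      apply huniq
      rw [h1, smul_smul, mul_comm]
    refine ⟨⟨c, hmem⟩, ?_⟩
    ext l
    exact (hc l).symm

theorem subsingleton_coindV (h : ∀ v : V, (∀ q, π q = 1 → τ q v = v) → v = 0) :
    Subsingleton (Representation.coindV π τ) :=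
  subsingleton_of_forall_eq 0 fun φ => Subtype.ext <| funext fun l =>
    h _ fun _ hq => coind_fixed φ l hq

end Eigenvectors

/-! ### From torus eigenvectors of σ to the parahoric restriction -/

section SiegelParamodularEigenvectors

variable {F : Type*} [Field F] [ValuativeRel F] [TopologicalSpace F]
  [IsNonarchimedeanLocalField F] {V : Type*} [AddCommGroup V] [Module ℂ V]
  {ϖ : Uniformizer F} {σ : Representation ℂ (GL2 F) V} {μ₀ : Fˣ →* ℂˣ}

/-- Each k in the pro-unipotent radical lifts to diag(k, k⁻ᵗ), which has similitude one and trivial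
image in the Levi quotient. -/
theorem fixed_proIwahori_of_fixed {v : V}
    (h : ∀ q, siegelParMap ϖ q = 1 → siegelParRep ϖ σ μ₀ q v = v) :
    ∀ k ∈ proIwahori F, σ k v = v := by
  intro k hk
  obtain ⟨q, h1, h2, h3⟩ := exists_siegelPar_of_proIwahori ϖ hk (one_mem (principalUnits F))
  have h' := h q h3
  rw [siegelParRep_apply, h1, h2, map_one, map_one, Units.val_one, one_smul] at h'
  exact h'

theorem subsingleton_siegelParInd_of_fixed
    (h : ∀ v : V, (∀ k ∈ proIwahori F, σ k v = v) → v = 0) :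
    Subsingleton (Representation.coindV (siegelParMap ϖ) (siegelParRep ϖ σ μ₀)) :=
  subsingleton_coindV fun v hv => h v (fixed_proIwahori_of_fixed hv)

/-- For a principal unit c the element diag(1, 1, c, c) lies in the kernel of the projection and
acts by the scalar μ₀(c). -/
theorem subsingleton_siegelParInd_of_not_isTame (h : ¬ IsTame μ₀) :
    Subsingleton (Representation.coindV (siegelParMap ϖ) (siegelParRep ϖ σ μ₀)) := by
  obtain ⟨u, hu, hne⟩ : ∃ u ∈ principalUnits F, μ₀ (unitsIncl F u) ≠ 1 := by
    by_contra! h'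
    exact h h'
  refine subsingleton_coindV fun v hv => ?_
  obtain ⟨q, h1, h2, h3⟩ := exists_siegelPar_of_proIwahori ϖ (one_mem (proIwahori F)) hu
  have h := hv q h3
  rw [siegelParRep_apply, h1, h2, map_one, Module.End.one_apply] at h
  have h' : ((μ₀ (unitsIncl F u) : ℂ) - 1) • v = 0 := by
    rw [sub_smul, one_smul, h, sub_self]
  refine (smul_eq_zero.1 h').resolve_left fun h0 => hne (Units.ext ?_)
  rw [sub_eq_zero] at h0
  exact h0

variable (σ) in
/-- A vector fixed by the pro-unipotent radical of the Iwahori subgroup on which the torus over the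
integers acts by a pair of characters of the residue field. -/
structure IsTorusEigenvector (e : V) (χ₁ χ₂ : 𝓀[F]ˣ →* ℂˣ) : Prop where
  fixed : ∀ k ∈ proIwahori F, σ k e = e
  torus : ∀ a b : 𝒪[F]ˣ, σ (diagGL (unitsIncl F a) (unitsIncl F b)) e =
    (χ₁ (unitsRed F a) * χ₂ (unitsRed F b) : ℂ) • e

theorem pairChar_apply {k : Type*} [Field k] (χ₀ χ₁ χ₂ : kˣ →* ℂˣ) (β : pairBorel k) :
    (pairChar χ₀ χ₁ χ₂ β : ℂ) = χ₀ (Matrix.GeneralLinearGroup.det β.1.1.1) *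
      (χ₁ (borelFst _ (pairBorelFst _ β)) * χ₂ (borelFst _ (pairBorelSnd _ β))) := by
  simp [pairChar, pairBorelFst]

variable {χ₀ χ₁ χ₂ : 𝓀[F]ˣ →* ℂˣ}

-- In the decomposition of q, the factor k fixes e, the torus part acts through the upper left
-- entries of the two components of β, and μ₀ of the similitude becomes χ₀ of their determinant.
set_option maxHeartbeats 800000 in
theorem IsTorusEigenvector.siegelParRep_eq {e : V} (he : IsTorusEigenvector σ e χ₁ χ₂)
    (hχ₀ : ∀ u, χ₀ (unitsRed F u) = μ₀ (unitsIncl F u))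
    (q : (siegel F ⊓ paramodular ϖ : Subgroup (GSp4 F))) (β : pairBorel 𝓀[F])
    (hβ : siegelParMap ϖ q = β) :
    siegelParRep ϖ σ μ₀ q e = (pairChar χ₀ χ₁ χ₂ β : ℂ) • e := by
  obtain ⟨a, b, c, β', ⟨k, hk, hA⟩, hc, hβ', ha', hb', hc'⟩ := siegelPar_decomp ϖ q
  obtain rfl : β' = β := Subtype.ext (hβ'.symm.trans hβ)
  have h1 := he.torus a b
  rw [ha', hb'] at h1
  have h2 := hχ₀ c
  rw [hc'] at h2
  rw [siegelParRep_apply, hc, hA, map_mul, Module.End.mul_apply, he.fixed k hk, h1, ← h2,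
    pairChar_apply, smul_smul]

theorem exists_pairBorel (ϖ : Uniformizer F)
    (q : (siegel F ⊓ paramodular ϖ : Subgroup (GSp4 F))) :
    ∃ β : pairBorel 𝓀[F], siegelParMap ϖ q = β := by
  obtain ⟨-, -, -, β, -, -, hβ, -⟩ := siegelPar_decomp ϖ q
  exact ⟨β, hβ⟩

theorem nonempty_siegelParInd_equiv_prod {χ₁' χ₂' : 𝓀[F]ˣ →* ℂˣ}
    (hχ₀ : ∀ u, χ₀ (unitsRed F u) = μ₀ (unitsIncl F u)) {e e' : V}
    (he : IsTorusEigenvector σ e χ₁ χ₂) (he' : IsTorusEigenvector σ e' χ₁' χ₂')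
    (hspan : ∀ v : V, (∀ k ∈ proIwahori F, σ k v = v) → ∃ z z' : ℂ, v = z • e + z' • e')
    (hind : ∀ z z' : ℂ, z • e + z' • e' = 0 → z = 0 ∧ z' = 0) :
    Nonempty ((Representation.coind (siegelParMap ϖ) (siegelParRep ϖ σ μ₀)).Equiv
      ((pairInd χ₀ χ₁ χ₂).prod (pairInd χ₀ χ₁' χ₂'))) :=
  nonempty_equiv_of_eigenvectors (exists_pairBorel ϖ) (exists_siegelPar_lift ϖ)
    (he.siegelParRep_eq hχ₀) (he'.siegelParRep_eq hχ₀)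
    (fun v hv => hspan v (fixed_proIwahori_of_fixed hv)) hind

theorem nonempty_siegelParInd_equiv
    (hχ₀ : ∀ u, χ₀ (unitsRed F u) = μ₀ (unitsIncl F u)) {e : V}
    (he : IsTorusEigenvector σ e χ₁ χ₂)
    (hspan : ∀ v : V, (∀ k ∈ proIwahori F, σ k v = v) → ∃ z : ℂ, v = z • e) (hne : e ≠ 0) :
    Nonempty ((Representation.coind (siegelParMap ϖ) (siegelParRep ϖ σ μ₀)).Equiv
      (pairInd χ₀ χ₁ χ₂)) :=
  nonempty_equiv_of_eigenvector (exists_pairBorel ϖ) (exists_siegelPar_lift ϖ)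
    (he.siegelParRep_eq hχ₀) (fun v hv => hspan v (fixed_proIwahori_of_fixed hv)) hne

end SiegelParamodularEigenvectors

/-! ### Functions supported on a double coset -/

section SupportedFunctions

variable {G V : Type*} [Group G] [TopologicalSpace G] [ContinuousMul G] [AddCommGroup V]
  [Module ℂ V]

/-- An induced representation contains a function with prescribed value at a point that is
supported on a given double coset. -/
theorem exists_smoothIndV_supported (H K : Subgroup G) (hK : IsOpen (K : Set G))
    (τ : Representation ℂ H V) (x : G) (z : V)
    (h : ∀ b : H, x⁻¹ * b * x ∈ K → τ b z = z) :
    ∃ f : smoothIndV H τ, (∀ k ∈ K, ∀ g, f.1 (g * k) = f.1 g) ∧ f.1 x = z ∧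
      ∀ g, (∀ b : H, ∀ k ∈ K, g ≠ b * x * k) → f.1 g = 0 := by
  classical
  let P : G → Prop := fun g => ∃ b : H, ∃ k ∈ K, g = b * x * k
  let f : G → V := fun g => if hg : P g then τ hg.choose z else 0
  -- Independence of the chosen decomposition: two of them differ by an element of H ∩ xKx⁻¹, which
  -- fixes z by `h`.
  have hf : ∀ (b : H), ∀ k ∈ K, f (b * x * k) = τ b z := by
    intro b k hk
    have hg : P (b * x * k) := ⟨b, k, hk, rfl⟩
    obtain ⟨k', hk', e⟩ := hg.choose_spec
    simp only [f, dif_pos hg]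
    set b' := hg.choose
    have h1 : τ (b'⁻¹ * b) z = z := by
      refine h _ ?_
      have e1 : x⁻¹ * ((b'⁻¹ * b : H) : G) * x = k' * k⁻¹ := by
        rw [eq_mul_inv_iff_mul_eq]
        push_cast
        simp only [mul_assoc] at e ⊢
        rw [e]
        simp
      rw [e1]
      exact mul_mem hk' (inv_mem hk)
    rw [map_mul, Module.End.mul_apply] at h1
    rw [← h1, ← Module.End.mul_apply (τ b'), ← map_mul, mul_inv_cancel, map_one,
      Module.End.one_apply, h1]
  have hf0 : ∀ g, ¬ P g → f g = 0 := fun g hg => dif_neg hg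
  have hr : ∀ k ∈ K, ∀ g, f (g * k) = f g := by
    intro k hk g
    by_cases hg : P g
    · obtain ⟨b, k', hk', rfl⟩ := hg
      rw [mul_assoc, hf _ _ (mul_mem hk' hk), hf _ _ hk']
    · rw [hf0 _ hg, hf0]
      rintro ⟨b, k', hk', e⟩
      exact hg ⟨b, k' * k⁻¹, mul_mem hk' (inv_mem hk), by
        rw [← mul_assoc, ← e, mul_inv_cancel_right]⟩
  refine ⟨⟨f, fun b g => ?_, K, hK, hr⟩, hr, ?_, fun g hg => hf0 g ?_⟩
  · by_cases hg : P g
    · obtain ⟨b', k', hk', rfl⟩ := hg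
      have e : (b : G) * (b' * x * k') = ((b * b' : H) : G) * x * k' := by
        push_cast
        simp only [mul_assoc]
      rw [e, hf _ _ hk', hf _ _ hk', map_mul, Module.End.mul_apply]
    · rw [hf0 _ hg, hf0, map_zero]
      rintro ⟨b', k', hk', e⟩
      refine hg ⟨b⁻¹ * b', k', hk', ?_⟩
      push_cast
      rw [eq_inv_mul_iff_mul_eq.2 e]
      simp only [mul_assoc]
  · have := hf 1 1 (one_mem K)
    simpa using this
  · rintro ⟨b, k, hk, e⟩
    exact hg b k hk e

end SupportedFunctions

/-! ### Fixed functions in representations induced from the Borel of GL(2,F) -/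

section BorelInduction

variable {F : Type*} [Field F] [ValuativeRel F] [TopologicalSpace F]
  [IsNonarchimedeanLocalField F]

/-- Comparing the entries of the bottom row decides the double coset: the larger one clears the
other by an element of the pro-unipotent radical. The inequality is strict in the first case since a
lower unipotent needs an entry in the maximal ideal. -/
theorem exists_borel_proIwahori (g : GL2 F) :
    ∃ b : borel F, ∃ k ∈ proIwahori F, g = b * k ∨ g = b * weyl F * k := by
  rcases lt_or_ge (valuation F (g.1 1 0)) (valuation F (g.1 1 1)) with h | h
  · have h1 := ne_zero_of_valuation_lt h
    have hk := lowerUnip_mem_proIwahori (valuation_div_lt_one h)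
    refine ⟨⟨g * (lowerUnip (g.1 1 0 / g.1 1 1))⁻¹, ?_⟩, _, hk, Or.inl (by simp)⟩
    rw [mem_borel, Units.val_mul, GL2_inv_val, Matrix.mul_apply, Fin.sum_univ_two]
    simp
    field_simp
    ring
  · have h1 : g.1 1 0 ≠ 0 := by
      intro h0
      have h2 : g.1 1 1 = 0 := by simpa [h0] using h
      have h3 : g.1.det ≠ 0 := ((Matrix.isUnit_iff_isUnit_det _).1 g.isUnit).ne_zero
      rw [Matrix.det_fin_two, h0, h2] at h3
      simp at h3
    have hk := upperUnip_mem_proIwahori (valuation_div_le_one h)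
    refine ⟨⟨g * (weyl F * upperUnip (g.1 1 1 / g.1 1 0))⁻¹, ?_⟩, _, hk,
      Or.inr (by rw [mul_assoc, inv_mul_cancel_right])⟩
    rw [mem_borel, Units.val_mul, GL2_inv_val]
    simp [Matrix.mul_apply, Fin.sum_univ_two]
    field_simp
    ring

/-- The lower right entry of b w is zero. This separates the double cosets of 1 and w. -/
theorem borel_mul_weyl_not_mem (b : borel F) : (b : GL2 F) * weyl F ∉ proIwahori F := by
  rintro ⟨-, -, -, h⟩
  have e : ((b : GL2 F) * weyl F).1 1 1 = 0 := by
    have hb := mem_borel.1 b.2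
    simp [Matrix.mul_apply, Fin.sum_univ_two, hb]
  rw [e, red_zero] at h
  exact zero_ne_one h

theorem det_proIwahori {k : GL2 F} (hk : k ∈ proIwahori F) : ∃ u ∈ principalUnits F,
    Matrix.GeneralLinearGroup.det k = unitsIncl F u := by
  obtain ⟨u, hu⟩ := exists_unitsIncl_units (x := Matrix.GeneralLinearGroup.det k)
    (valuation_det_proIwahori hk)
  refine ⟨u, mem_principalUnits_iff.2 ?_, hu.symm⟩
  rw [hu]
  change red k.1.det = 1
  rw [red_det hk.1, hk.2.1, hk.2.2.1, hk.2.2.2]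
  simp

/-- A representation of the Borel subgroup is tame if elements with principal units on the diagonal
act trivially. -/
def IsTameBorel {V : Type*} [AddCommGroup V] [Module ℂ V] (τ : Representation ℂ (borel F) V) : Prop :=
  ∀ b : borel F, (∃ u ∈ principalUnits F, borelFst F b = unitsIncl F u) →
    (∃ u ∈ principalUnits F, borelSnd F b = unitsIncl F u) → τ b = 1

theorem exists_principalUnits {x : Fˣ} (hx : valuation F (x : F) ≤ 1) (h : red (x : F) = 1) :
    ∃ u ∈ principalUnits F, x = unitsIncl F u := by
  obtain ⟨u, hu⟩ := exists_unitsIncl_units (valuation_eq_one_of_red hx (by simp [h]))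
  exact ⟨u, mem_principalUnits_iff.2 (hu ▸ h), hu.symm⟩

variable {τ : Representation ℂ (borel F) ℂ}

theorem smoothIndV_borel (f : smoothIndV (borel F) τ) (b : borel F) (g : GL2 F) :
    f.1 (b * g) = f.1 g * τ b 1 := by
  rw [f.2.1, ← smul_eq_mul (f.1 g), ← map_smul, smul_eq_mul, mul_one]

/-- A function in an induced representation that is an eigenvector of the pro-unipotent radical of
the Iwahori subgroup is determined by its values at representatives of the double cosets. -/
theorem smoothIndV_eq_zero {f : smoothIndV (borel F) τ} (c : GL2 F → ℂ)
    (hf : ∀ k ∈ proIwahori F, ∀ g, f.1 (g * k) = c k * f.1 g) (h1 : f.1 1 = 0)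
    (hw : f.1 (weyl F) = 0) : f = 0 := by
  ext g
  obtain ⟨b, k, hk, rfl | rfl⟩ := exists_borel_proIwahori g
  · rw [hf k hk, ← mul_one (b : GL2 F), smoothIndV_borel, h1, zero_mul, mul_zero]
    rfl
  · rw [hf k hk, smoothIndV_borel, hw, zero_mul, mul_zero]
    rfl

theorem smoothIndV_ext {f f' : smoothIndV (borel F) τ}
    (hf : ∀ k ∈ proIwahori F, smoothInd (borel F) τ k f = f)
    (hf' : ∀ k ∈ proIwahori F, smoothInd (borel F) τ k f' = f') (h1 : f.1 1 = f'.1 1)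
    (hw : f.1 (weyl F) = f'.1 (weyl F)) : f = f' := by
  have e : ∀ (f : smoothIndV (borel F) τ) (k g : GL2 F), smoothInd (borel F) τ k f = f →
      f.1 (g * k) = f.1 g := fun f k g h => congrFun (congrArg Subtype.val h) g
  refine sub_eq_zero.1 (smoothIndV_eq_zero (fun _ => 1) (fun k hk g => ?_)
    (sub_eq_zero.2 h1) (sub_eq_zero.2 hw))
  change f.1 (g * k) - f'.1 (g * k) = 1 * (f.1 g - f'.1 g)
  rw [e f k g (hf k hk), e f' k g (hf' k hk), one_mul]

/-- Tameness is precisely what the prescribed value at 1 needs: upper triangular elements of the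
pro-unipotent radical have principal units on the diagonal. -/
theorem exists_smoothIndV_one (hτ : IsTameBorel τ) : ∃ f : smoothIndV (borel F) τ,
    (∀ k ∈ proIwahori F, smoothInd (borel F) τ k f = f) ∧ f.1 1 = 1 ∧ f.1 (weyl F) = 0 := by
  obtain ⟨f, h1, h2, h3⟩ := exists_smoothIndV_supported (borel F) (proIwahori F)
    isOpen_proIwahori τ 1 1 (by
      intro b hb
      rw [inv_one, one_mul, mul_one] at hb
      rw [hτ b (exists_principalUnits (hb.1 0 0) hb.2.1)
        (exists_principalUnits (hb.1 1 1) hb.2.2.2), Module.End.one_apply])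
  refine ⟨f, fun k hk => Subtype.ext (funext fun g => h1 k hk g), h2, h3 _ fun b k hk e => ?_⟩
  apply borel_mul_weyl_not_mem b⁻¹
  rw [e]
  simpa using hk

theorem exists_smoothIndV_weyl (hτ : IsTameBorel τ) : ∃ f : smoothIndV (borel F) τ,
    (∀ k ∈ proIwahori F, smoothInd (borel F) τ k f = f) ∧ f.1 1 = 0 ∧ f.1 (weyl F) = 1 := by
  obtain ⟨f, h1, h2, h3⟩ := exists_smoothIndV_supported (borel F) (proIwahori F)
    isOpen_proIwahori τ (weyl F) 1 (by
      intro b hb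
      -- Conjugation by w swaps the diagonal entries, so tameness again applies.
      have e : ((weyl F)⁻¹ * (b : GL2 F) * weyl F).1 0 0 = b.1.1 1 1 ∧
          ((weyl F)⁻¹ * (b : GL2 F) * weyl F).1 1 1 = b.1.1 0 0 := by
        rw [Units.val_mul, Units.val_mul, GL2_inv_val]
        simp [Matrix.mul_apply, Fin.sum_univ_two, Matrix.vecMul, dotProduct]
      have h00 := hb.1 0 0
      have h11 := hb.1 1 1
      have r00 := hb.2.1
      have r11 := hb.2.2.2
      rw [e.1] at h00 r00
      rw [e.2] at h11 r11
      rw [hτ b (exists_principalUnits h11 r11) (exists_principalUnits h00 r00),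
        Module.End.one_apply])
  refine ⟨f, fun k hk => Subtype.ext (funext fun g => h1 k hk g), h3 _ fun b k hk e => ?_, h2⟩
  apply borel_mul_weyl_not_mem b
  rw [eq_inv_of_mul_eq_one_left e.symm]
  exact inv_mem hk

/-- The integral torus normalizes the pro-unipotent radical, hence acts on its fixed vectors. -/
theorem smoothInd_diagGL_fixed {f : smoothIndV (borel F) τ}
    (hf : ∀ k ∈ proIwahori F, smoothInd (borel F) τ k f = f) (a b : 𝒪[F]ˣ) :
    ∀ k ∈ proIwahori F, smoothInd (borel F) τ k
      (smoothInd (borel F) τ (diagGL (unitsIncl F a) (unitsIncl F b)) f) =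
        smoothInd (borel F) τ (diagGL (unitsIncl F a) (unitsIncl F b)) f := by
  intro k hk
  have h := hf _ (diagGL_conj_mem_proIwahori a⁻¹ b⁻¹ hk)
  rw [map_inv, map_inv, ← diagGL_inv, inv_inv] at h
  rw [← Module.End.mul_apply, ← map_mul]
  nth_rewrite 2 [← h]
  rw [← Module.End.mul_apply, ← map_mul]
  congr 2
  group

theorem smoothIndV_diagGL_one (f : smoothIndV (borel F) τ) (a b : Fˣ) :
    (smoothInd (borel F) τ (diagGL a b) f).1 1 = f.1 1 * τ ⟨diagGL a b, diagGL_mem a b⟩ 1 := by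
  rw [← smoothIndV_borel]
  change f.1 (1 * diagGL a b) = f.1 (diagGL a b * 1)
  rw [one_mul, mul_one]

/-- Passing a diagonal matrix through w exchanges its entries, which is the source of the swapped
characters of the second eigenvector. -/
theorem smoothIndV_diagGL_weyl (f : smoothIndV (borel F) τ) (a b : Fˣ) :
    (smoothInd (borel F) τ (diagGL a b) f).1 (weyl F) =
      f.1 (weyl F) * τ ⟨diagGL b a, diagGL_mem b a⟩ 1 := by
  rw [← smoothIndV_borel]
  change f.1 (weyl F * diagGL a b) = f.1 (diagGL b a * weyl F)
  rw [weyl_mul_diagGL]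

end BorelInduction

/-! ### Transport of fixed vectors and eigenvectors along equivalences -/

section Transport

variable {F : Type*} [Field F] [ValuativeRel F] [TopologicalSpace F]
  [IsNonarchimedeanLocalField F] {V W : Type*} [AddCommGroup V] [Module ℂ V]
  [AddCommGroup W] [Module ℂ W] {σ : Representation ℂ (GL2 F) V} {σ' : Representation ℂ (GL2 F) W}

theorem equiv_fixed (E : σ.Equiv σ') {v : V} (h : ∀ k ∈ proIwahori F, σ k v = v) :
    ∀ k ∈ proIwahori F, σ' k (E v) = E v := by
  intro k hk
  have h1 := E.toIntertwiningMap.isIntertwining _ _ k v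
  rw [h k hk] at h1
  exact h1.symm

theorem IsTorusEigenvector.map (E : σ.Equiv σ') {e : V} {χ₁ χ₂ : 𝓀[F]ˣ →* ℂˣ}
    (he : IsTorusEigenvector σ e χ₁ χ₂) : IsTorusEigenvector σ' (E e) χ₁ χ₂ where
  fixed := equiv_fixed E he.fixed
  torus a b := by
    have h1 := E.toIntertwiningMap.isIntertwining _ _ (diagGL (unitsIncl F a) (unitsIncl F b)) e
    rw [he.torus, map_smul] at h1
    exact h1.symm

end Transport

/-! ### Fixed vectors of principal series and one-dimensional representations -/

section FixedVectors

variable {F : Type*} [Field F] [ValuativeRel F] [TopologicalSpace F]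
  [IsNonarchimedeanLocalField F] {τ : Representation ℂ (borel F) ℂ} {μ μ₁ μ₂ : Fˣ →* ℂˣ}
  {χ χ₁ χ₂ : 𝓀[F]ˣ →* ℂˣ}

theorem diagGL_mem_proIwahori_left {u : 𝒪[F]ˣ} (hu : u ∈ principalUnits F) :
    diagGL (unitsIncl F u) 1 ∈ proIwahori F := by
  have h := diagGL_mem_proIwahori hu (one_mem (principalUnits F))
  rwa [map_one] at h

/-- A fixed function is determined by its values at 1 and w, so the eigenvector property of the
functions supported on either double coset is checked at these two points. -/
theorem exists_torusEigenvectors (hτ : IsTameBorel τ)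
    (h : ∀ a b : 𝒪[F]ˣ, τ ⟨diagGL (unitsIncl F a) (unitsIncl F b), diagGL_mem _ _⟩ 1 =
      χ₁ (unitsRed F a) * χ₂ (unitsRed F b)) :
    ∃ e e' : smoothIndV (borel F) τ, IsTorusEigenvector (smoothInd (borel F) τ) e χ₁ χ₂ ∧
      IsTorusEigenvector (smoothInd (borel F) τ) e' χ₂ χ₁ ∧
      (e.1 1 = 1 ∧ e.1 (weyl F) = 0) ∧ (e'.1 1 = 0 ∧ e'.1 (weyl F) = 1) := by
  obtain ⟨e, he, h1, hw⟩ := exists_smoothIndV_one hτ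
  obtain ⟨e', he', h1', hw'⟩ := exists_smoothIndV_weyl hτ
  have hsmul : ∀ (c : ℂ) (f : smoothIndV (borel F) τ), (∀ k ∈ proIwahori F,
      smoothInd (borel F) τ k f = f) → ∀ k ∈ proIwahori F,
      smoothInd (borel F) τ k (c • f) = c • f := fun c f hf k hk => by rw [map_smul, hf k hk]
  refine ⟨e, e', ⟨he, fun a b => ?_⟩, ⟨he', fun a b => ?_⟩, ⟨h1, hw⟩, ⟨h1', hw'⟩⟩
  · refine smoothIndV_ext (smoothInd_diagGL_fixed he a b) (hsmul _ _ he) ?_ ?_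
    · rw [smoothIndV_diagGL_one, h, mul_comm]
      rfl
    · rw [smoothIndV_diagGL_weyl, hw, zero_mul]
      change 0 = _ * e.1 (weyl F)
      rw [hw, mul_zero]
  · refine smoothIndV_ext (smoothInd_diagGL_fixed he' a b) (hsmul _ _ he') ?_ ?_
    · rw [smoothIndV_diagGL_one, h1', zero_mul]
      change 0 = _ * e'.1 1
      rw [h1', mul_zero]
    · rw [smoothIndV_diagGL_weyl, h, mul_comm (χ₁ _ : ℂ), mul_comm]
      rfl

variable (μ₁ μ₂) in
/-- The representation of the Borel subgroup from which a principal series is induced. -/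
abbrev principalSeriesRep : Representation ℂ (borel F) ℂ :=
  charRep ((nuPow F (1 / 2)).comp (borelFst F / borelSnd F) *
    (μ₁.comp (borelFst F) * μ₂.comp (borelSnd F)))

theorem principalSeriesRep_one {b : borel F} {u w : 𝒪[F]ˣ} (hu : borelFst F b = unitsIncl F u)
    (hw : borelSnd F b = unitsIncl F w) :
    principalSeriesRep μ₁ μ₂ b 1 = μ₁ (unitsIncl F u) * μ₂ (unitsIncl F w) := by
  have h1 : nuPow F (1 / 2) (unitsIncl F u / unitsIncl F w) = 1 := by
    rw [← map_div]
    exact nuPow_eq_one _ (valuation_unitsIncl _)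
  rw [charRep_apply, mul_one]
  simp only [MonoidHom.mul_apply, MonoidHom.comp_apply, MonoidHom.div_apply, hu, hw, h1, one_mul,
    Units.val_mul]

theorem isTameBorel_principalSeriesRep (h₁ : IsTame μ₁) (h₂ : IsTame μ₂) :
    IsTameBorel (principalSeriesRep μ₁ μ₂) := by
  rintro b ⟨u, hu, hb⟩ ⟨w, hw, hb'⟩
  ext
  rw [principalSeriesRep_one hb hb', h₁ u hu, h₂ w hw]
  simp

theorem borelFst_diagGL {K : Type*} [Field K] (a b : Kˣ) :
    borelFst K ⟨diagGL a b, diagGL_mem a b⟩ = a ∧ borelSnd K ⟨diagGL a b, diagGL_mem a b⟩ = b :=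
  borelFst_eq (x := 0) (by rw [upperUnip_zero, mul_one])

/-- Evaluations at 1 and w are coordinates on the fixed vectors, dual to the two eigenvectors. -/
theorem exists_principalSeries_eigenvectors
    (hχ₁ : ∀ u, χ₁ (unitsRed F u) = μ₁ (unitsIncl F u))
    (hχ₂ : ∀ u, χ₂ (unitsRed F u) = μ₂ (unitsIncl F u)) (h₁ : IsTame μ₁) (h₂ : IsTame μ₂) :
    ∃ e e', IsTorusEigenvector (principalSeries μ₁ μ₂) e χ₁ χ₂ ∧
      IsTorusEigenvector (principalSeries μ₁ μ₂) e' χ₂ χ₁ ∧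
      (∀ v, (∀ k ∈ proIwahori F, principalSeries μ₁ μ₂ k v = v) →
        ∃ z z' : ℂ, v = z • e + z' • e') ∧
      (∀ z z' : ℂ, z • e + z' • e' = 0 → z = 0 ∧ z' = 0) := by
  obtain ⟨e, e', he, he', ⟨h1, hw⟩, ⟨h1', hw'⟩⟩ :=
    exists_torusEigenvectors (isTameBorel_principalSeriesRep h₁ h₂) (χ₁ := χ₁) (χ₂ := χ₂) (by
      intro a b
      rw [principalSeriesRep_one (borelFst_diagGL _ _).1 (borelFst_diagGL _ _).2, hχ₁, hχ₂])
  have hval1 : ∀ z z' : ℂ, (z • e + z' • e').1 1 = z := by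
    intro z z'
    change z * e.1 1 + z' * e'.1 1 = z
    rw [h1, h1', mul_one, mul_zero, add_zero]
  have hvalw : ∀ z z' : ℂ, (z • e + z' • e').1 (weyl F) = z' := by
    intro z z'
    change z * e.1 (weyl F) + z' * e'.1 (weyl F) = z'
    rw [hw, hw', mul_one, mul_zero, zero_add]
  refine ⟨e, e', he, he', fun v hv => ⟨v.1 1, v.1 (weyl F), ?_⟩, fun z z' h => ?_⟩
  · refine smoothIndV_ext hv (fun k hk => ?_) (hval1 _ _).symm (hvalw _ _).symm
    rw [map_add, map_smul, map_smul, he.fixed k hk, he'.fixed k hk]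
  · constructor
    · rw [← hval1 z z', h]
      rfl
    · rw [← hvalw z z', h]
      rfl

/-- A torus element with principal unit entries fixes v but scales its values at 1 and w by μ₁ and
μ₂, in opposite order. Hence one nontrivial character suffices to kill both values. -/
theorem principalSeries_eq_zero_of_fixed (h : ¬ (IsTame μ₁ ∧ IsTame μ₂))
    (v : smoothIndV (borel F) (principalSeriesRep μ₁ μ₂))
    (hv : ∀ k ∈ proIwahori F, principalSeries μ₁ μ₂ k v = v) : v = 0 := by
  have key : ∀ u w : 𝒪[F]ˣ, u ∈ principalUnits F → w ∈ principalUnits F →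
      v.1 1 * (μ₁ (unitsIncl F u) * μ₂ (unitsIncl F w)) = v.1 1 ∧
      v.1 (weyl F) * (μ₁ (unitsIncl F w) * μ₂ (unitsIncl F u)) = v.1 (weyl F) := by
    intro u w hu hw
    have h1 := hv _ (diagGL_mem_proIwahori hu hw)
    have h2 := smoothIndV_diagGL_one v (unitsIncl F u) (unitsIncl F w)
    have h3 := smoothIndV_diagGL_weyl v (unitsIncl F u) (unitsIncl F w)
    rw [h1, principalSeriesRep_one (borelFst_diagGL _ _).1 (borelFst_diagGL _ _).2] at h2 h3
    exact ⟨h2.symm, h3.symm⟩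
  have hz : ∀ {z : ℂ} {c : ℂˣ}, c ≠ 1 → z * c = z → z = 0 := by
    intro z c hc hz
    by_contra h0
    exact hc (Units.ext (mul_left_cancel₀ h0 (hz.trans (mul_one z).symm)))
  have hval : ∀ k ∈ proIwahori F, ∀ g, v.1 (g * k) = 1 * v.1 g := fun k hk g => by
    rw [one_mul]
    exact congrFun (congrArg Subtype.val (hv k hk)) g
  rw [not_and_or] at h
  rcases h with h | h <;> simp only [IsTame, not_forall] at h <;> obtain ⟨u, hu, hne⟩ := h
  · refine smoothIndV_eq_zero _ hval (hz hne ?_) (hz hne ?_)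
    · simpa using (key u 1 hu (one_mem _)).1
    · simpa using (key 1 u (one_mem _) hu).2
  · refine smoothIndV_eq_zero _ hval (hz hne ?_) (hz hne ?_)
    · simpa using (key 1 u (one_mem _) hu).1
    · simpa using (key u 1 hu (one_mem _)).2

theorem detRep_apply (g : GL2 F) (z : ℂ) :
    detRep μ g z = μ (Matrix.GeneralLinearGroup.det g) * z := rfl

theorem IsTame.det_proIwahori (h : IsTame μ) {k : GL2 F} (hk : k ∈ proIwahori F) :
    μ (Matrix.GeneralLinearGroup.det k) = 1 := by
  obtain ⟨u, hu, e⟩ := ParahoricRes.det_proIwahori hk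
  rw [e, h u hu]

theorem detRep_eigenvector (hχ : ∀ u, χ (unitsRed F u) = μ (unitsIncl F u)) (h : IsTame μ) :
    IsTorusEigenvector (detRep μ) 1 χ χ where
  fixed k hk := by rw [detRep_apply, h.det_proIwahori hk, Units.val_one, one_mul]
  torus a b := by
    rw [detRep_apply, det_diagGL, map_mul, hχ, hχ, Units.val_mul]
    rfl

theorem detRep_eq_zero_of_fixed (h : ¬ IsTame μ) (v : ℂ)
    (hv : ∀ k ∈ proIwahori F, detRep μ k v = v) : v = 0 := by
  simp only [IsTame, not_forall] at h
  obtain ⟨u, hu, hne⟩ := h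
  have h1 := hv _ (diagGL_mem_proIwahori_left hu)
  rw [detRep_apply, det_diagGL, mul_one] at h1
  by_contra h0
  exact hne (Units.ext (mul_right_cancel₀ h0 (h1.trans (one_mul v).symm)))

/-! ### Fixed vectors of twisted Steinberg representations -/

theorem borelFunction_borel (f : smoothIndV (borel F) (Representation.trivial ℂ (borel F) ℂ))
    {b : GL2 F} (hb : b ∈ borel F) (g : GL2 F) : f.1 (b * g) = f.1 g :=
  f.2.1 ⟨b, hb⟩ g

theorem twistedSteinberg_mk (g : GL2 F)
    (f : smoothIndV (borel F) (Representation.trivial ℂ (borel F) ℂ)) :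
    twistedSteinberg μ g ((constFunctions F).mkQ f) = (constFunctions F).mkQ
      ((μ (Matrix.GeneralLinearGroup.det g) : ℂ) • borelFunctions F g f) := rfl

theorem weyl_mul_lowerUnip {K : Type*} [Field K] (x : K) :
    weyl K * lowerUnip x = upperUnip (-x) * weyl K := by
  apply GL2_ext <;> simp

theorem det_lowerUnip {K : Type*} [Field K] (x : K) :
    Matrix.GeneralLinearGroup.det (lowerUnip x) = 1 := by
  ext
  simp

/-- A vector of a twisted Steinberg representation that is fixed by the pro-unipotent radical of
the Iwahori subgroup is represented by an eigenfunction that vanishes at one. -/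
theorem exists_lift_of_twistedSteinberg_fixed
    (v : smoothIndV (borel F) (Representation.trivial ℂ (borel F) ℂ) ⧸ constFunctions F)
    (hv : ∀ k ∈ proIwahori F, twistedSteinberg μ k v = v) :
    ∃ f, (constFunctions F).mkQ f = v ∧ f.1 1 = 0 ∧ ∀ k ∈ proIwahori F, ∀ g,
      (μ (Matrix.GeneralLinearGroup.det k) : ℂ) * f.1 (g * k) = f.1 g := by
  obtain ⟨f₀, rfl⟩ := (constFunctions F).mkQ_surjective v
  -- Subtracting the constant value at 1 normalizes the lift.
  let c : smoothIndV (borel F) (Representation.trivial ℂ (borel F) ℂ) :=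
    ⟨fun _ => f₀.1 1, fun b g => rfl, ⊤, isOpen_univ, fun u hu g => rfl⟩
  have hc : (constFunctions F).mkQ c = 0 :=
    (Submodule.Quotient.mk_eq_zero _).2 ⟨f₀.1 1, fun g => rfl⟩
  obtain ⟨f, hf⟩ : ∃ f, f = f₀ - c := ⟨_, rfl⟩
  have hmk : (constFunctions F).mkQ f = (constFunctions F).mkQ f₀ := by
    rw [hf, map_sub, hc, sub_zero]
  have h1 : f.1 1 = 0 := by
    rw [hf]
    exact sub_self _
  -- A priori the lift is an eigenfunction only up to a constant depending on k; evaluation at g = 1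
  -- identifies that constant.
  have hconst : ∀ k ∈ proIwahori F, ∀ g, (μ (Matrix.GeneralLinearGroup.det k) : ℂ) * f.1 (g * k) =
      f.1 g + (μ (Matrix.GeneralLinearGroup.det k) : ℂ) * f.1 k := by
    intro k hk g
    have h := hv k hk
    rw [← hmk, twistedSteinberg_mk, ← sub_eq_zero, ← map_sub] at h
    obtain ⟨z, hz⟩ := (Submodule.Quotient.mk_eq_zero _).1 h
    have hz' : ∀ g, (μ (Matrix.GeneralLinearGroup.det k) : ℂ) * f.1 (g * k) - f.1 g = z := hz
    have hz1 := hz' 1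
    rw [one_mul, h1, sub_zero] at hz1
    rw [hz1, ← hz' g]
    ring
  -- At g = w a lower unipotent crosses w to become an upper one on the left, where it acts
  -- trivially; the constant is therefore zero.
  have hlow : ∀ x : F, valuation F x < 1 → f.1 (lowerUnip x) = 0 := by
    intro x hx
    have h := hconst _ (lowerUnip_mem_proIwahori hx) (weyl F)
    rw [weyl_mul_lowerUnip, borelFunction_borel f (upperUnip_mem _), det_lowerUnip, map_one,
      Units.val_one, one_mul, one_mul] at h
    exact left_eq_add.1 h
  refine ⟨f, hmk, h1, fun k hk g => ?_⟩
  have hk0 : f.1 k = 0 := by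
    obtain ⟨hk0, -, hk1, hk2⟩ := hk
    have hlt : valuation F (k.1 1 0) < valuation F (k.1 1 1) := by
      rw [valuation_eq_one_of_red (hk0 1 1) (by rw [hk2]; exact one_ne_zero)]
      exact (red_eq_zero_iff (hk0 1 0)).1 hk1
    have h0 := ne_zero_of_valuation_lt hlt
    -- Up to the Borel on the left, k is a lower unipotent of the kind just treated.
    have hb : k * (lowerUnip (k.1 1 0 / k.1 1 1))⁻¹ ∈ borel F := by
      rw [mem_borel, Units.val_mul, GL2_inv_val, Matrix.mul_apply, Fin.sum_univ_two]
      simp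
      field_simp
      ring
    have h := borelFunction_borel f hb (lowerUnip (k.1 1 0 / k.1 1 1))
    rwa [inv_mul_cancel_right, hlow _ (valuation_div_lt_one hlt)] at h
  rw [hconst k hk g, hk0, mul_zero, add_zero]

theorem eq_zero_of_weyl {f : smoothIndV (borel F) (Representation.trivial ℂ (borel F) ℂ)}
    (h1 : f.1 1 = 0) (hf : ∀ k ∈ proIwahori F, ∀ g,
      (μ (Matrix.GeneralLinearGroup.det k) : ℂ) * f.1 (g * k) = f.1 g)
    (h : f.1 (weyl F) = 0) : f = 0 := by
  refine smoothIndV_eq_zero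
    (fun k => ((μ (Matrix.GeneralLinearGroup.det k))⁻¹ : ℂˣ)) (fun k hk g => ?_) h1 h
  rw [← hf k hk g, ← mul_assoc, ← Units.val_mul, inv_mul_cancel, Units.val_one, one_mul]

/-- Testing the normalized lift at w with diag(u, 1) gives μ(u) f(w) = f(w), so f vanishes at w as
well as at 1. -/
theorem twistedSteinberg_eq_zero_of_fixed (h : ¬ IsTame μ)
    (v : smoothIndV (borel F) (Representation.trivial ℂ (borel F) ℂ) ⧸ constFunctions F)
    (hv : ∀ k ∈ proIwahori F, twistedSteinberg μ k v = v) : v = 0 := by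
  obtain ⟨f, rfl, h1, hf⟩ := exists_lift_of_twistedSteinberg_fixed v hv
  simp only [IsTame, not_forall] at h
  obtain ⟨u, hu, hne⟩ := h
  have hw := hf _ (diagGL_mem_proIwahori_left hu) (weyl F)
  rw [weyl_mul_diagGL, borelFunction_borel f (diagGL_mem _ _), det_diagGL, mul_one] at hw
  rw [eq_zero_of_weyl h1 hf, map_zero]
  by_contra h0
  exact hne (Units.ext (mul_right_cancel₀ h0 (hw.trans (one_mul _).symm)))

/-- The eigenvector is the class of the fixed function with value 0 at 1 and 1 at w. It is not
constant, and every normalized lift of a fixed vector is a multiple of it. -/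
theorem exists_twistedSteinberg_eigenvector
    (hχ : ∀ u, χ (unitsRed F u) = μ (unitsIncl F u)) (h : IsTame μ) :
    ∃ e, IsTorusEigenvector (twistedSteinberg μ) e χ χ ∧
      (∀ v, (∀ k ∈ proIwahori F, twistedSteinberg μ k v = v) → ∃ z : ℂ, v = z • e) ∧ e ≠ 0 := by
  obtain ⟨-, f, -, hf, -, ⟨h1, hw⟩⟩ :=
    exists_torusEigenvectors (F := F) (τ := Representation.trivial ℂ (borel F) ℂ) (χ₁ := 1)
      (χ₂ := 1) (fun _ _ _ => rfl) (fun _ _ => by simp)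
  refine ⟨(constFunctions F).mkQ f, ⟨fun k hk => ?_, fun a b => ?_⟩, fun v hv => ?_, fun h0 => ?_⟩
  · rw [twistedSteinberg_mk, h.det_proIwahori hk, Units.val_one, one_smul, hf.fixed k hk]
  · rw [twistedSteinberg_mk, hf.torus, det_diagGL, map_mul, hχ, hχ, Units.val_mul, ← map_smul]
    simp
  · obtain ⟨f', rfl, h1', hf'⟩ := exists_lift_of_twistedSteinberg_fixed v hv
    refine ⟨f'.1 (weyl F), ?_⟩
    rw [← map_smul]
    congr 1
    refine smoothIndV_ext (fun k hk => Subtype.ext (funext fun g => ?_)) (fun k hk => ?_) ?_ ?_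
    · have h2 := hf' k hk g
      rw [h.det_proIwahori hk, Units.val_one, one_mul] at h2
      exact h2
    · rw [map_smul, hf.fixed k hk]
    · change f'.1 1 = f'.1 (weyl F) * f.1 1
      rw [h1, h1', mul_zero]
    · change f'.1 (weyl F) = f'.1 (weyl F) * f.1 (weyl F)
      rw [hw, mul_one]
  · obtain ⟨z, hz⟩ := (Submodule.Quotient.mk_eq_zero _).1 h0
    have h2 := hz 1
    rw [← hz (weyl F), h1, hw] at h2
    exact zero_ne_one h2

end FixedVectors

/-! ### Invariants and coinvariants by averaging -/

section FixedCoinvariants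

variable {A V : Type*} [CommGroup A] [AddCommGroup V] [Module ℂ V]

/-- If every vector has a stabilizer of finite index, then nonzero invariant vectors are not killed
by passing to coinvariants. -/
theorem eq_zero_of_mem_coinvariants_ker (ρ : Representation ℂ A V)
    (h : ∀ w, ∃ D : Subgroup A, D.FiniteIndex ∧ ∀ d ∈ D, ρ d w = w) {v : V}
    (hv : v ∈ Representation.Coinvariants.ker ρ) (hfix : ∀ a, ρ a v = v) : v = 0 := by
  -- Summing over representatives of A/D' kills the kernel of coinvariants. Allowing every D' below
  -- D lets the subgroups for different summands be intersected.
  have key : ∃ D : Subgroup A, D.FiniteIndex ∧ ∀ D' ≤ D, ∀ _ : Fintype (A ⧸ D'),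
      ∑ x : A ⧸ D', ρ x.out v = 0 := by
    clear hfix
    rw [Representation.Coinvariants.ker] at hv
    induction hv using Submodule.span_induction with
    | mem v hv =>
      obtain ⟨⟨g, w⟩, rfl⟩ := hv
      obtain ⟨D, hD, hw⟩ := h w
      refine ⟨D, hD, fun D' hD' _ => ?_⟩
      -- Since D' fixes w, translation by g only permutes the summands.
      have e : ∀ x : A ⧸ D', ρ x.out (ρ g w) = ρ (x * (g : A ⧸ D')).out w := by
        intro x
        have h1 : (x * (g : A ⧸ D')).out⁻¹ * (x.out * g) ∈ D' := by
          rw [← QuotientGroup.eq]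
          simp
        have h2 := hw _ (hD' h1)
        rw [map_mul, Module.End.mul_apply] at h2
        rw [← Module.End.mul_apply, ← map_mul]
        nth_rewrite 2 [← h2]
        rw [← Module.End.mul_apply, ← map_mul, mul_inv_cancel, map_one, Module.End.one_apply]
      simp only [map_sub, Finset.sum_sub_distrib, e]
      rw [sub_eq_zero]
      exact Equiv.sum_comp (Equiv.mulRight (g : A ⧸ D')) fun x => ρ x.out w
    | zero => exact ⟨⊤, inferInstance, fun D' _ _ => by simp⟩
    | add v w _ _ hv hw =>
      obtain ⟨D, hD, hv⟩ := hv
      obtain ⟨E, hE, hw⟩ := hw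
      refine ⟨D ⊓ E, inferInstance, fun D' hD' _ => ?_⟩
      simp only [map_add, Finset.sum_add_distrib]
      rw [hv D' (hD'.trans inf_le_left), hw D' (hD'.trans inf_le_right), add_zero]
    | smul c v _ hv =>
      obtain ⟨D, hD, hv⟩ := hv
      refine ⟨D, hD, fun D' hD' _ => ?_⟩
      simp only [map_smul]
      rw [← Finset.smul_sum, hv D' hD', smul_zero]
  -- On an invariant vector the sum is the index of D times the vector.
  obtain ⟨D, hD, hsum⟩ := key
  have : Fintype (A ⧸ D) := Fintype.ofFinite _
  have hD' := hsum D le_rfl this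
  simp only [hfix, Finset.sum_const, ← Nat.cast_smul_eq_nsmul ℂ] at hD'
  refine (smul_eq_zero.1 hD').resolve_left ?_
  exact Nat.cast_ne_zero.2 (Finset.card_ne_zero.2 Finset.univ_nonempty)

end FixedCoinvariants

/-! ### The Jacquet module along compact unipotent subgroups -/

section Cuspidal

variable {F : Type*} [Field F] [ValuativeRel F] [TopologicalSpace F]
  [IsNonarchimedeanLocalField F] {V : Type*} [AddCommGroup V] [Module ℂ V]
  {σ : Representation ℂ (GL2 F) V}

/-- The homomorphism `x ↦ (1, c * x; 0, 1)` on the ring of integers. -/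
def scaledUnip (c : F) : Multiplicative 𝒪[F] →* GL2 F where
  toFun x := upperUnip (c * (x.toAdd : F))
  map_one' := by simp [upperUnip_zero]
  map_mul' x y := by
    rw [← upperUnip_add, ← mul_add]
    rfl

theorem continuous_upperUnip : Continuous (upperUnip : F → GL2 F) := by
  rw [Units.continuous_iff]
  constructor
  · refine continuous_matrix fun i j => ?_
    fin_cases i <;> fin_cases j <;> simp <;> fun_prop
  · refine continuous_matrix fun i j => ?_
    simp only [GL2_inv_val]
    fin_cases i <;> fin_cases j <;> simp <;> fun_prop

theorem continuous_scaledUnip (c : F) : Continuous (scaledUnip c) :=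
  continuous_upperUnip.comp (continuous_const.mul (continuous_subtype_val.comp continuous_toAdd))

/-- The stabilizer of a vector pulls back to an open subgroup of the compact group 𝒪, so its index
is finite. -/
theorem scaledUnip_stabilizer (hσ : IsSmooth σ) (c : F) (w : V) :
    ∃ D : Subgroup (Multiplicative 𝒪[F]), D.FiniteIndex ∧
      ∀ d ∈ D, (σ.comp (scaledUnip c)) d w = w := by
  obtain ⟨U, hU, hw⟩ := hσ w
  have hopen : IsOpen (U.comap (scaledUnip c) : Set (Multiplicative 𝒪[F])) :=
    hU.preimage (continuous_scaledUnip c)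
  have := Subgroup.quotient_finite_of_isOpen _ hopen
  exact ⟨U.comap (scaledUnip c), Subgroup.finiteIndex_of_finite_quotient, fun d hd => hw _ hd⟩

theorem coinvariants_ker_scaledUnip_le (c : F) (y : 𝒪[F]) :
    Representation.Coinvariants.ker (σ.comp (scaledUnip (c * y))) ≤
      Representation.Coinvariants.ker (σ.comp (scaledUnip c)) := by
  refine Submodule.span_le.2 ?_
  rintro _ ⟨⟨x, w⟩, rfl⟩
  refine Representation.Coinvariants.mem_ker_of_eq (Multiplicative.ofAdd (y * x.toAdd)) w _ ?_
  have e : scaledUnip c (Multiplicative.ofAdd (y * x.toAdd)) = scaledUnip (c * y) x := by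
    change upperUnip (c * ((y * x.toAdd : 𝒪[F]) : F)) = upperUnip (c * y * (x.toAdd : F))
    push_cast
    rw [mul_assoc]
  change σ (scaledUnip c _) w - w = σ (scaledUnip (c * y) x) w - w
  rw [e]

/-- A uniformizer, as an element of the multiplicative group of the field. -/
def Uniformizer.unit (ϖ : Uniformizer F) : Fˣ := Units.mk0 (ϖ.1 : F) (coe_ne_zero ϖ)

theorem exists_mul_pow_mem (ϖ : Uniformizer F) (x : F) :
    ∃ (m : ℕ) (y : 𝒪[F]), x = (ϖ.1 : F)⁻¹ ^ m * y := by
  have h0 := coe_ne_zero ϖ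
  rcases le_total (valuation F x) 1 with h | h
  · exact ⟨0, ⟨x, h⟩, by simp⟩
  · have hx : x ≠ 0 := by
      rintro rfl
      simp at h
    have hx' : valuation F x⁻¹ ≤ 1 := by
      rw [map_inv₀]
      exact inv_le_one_of_one_le₀ h
    obtain ⟨m, u, hu⟩ := IsDiscreteValuationRing.eq_unit_mul_pow_irreducible
      (x := (⟨x⁻¹, hx'⟩ : 𝒪[F])) (fun h' => inv_ne_zero hx (congrArg Subtype.val h')) ϖ.2
    have hu' : x⁻¹ = (unitsIncl F u : F) * (ϖ.1 : F) ^ m := by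
      have := congrArg Subtype.val hu
      push_cast at this
      exact this
    refine ⟨m, (u⁻¹ : 𝒪[F]ˣ), ?_⟩
    have e : (((u⁻¹ : 𝒪[F]ˣ) : 𝒪[F]) : F) = (unitsIncl F u : F)⁻¹ := by
      rw [← Units.val_inv_eq_inv_val, ← map_inv]
      rfl
    rw [e, inv_pow, ← mul_inv_rev, ← hu', inv_inv]

/-- An element of the Jacquet kernel involves finitely many unipotents, and the unipotent radical is
the increasing union of the subgroups with entry in ϖ⁻ᵐ𝒪. -/
theorem IsCuspidal.mem_coinvariants_ker (ϖ : Uniformizer F) (h : IsCuspidal σ) (v : V) :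
    ∃ m : ℕ, v ∈ Representation.Coinvariants.ker (σ.comp (scaledUnip ((ϖ.1 : F)⁻¹ ^ m))) := by
  have hv : v ∈ Representation.Coinvariants.ker
      (σ.comp ((borel F).subtype.comp (borelUnipotent F).subtype)) :=
    (Representation.Coinvariants.mk_eq_zero _).1 (@Subsingleton.elim _ h _ _)
  have hmono : ∀ m n : ℕ, Representation.Coinvariants.ker
      (σ.comp (scaledUnip ((ϖ.1 : F)⁻¹ ^ m))) ≤
      Representation.Coinvariants.ker (σ.comp (scaledUnip ((ϖ.1 : F)⁻¹ ^ (m + n)))) := by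
    intro m n
    convert coinvariants_ker_scaledUnip_le (σ := σ) ((ϖ.1 : F)⁻¹ ^ (m + n)) (ϖ.1 ^ n) using 5
    rw [pow_add, mul_assoc]
    push_cast
    rw [← mul_pow, inv_mul_cancel₀ (coe_ne_zero ϖ), one_pow, mul_one]
  rw [Representation.Coinvariants.ker] at hv
  induction hv using Submodule.span_induction with
  | mem v hv =>
    obtain ⟨⟨⟨b, hb1, hb2⟩, w⟩, rfl⟩ := hv
    have hb : (b : GL2 F) = upperUnip (b.1.1 0 1 * (b.1.1 0 0)⁻¹) := by
      conv_lhs => rw [borel_decomp b, (MonoidHom.mem_ker).1 hb1, (MonoidHom.mem_ker).1 hb2,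
        diagGL_one, one_mul]
    obtain ⟨m, y, hy⟩ := exists_mul_pow_mem ϖ (b.1.1 0 1 * (b.1.1 0 0)⁻¹)
    refine ⟨m, Representation.Coinvariants.mem_ker_of_eq (Multiplicative.ofAdd y) w _ ?_⟩
    change σ (upperUnip ((ϖ.1 : F)⁻¹ ^ m * (y : F))) w - w = σ (b : GL2 F) w - w
    rw [← hy, ← hb]
  | zero => exact ⟨0, zero_mem _⟩
  | add v w _ _ hv hw =>
    obtain ⟨m, hm⟩ := hv
    obtain ⟨n, hn⟩ := hw
    exact ⟨m + n, add_mem (hmono m n hm) (add_comm n m ▸ hmono n m hn)⟩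
  | smul c v _ hv =>
    obtain ⟨m, hm⟩ := hv
    exact ⟨m, Submodule.smul_mem _ c hm⟩

/-- A section of the residue map. -/
def residueLift (c : 𝓀[F]) : 𝒪[F] :=
  Function.surjInv (IsLocalRing.residue_surjective (R := 𝒪[F])) c

theorem red_residueLift (c : 𝓀[F]) : red (residueLift c : F) = c := by
  rw [red_coe]
  exact Function.surjInv_eq _ c

/-- The difference y - x passes through w as a lower unipotent with entry in the maximal ideal,
which fixes u. -/
theorem upperUnip_weyl_congr {u : V} (hu : ∀ k ∈ proIwahori F, σ k u = u) {x y : F}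
    (hx : valuation F x ≤ 1) (hy : valuation F y ≤ 1) (h : red x = red y) :
    σ (upperUnip x * weyl F) u = σ (upperUnip y * weyl F) u := by
  have hlt : valuation F (y - x) < 1 := by
    rw [← red_eq_zero_iff (val_sub_le hy hx), red_sub hy hx, h, sub_self]
  have e : upperUnip x * weyl F = upperUnip y * weyl F * lowerUnip (y - x) := by
    rw [mul_assoc, weyl_mul_lowerUnip, ← mul_assoc, ← upperUnip_add]
    congr 2
    ring
  rw [e, map_mul, Module.End.mul_apply, hu _ (lowerUnip_mem_proIwahori hlt)]

/-! ### Hecke operators on vectors fixed by the pro-unipotent radical -/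

variable [Fintype 𝓀[F]]

variable (σ) in
/-- The Hecke operator of the Weyl element, on vectors fixed by the pro-unipotent radical of the
Iwahori subgroup. -/
def weylSum : V →ₗ[ℂ] V := ∑ c : 𝓀[F], σ (upperUnip (residueLift c : F) * weyl F)

theorem weylSum_apply (u : V) :
    weylSum σ u = ∑ c : 𝓀[F], σ (upperUnip (residueLift c : F) * weyl F) u := by
  rw [weylSum, LinearMap.sum_apply]

theorem sum_eq_weylSum {u : V} (hu : ∀ k ∈ proIwahori F, σ k u = u) (f : 𝓀[F] → F)
    (hf : ∀ c, valuation F (f c) ≤ 1) (hbij : Function.Bijective fun c => red (f c)) :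
    ∑ c, σ (upperUnip (f c) * weyl F) u = weylSum σ u := by
  rw [weylSum_apply, ← hbij.sum_comp fun c => σ (upperUnip (residueLift c : F) * weyl F) u]
  exact Finset.sum_congr rfl fun c _ =>
    upperUnip_weyl_congr hu (hf c) (residueLift _).2 (red_residueLift _).symm

theorem weyl_conj_mem_proIwahori {k : GL2 F} (hk : k ∈ proIwahori F) (h : red (k.1 0 1) = 0) :
    (weyl F)⁻¹ * k * weyl F ∈ proIwahori F := by
  obtain ⟨h1, h2, h3, h4⟩ := hk
  have e : ((weyl F)⁻¹ * k * weyl F).1 = !![k.1 1 1, -k.1 1 0; -k.1 0 1, k.1 0 0] := by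
    rw [Units.val_mul, Units.val_mul, GL2_inv_val]
    ext i j
    fin_cases i <;> fin_cases j <;>
      simp [Matrix.mul_apply, Fin.sum_univ_two, Matrix.vecMul, dotProduct]
  rw [mem_proIwahori, e]
  refine ⟨fun i j => ?_, ?_, ?_, ?_⟩
  · fin_cases i <;> fin_cases j <;> simp [h1]
  · simpa using h4
  · simp [red_neg (h1 0 1), h]
  · simpa using h2

/-- Peeling an upper unipotent off k makes its upper right entry zero; the remaining factor stays in
the pro-unipotent radical when conjugated by w. -/
theorem exists_upperUnip_weyl_mul {k : GL2 F} (hk : k ∈ proIwahori F) :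
    ∃ y : F, valuation F y ≤ 1 ∧ red y = red (k.1 0 1) ∧
      ∃ k' ∈ proIwahori F, k * weyl F = upperUnip y * weyl F * k' := by
  obtain ⟨h1, h2, h3, h4⟩ := hk
  have hv : valuation F (k.1 1 1) = 1 := valuation_eq_one_of_red (h1 1 1) (by simp [h4])
  have hy : valuation F (k.1 0 1 / k.1 1 1) ≤ 1 := by
    rw [map_div₀, hv, div_one]
    exact h1 0 1
  have h0 : k.1 1 1 ≠ 0 := by
    intro h
    simp [h] at hv
  refine ⟨k.1 0 1 / k.1 1 1, hy, ?_, _, weyl_conj_mem_proIwahori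
    (k := upperUnip (-(k.1 0 1 / k.1 1 1)) * k)
    (mul_mem (upperUnip_mem_proIwahori (by rwa [Valuation.map_neg])) ⟨h1, h2, h3, h4⟩) ?_, ?_⟩
  · rw [div_eq_mul_inv, red_mul (h1 0 1) (by simp [hv]), red_inv hv, h4, inv_one, mul_one]
  · have e : (upperUnip (-(k.1 0 1 / k.1 1 1)) * k).1 0 1 = 0 := by
      rw [Units.val_mul, Matrix.mul_apply, Fin.sum_univ_two]
      simp
      field_simp
      ring
    rw [e, red_zero]
  · have e : upperUnip (k.1 0 1 / k.1 1 1) * upperUnip (-(k.1 0 1 / k.1 1 1)) = 1 := by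
      rw [← upperUnip_add, add_neg_cancel, upperUnip_zero]
    calc k * weyl F = upperUnip (k.1 0 1 / k.1 1 1) * upperUnip (-(k.1 0 1 / k.1 1 1)) * k *
          weyl F := by rw [e, one_mul]
      _ = _ := by group

/-- Multiplication by k permutes the cosets of n(c) w, translating c by the reduction of the upper
right entry of k. -/
theorem weylSum_fixed {u : V} (hu : ∀ k ∈ proIwahori F, σ k u = u) :
    ∀ k ∈ proIwahori F, σ k (weylSum σ u) = weylSum σ u := by
  intro k hk
  have hmem : ∀ c : 𝓀[F], k * upperUnip (residueLift c : F) ∈ proIwahori F := fun c =>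
    mul_mem hk (upperUnip_mem_proIwahori (residueLift c).2)
  choose y hy hred k' hk' e using fun c => exists_upperUnip_weyl_mul (hmem c)
  have hy' : ∀ c, red (y c) = c + red (k.1 0 1) := by
    intro c
    rw [hred, Units.val_mul, red_mul_apply hk.1 (upperUnip_mem_proIwahori (residueLift c).2).1,
      hk.2.1]
    simp [red_residueLift, red_one]
  nth_rewrite 2 [← sum_eq_weylSum hu y hy]
  · rw [weylSum_apply, map_sum]
    refine Finset.sum_congr rfl fun c _ => ?_
    rw [← Module.End.mul_apply, ← map_mul, ← mul_assoc, e, map_mul, Module.End.mul_apply,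
      hu _ (hk' c)]
  · simp only [hy']
    exact (Equiv.addRight (red (k.1 0 1))).bijective

/-- The quadratic relation of the finite Hecke algebra. Applying the operator formally once more,
the terms n(d) w n(c) w u with c ≠ 0 sum over d to a torus translate of `weylSum σ u` and vanish,
while c = 0 leaves q times the action of -1 on u. -/
theorem eq_zero_of_weylSum_eq_zero {u : V} (hu : ∀ k ∈ proIwahori F, σ k u = u)
    (h : weylSum σ u = 0) : u = 0 := by
  classical
  have hval : ∀ c : 𝓀[F], c ≠ 0 → valuation F (residueLift c : F) = 1 := fun c hc =>
    valuation_eq_one_of_red (residueLift c).2 (by rwa [red_residueLift])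
  -- By the rank one relation, with the torus factor moved to the left and the last unipotent
  -- absorbed by u, the index d runs through another set of representatives.
  have hterm : ∀ c : 𝓀[F], c ≠ 0 → ∑ d : 𝓀[F], σ (upperUnip (residueLift d : F))
      (σ (weyl F) (σ (upperUnip (residueLift c : F) * weyl F) u)) = 0 := by
    intro c hc
    have hv := hval c hc
    have h0 : (residueLift c : F) ≠ 0 := by
      intro h
      simp [h] at hv
    set y : Fˣ := Units.mk0 (residueLift c : F) h0 with hy
    have hyv : (y : F) = residueLift c := rfl
    have hvy : valuation F (y : F) = 1 := hv
    have hf : ∀ d : 𝓀[F], valuation F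
        (((residueLift d : F) + -(y : F)⁻¹) * ((y : F) * y)) ≤ 1 := by
      intro d
      rw [map_mul, map_mul, hvy, mul_one, mul_one]
      exact Valuation.map_add_le _ (residueLift d).2 (by simp [hvy])
    have e : ∀ d : 𝓀[F], σ (upperUnip (residueLift d : F))
        (σ (weyl F) (σ (upperUnip (residueLift c : F) * weyl F) u)) =
        σ (diagGL (-y⁻¹) (-y)) (σ (upperUnip
          (((residueLift d : F) + -(y : F)⁻¹) * ((y : F) * y)) * weyl F) u) := by
      intro d
      rw [← Module.End.mul_apply, ← Module.End.mul_apply, ← map_mul, ← map_mul,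
        ← Module.End.mul_apply, ← map_mul]
      have e1 : upperUnip (residueLift d : F) * weyl F * (upperUnip (residueLift c : F) * weyl F) =
          diagGL (-y⁻¹) (-y) * (upperUnip
            (((residueLift d : F) + -(y : F)⁻¹) * ((y : F) * y)) * weyl F) *
              upperUnip (-(y : F)⁻¹) := by
        have e2 := weyl_mul_upperUnip_mul_weyl y
        rw [hyv] at e2
        have e3 := upperUnip_mul_diagGL (-y⁻¹) (-y) ((residueLift d : F) + -(y : F)⁻¹)
        have e4 : ((residueLift d : F) + -(y : F)⁻¹) * ((-y : Fˣ) : F) * (((-y⁻¹ : Fˣ) : F))⁻¹ =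
            ((residueLift d : F) + -(y : F)⁻¹) * ((y : F) * y) := by
          push_cast
          rw [inv_neg, inv_inv]
          ring
        rw [e4, upperUnip_add] at e3
        rw [mul_assoc, ← mul_assoc (weyl F), e2, ← hyv, ← mul_assoc (diagGL _ _), ← e3]
        group
      rw [e1, map_mul _ _ (upperUnip (-(y : F)⁻¹)), Module.End.mul_apply,
        hu _ (upperUnip_mem_proIwahori (by simp [hvy]))]
    rw [Finset.sum_congr rfl fun d _ => e d, ← map_sum, sum_eq_weylSum hu _ hf, h, map_zero]
    have hr : ∀ d : 𝓀[F], red (((residueLift d : F) + -(y : F)⁻¹) * ((y : F) * y)) =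
        (d + red (-(y : F)⁻¹)) * (c * c) := by
      intro d
      have hyy : red (y : F) = c := red_residueLift c
      rw [red_mul (Valuation.map_add_le _ (residueLift d).2 (by simp [hvy])) (by simp [hvy]),
        red_mul hvy.le hvy.le, hyy, red_add (residueLift d).2 (by simp [hvy]), red_residueLift]
    simp only [hr]
    exact ((Equiv.addRight (red (-(y : F)⁻¹))).trans
      (Equiv.mulRight₀ (c * c) (mul_ne_zero hc hc))).bijective
  have hzero : ∑ d : 𝓀[F], σ (upperUnip (residueLift d : F))
      (σ (weyl F) (σ (upperUnip (residueLift (0 : 𝓀[F]) : F) * weyl F) u)) = 0 := by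
    have h1 : ∑ c : 𝓀[F], ∑ d : 𝓀[F], σ (upperUnip (residueLift d : F))
        (σ (weyl F) (σ (upperUnip (residueLift c : F) * weyl F) u)) = 0 := by
      rw [Finset.sum_comm]
      simp only [← map_sum]
      simp only [← weylSum_apply, h, map_zero, Finset.sum_const_zero]
    rwa [Finset.sum_eq_single 0 (fun c _ hc => hterm c hc) (by simp)] at h1
  have e : σ (upperUnip (residueLift (0 : 𝓀[F]) : F) * weyl F) u = σ (weyl F) u := by
    rw [upperUnip_weyl_congr hu (residueLift 0).2 (y := 0) (by simp)
      (by rw [red_residueLift, red_zero]), upperUnip_zero, one_mul]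
  -- As w² = -1 is central, n(d) acts directly on u, which it fixes; all q terms agree.
  have e' : ∀ d : 𝓀[F], σ (upperUnip (residueLift d : F)) (σ (weyl F) (σ (weyl F) u)) =
      σ (diagGL (-1) (-1)) u := by
    intro d
    rw [← Module.End.mul_apply (σ (weyl F)), ← map_mul, weyl_mul_weyl, ← Module.End.mul_apply,
      ← map_mul, upperUnip_mul_diagGL, map_mul, Module.End.mul_apply,
      hu _ (upperUnip_mem_proIwahori (by
        simp only [Units.val_neg, Units.val_one, inv_neg, inv_one, mul_neg, mul_one, neg_neg]
        exact (residueLift d).2))]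
  rw [e, Finset.sum_congr rfl fun d _ => e' d, Finset.sum_const, ← Nat.cast_smul_eq_nsmul ℂ] at hzero
  have h2 := (smul_eq_zero.1 hzero).resolve_left 
    (Nat.cast_ne_zero.2 (Finset.card_ne_zero.2 Finset.univ_nonempty))
  have h3 := congrArg (σ (diagGL (-1) (-1))⁻¹) h2
  rwa [← Module.End.mul_apply, ← map_mul, inv_mul_cancel, map_one, Module.End.one_apply,
    map_zero] at h3

/-- The matrix (0, -1; ϖ, 0) normalizes the pro-unipotent radical. Factoring the Hecke operator
through it reduces injectivity to that of `weylSum`. -/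
theorem atkinLehner_conj_mem_proIwahori (ϖ : Uniformizer F) {k : GL2 F} (hk : k ∈ proIwahori F) :
    ((weyl F)⁻¹ * diagGL ϖ.unit 1)⁻¹ * k * ((weyl F)⁻¹ * diagGL ϖ.unit 1) ∈ proIwahori F := by
  obtain ⟨h1, h2, h3, h4⟩ := hk
  have h0 := coe_ne_zero ϖ
  have hu : ((ϖ.unit : Fˣ) : F) = ϖ.1 := rfl
  have e : (((weyl F)⁻¹ * diagGL ϖ.unit 1)⁻¹ * k * ((weyl F)⁻¹ * diagGL ϖ.unit 1)).1 =
      !![k.1 1 1, -(k.1 1 0 / ϖ.1); -(k.1 0 1 * ϖ.1), k.1 0 0] := by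
    rw [mul_inv_rev, inv_inv, diagGL_inv]
    simp only [Units.val_mul]
    rw [GL2_inv_val (weyl F)]
    ext i j
    fin_cases i <;> fin_cases j <;>
      simp [Matrix.mul_apply, Fin.sum_univ_two, Matrix.vecMul, dotProduct, hu] <;> field_simp
  have h10 : valuation F (k.1 1 0 / ϖ.1) ≤ 1 := by
    have h5 : k.1 1 0 ∈ pIdeal ϖ 1 := mem_pIdeal_one.2 ((red_eq_zero_iff (h1 1 0)).1 h3)
    have h6 : valuation F (k.1 1 0) ≤ valuation F (ϖ.1 : F) := by
      simpa [pIdeal] using h5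
    rw [map_div₀]
    exact div_le_one_of_le₀ h6 zero_le
  have h01 : valuation F (k.1 0 1 * ϖ.1) < 1 := by
    rw [map_mul]
    exact mul_lt_one_of_nonneg_of_lt_one_right (h1 0 1) zero_le (val_lt_one ϖ)
  rw [mem_proIwahori, e]
  refine ⟨fun i j => ?_, ?_, ?_, ?_⟩
  · fin_cases i <;> fin_cases j
    · simpa using h1 1 1
    · simpa using h10
    · simpa using h01.le
    · simpa using h1 0 0
  · simpa using h4
  · simp [red_neg h01.le, red_eq_zero h01]
  · simpa using h2

variable (σ) in
/-- The Hecke operator of `(ϖ, 0; 0, 1)`. -/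
def heckeU (ϖ : Uniformizer F) : V →ₗ[ℂ] V :=
  weylSum σ ∘ₗ σ ((weyl F)⁻¹ * diagGL ϖ.unit 1)

theorem heckeU_apply (ϖ : Uniformizer F) (u : V) : heckeU σ ϖ u =
    ∑ c : 𝓀[F], σ (upperUnip (residueLift c : F) * diagGL ϖ.unit 1) u := by
  rw [heckeU, LinearMap.comp_apply, weylSum_apply]
  refine Finset.sum_congr rfl fun c _ => ?_
  rw [← Module.End.mul_apply, ← map_mul]
  congr 2
  group

theorem atkinLehner_fixed (ϖ : Uniformizer F) {u : V} (hu : ∀ k ∈ proIwahori F, σ k u = u) :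
    ∀ k ∈ proIwahori F, σ k (σ ((weyl F)⁻¹ * diagGL ϖ.unit 1) u) =
      σ ((weyl F)⁻¹ * diagGL ϖ.unit 1) u := by
  intro k hk
  have h := hu _ (atkinLehner_conj_mem_proIwahori ϖ hk)
  nth_rewrite 2 [← h]
  rw [← Module.End.mul_apply, ← Module.End.mul_apply, ← map_mul, ← map_mul]
  congr 2
  group

theorem heckeU_pow_fixed (ϖ : Uniformizer F) {u : V} (hu : ∀ k ∈ proIwahori F, σ k u = u) (m : ℕ) :
    ∀ k ∈ proIwahori F, σ k ((heckeU σ ϖ ^ m) u) = (heckeU σ ϖ ^ m) u := by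
  induction m with
  | zero => simpa using hu
  | succ m ih =>
    rw [pow_succ', Module.End.mul_apply]
    exact weylSum_fixed (atkinLehner_fixed ϖ ih)

theorem eq_zero_of_heckeU_pow (ϖ : Uniformizer F) {u : V} (hu : ∀ k ∈ proIwahori F, σ k u = u)
    (m : ℕ) (h : (heckeU σ ϖ ^ m) u = 0) : u = 0 := by
  induction m with
  | zero => simpa using h
  | succ m ih =>
    apply ih
    rw [pow_succ', Module.End.mul_apply] at h
    have h1 := eq_zero_of_weylSum_eq_zero (atkinLehner_fixed ϖ (heckeU_pow_fixed ϖ hu m)) h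
    have h2 := congrArg (σ ((weyl F)⁻¹ * diagGL ϖ.unit 1)⁻¹) h1
    rwa [← Module.End.mul_apply, ← map_mul, inv_mul_cancel, map_one, Module.End.one_apply,
      map_zero] at h2

/-- Conjugation by diag(ϖ⁻ᵐ, 1) carries the integral unipotents in Uᵐ to unipotents with entry in
ϖ⁻ᵐ𝒪, which act trivially on coinvariants; the qᵐ terms then all have the class of u. -/
theorem heckeU_pow_mem_ker (ϖ : Uniformizer F) (u : V) (m : ℕ) :
    σ (diagGL (ϖ.unit⁻¹ ^ m) 1) ((heckeU σ ϖ ^ m) u) - (Fintype.card 𝓀[F] : ℂ) ^ m • u ∈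
      Representation.Coinvariants.ker (σ.comp (scaledUnip ((ϖ.1 : F)⁻¹ ^ m))) := by
  induction m with
  | zero =>
    rw [pow_zero, pow_zero, pow_zero, diagGL_one, map_one, pow_zero, one_smul, Module.End.one_apply,
      Module.End.one_apply, sub_self]
    exact zero_mem _
  | succ m ih =>
    have h0 := coe_ne_zero ϖ
    have hle : Representation.Coinvariants.ker (σ.comp (scaledUnip ((ϖ.1 : F)⁻¹ ^ m))) ≤
        Representation.Coinvariants.ker (σ.comp (scaledUnip ((ϖ.1 : F)⁻¹ ^ (m + 1)))) := by
      convert coinvariants_ker_scaledUnip_le (σ := σ) ((ϖ.1 : F)⁻¹ ^ (m + 1)) ϖ.1 using 5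
      rw [pow_succ, mul_assoc, inv_mul_cancel₀ h0, mul_one]
    obtain ⟨w, hw⟩ : ∃ w, w = (heckeU σ ϖ ^ m) u := ⟨_, rfl⟩
    rw [← hw] at ih
    have e : ∀ c : 𝓀[F], σ (diagGL (ϖ.unit⁻¹ ^ (m + 1)) 1)
        (σ (upperUnip (residueLift c : F) * diagGL ϖ.unit 1) w) =
        (σ.comp (scaledUnip ((ϖ.1 : F)⁻¹ ^ (m + 1)))) (Multiplicative.ofAdd (residueLift c))
          (σ (diagGL (ϖ.unit⁻¹ ^ m) 1) w) := by
      intro c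
      change _ = σ (upperUnip ((ϖ.1 : F)⁻¹ ^ (m + 1) * (residueLift c : F))) _
      rw [← Module.End.mul_apply, ← Module.End.mul_apply, ← map_mul, ← map_mul]
      congr 2
      have e1 : diagGL (ϖ.unit⁻¹ ^ m) 1 =
          diagGL (ϖ.unit⁻¹ ^ (m + 1)) 1 * diagGL ϖ.unit 1 := by
        rw [← diagGL_mul, pow_succ, inv_mul_cancel_right, one_mul]
      rw [e1, ← mul_assoc, ← mul_assoc, upperUnip_mul_diagGL]
      congr 3
      have hu : ((ϖ.unit : Fˣ) : F) = ϖ.1 := rfl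
      push_cast
      rw [hu]
      field_simp
    -- A sum of elementary generators of the larger kernel, plus q times the difference from the
    -- induction hypothesis.
    have e2 : σ (diagGL (ϖ.unit⁻¹ ^ (m + 1)) 1) ((heckeU σ ϖ ^ (m + 1)) u) -
        (Fintype.card 𝓀[F] : ℂ) ^ (m + 1) • u =
        (∑ c : 𝓀[F], ((σ.comp (scaledUnip ((ϖ.1 : F)⁻¹ ^ (m + 1))))
          (Multiplicative.ofAdd (residueLift c)) (σ (diagGL (ϖ.unit⁻¹ ^ m) 1) w) -
            σ (diagGL (ϖ.unit⁻¹ ^ m) 1) w)) +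
        (Fintype.card 𝓀[F] : ℂ) • (σ (diagGL (ϖ.unit⁻¹ ^ m) 1) w -
          (Fintype.card 𝓀[F] : ℂ) ^ m • u) := by
      rw [pow_succ' (heckeU σ ϖ), Module.End.mul_apply, ← hw, heckeU_apply, map_sum,
        Finset.sum_congr rfl fun c _ => e c, Finset.sum_sub_distrib, Finset.sum_const,
        Finset.card_univ, smul_sub, smul_smul, ← pow_succ', Nat.cast_smul_eq_nsmul]
      abel
    rw [e2]
    exact add_mem (sum_mem fun c _ => Representation.Coinvariants.sub_mem_ker _ _)
      (Submodule.smul_mem _ _ (hle ih))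

end Cuspidal

/-! ### Cuspidal representations have no fixed vectors -/

section CuspidalFixed

variable {F : Type*} [Field F] [ValuativeRel F] [TopologicalSpace F]
  [IsNonarchimedeanLocalField F] {V : Type*} [AddCommGroup V] [Module ℂ V]
  {σ : Representation ℂ (GL2 F) V}

/-- A cuspidal representation has no vectors fixed by the pro-unipotent radical of the Iwahori
subgroup. -/
theorem IsCuspidal.eq_zero_of_fixed (ϖ : Uniformizer F) (hσ : IsSmooth σ) (h : IsCuspidal σ) (v : V)
    (hv : ∀ k ∈ proIwahori F, σ k v = v) : v = 0 := by
  have : Fintype 𝓀[F] := Fintype.ofFinite _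
  obtain ⟨m, hm⟩ := h.mem_coinvariants_ker ϖ v
  apply eq_zero_of_heckeU_pow ϖ hv m
  have hfix := heckeU_pow_fixed ϖ hv m
  -- This vector lies in the kernel of coinvariants because v does, and it is invariant because
  -- conjugation by diag(ϖ⁻ᵐ, 1) makes the unipotents integral.
  have h1 : σ (diagGL (ϖ.unit⁻¹ ^ m) 1) ((heckeU σ ϖ ^ m) v) = 0 := by
    refine eq_zero_of_mem_coinvariants_ker (σ.comp (scaledUnip ((ϖ.1 : F)⁻¹ ^ m)))
      (scaledUnip_stabilizer hσ _) ?_ fun x => ?_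
    · have h2 := add_mem (heckeU_pow_mem_ker (σ := σ) ϖ v m)
        (Submodule.smul_mem _ ((Fintype.card 𝓀[F] : ℂ) ^ m) hm)
      rwa [sub_add_cancel] at h2
    · change σ (upperUnip ((ϖ.1 : F)⁻¹ ^ m * (x.toAdd : F))) _ = _
      rw [← Module.End.mul_apply, ← map_mul, upperUnip_mul_diagGL, map_mul, Module.End.mul_apply,
        hfix]
      apply upperUnip_mem_proIwahori
      have hu : ((ϖ.unit : Fˣ) : F) = ϖ.1 := rfl
      have h0 := coe_ne_zero ϖ
      have e : (ϖ.1 : F)⁻¹ ^ m * (x.toAdd : F) * ((1 : Fˣ) : F) *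
          ((ϖ.unit⁻¹ ^ m : Fˣ) : F)⁻¹ = (x.toAdd : F) := by
        push_cast
        rw [hu]
        field_simp
      rw [e]
      exact x.toAdd.2
  have h2 := congrArg (σ (diagGL (ϖ.unit⁻¹ ^ m) 1)⁻¹) h1
  rwa [← Module.End.mul_apply, ← map_mul, inv_mul_cancel, map_one, Module.End.one_apply,
    map_zero] at h2

end CuspidalFixed

/-! ### Formal properties of equivalences of representations -/

section Equivalences

variable {G V V' W W' : Type*} [Group G] [AddCommMonoid V] [Module ℂ V] [AddCommMonoid V']
  [Module ℂ V'] [AddCommMonoid W] [Module ℂ W] [AddCommMonoid W'] [Module ℂ W']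
  {ρ : Representation ℂ G V} {ρ' : Representation ℂ G V'} {σ : Representation ℂ G W}
  {σ' : Representation ℂ G W'}

theorem nonempty_equiv_trans (h : Nonempty (ρ.Equiv σ)) (h' : Nonempty (σ.Equiv σ')) :
    Nonempty (ρ.Equiv σ') :=
  h.elim fun e => h'.elim fun e' => ⟨e.trans e'⟩

theorem nonempty_equiv_symm (h : Nonempty (ρ.Equiv σ)) : Nonempty (σ.Equiv ρ) :=
  h.elim fun e => ⟨e.symm⟩

theorem nonempty_equiv_prod (h : Nonempty (ρ.Equiv σ)) (h' : Nonempty (ρ'.Equiv σ')) :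
    Nonempty ((ρ.prod ρ').Equiv (σ.prod σ')) := by
  obtain ⟨e⟩ := h
  obtain ⟨e'⟩ := h'
  refine ⟨Representation.Equiv.mk (e.toLinearEquiv.prodCongr e'.toLinearEquiv) fun g =>
    LinearMap.ext fun v => Prod.ext ?_ ?_⟩
  · exact e.toIntertwiningMap.isIntertwining _ _ g v.1
  · exact e'.toIntertwiningMap.isIntertwining _ _ g v.2

theorem nonempty_equiv_of_subsingleton (h : Subsingleton V) (h' : Subsingleton W) :
    Nonempty (ρ.Equiv σ) :=
  ⟨Representation.Equiv.mk (LinearEquiv.ofSubsingleton V W) fun _ =>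
    LinearMap.ext fun _ => Subsingleton.elim _ _⟩

theorem subsingleton_of_equiv (h : Nonempty (ρ.Equiv σ)) (h' : Subsingleton W) : Subsingleton V :=
  h.elim fun e => e.toLinearEquiv.toEquiv.subsingleton

end Equivalences

/-! ### The representations on the right-hand side, and when they vanish -/

section Bracket

variable {k : Type*} [Field k] {A₀ A₁ A₂ : Type*} [AddCommGroup A₀] [Module ℂ A₀] [AddCommGroup A₁]
  [Module ℂ A₁] [AddCommGroup A₂] [Module ℂ A₂]

theorem subsingleton_finInd {A : Type*} [AddCommGroup A] [Module ℂ A] (χ : Representation ℂ kˣ A)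
    (h : Subsingleton A) : Subsingleton (Representation.coindV (borel k).subtype
      (Representation.tprod ((Representation.trivial ℂ kˣ ℂ).comp (borelFst k))
        (χ.comp (borelSnd k)))) :=
  subsingleton_of_forall_eq 0 fun _ => Subtype.ext <| funext fun _ => Subsingleton.elim _ _

/-- A representation is of the form `χ₀[1 × χ₁, 1 × χ₂]`. -/
def IsBracketInd {V : Type*} [AddCommMonoid V] [Module ℂ V] (ρ : Representation ℂ (GL2sq0 k) V)
    (χ₀ : Representation ℂ kˣ A₀) (χ₁ : Representation ℂ kˣ A₁) (χ₂ : Representation ℂ kˣ A₂) :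
    Prop :=
  Nonempty (ρ.Equiv (bracketInd χ₀ χ₁ χ₂))

/-- A representation is of the form `χ₀[1 × χ₁, 1 × χ₂] ⊕ χ₀[1 × χ₂, 1 × χ₁]`. -/
def IsBracketIndSum {V : Type*} [AddCommMonoid V] [Module ℂ V] (ρ : Representation ℂ (GL2sq0 k) V)
    (χ₀ : Representation ℂ kˣ A₀) (χ₁ : Representation ℂ kˣ A₁) (χ₂ : Representation ℂ kˣ A₂) :
    Prop :=
  Nonempty (ρ.Equiv ((bracketInd χ₀ χ₁ χ₂).prod (bracketInd χ₀ χ₂ χ₁)))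

theorem isBracketIndSum_of_subsingleton {V : Type*} [AddCommGroup V] [Module ℂ V]
    {ρ : Representation ℂ (GL2sq0 k) V} (hV : Subsingleton V) (χ₀ : Representation ℂ kˣ A₀)
    (χ₁ : Representation ℂ kˣ A₁) (χ₂ : Representation ℂ kˣ A₂)
    (h : Subsingleton A₀ ∨ Subsingleton A₁ ∨ Subsingleton A₂) :
    IsBracketIndSum ρ χ₀ χ₁ χ₂ := by
  refine nonempty_equiv_of_subsingleton hV ?_
  rcases h with h | h | h
  · infer_instance
  · have := subsingleton_finInd χ₁ h
    infer_instance
  · have := subsingleton_finInd χ₂ h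
    infer_instance

theorem isBracketInd_of_subsingleton {V : Type*} [AddCommGroup V] [Module ℂ V]
    {ρ : Representation ℂ (GL2sq0 k) V} (hV : Subsingleton V) (χ₀ : Representation ℂ kˣ A₀)
    (χ₁ : Representation ℂ kˣ A₁) (χ₂ : Representation ℂ kˣ A₂)
    (h : Subsingleton A₀ ∨ Subsingleton A₁ ∨ Subsingleton A₂) :
    IsBracketInd ρ χ₀ χ₁ χ₂ := by
  refine nonempty_equiv_of_subsingleton hV ?_
  rcases h with h | h | h
  · infer_instance
  · have := subsingleton_finInd χ₁ h
    infer_instance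
  · have := subsingleton_finInd χ₂ h
    infer_instance

end Bracket

/-! ### Comparison of both sides, in the tame and non-tame cases -/

section Siegel

variable {F : Type*} [Field F] [ValuativeRel F] [TopologicalSpace F]
  [IsNonarchimedeanLocalField F] {V : Type*} [AddCommGroup V] [Module ℂ V] (ϖ : Uniformizer F)
  {σ : Representation ℂ (GL2 F) V} {μ₀ μ₁ μ₂ : Fˣ →* ℂˣ} {A₀ A₁ A₂ : Type*} [AddCommGroup A₀]
  [Module ℂ A₀] [AddCommGroup A₁] [Module ℂ A₁] [AddCommGroup A₂] [Module ℂ A₂]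
  {ρ₀ : Representation ℂ 𝓀[F]ˣ A₀} {ρ₁ : Representation ℂ 𝓀[F]ˣ A₁}
  {ρ₂ : Representation ℂ 𝓀[F]ˣ A₂}

/-- A representation of the multiplicative group of the residue field is a tame restriction of a
character if it is equivalent to the induced character, or zero if there is none. -/
structure IsTameRestriction (μ : Fˣ →* ℂˣ) {A : Type*} [AddCommGroup A] [Module ℂ A]
    (ρ : Representation ℂ 𝓀[F]ˣ A) : Prop where
  subsingleton : ¬ IsTame μ → Subsingleton A
  exists_equiv : ∀ χ : 𝓀[F]ˣ →* ℂˣ, (∀ u, χ (unitsRed F u) = μ (unitsIncl F u)) →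
    ∃ e : A ≃ₗ[ℂ] ℂ, ∀ u a, e (ρ u a) = χ u * e a

theorem isTameRestriction_tameRes (μ : Fˣ →* ℂˣ) : IsTameRestriction μ (tameRes μ) :=
  ⟨subsingleton_tameRes, fun _ hχ => exists_tameRes_equiv hχ⟩

theorem IsTameRestriction.isBracketInd_pairInd {χ₀ χ₁ χ₂ : 𝓀[F]ˣ →* ℂˣ}
    (h₀ : IsTameRestriction μ₀ ρ₀) (h₁ : IsTameRestriction μ₁ ρ₁) (h₂ : IsTameRestriction μ₂ ρ₂)
    (hχ₀ : ∀ u, χ₀ (unitsRed F u) = μ₀ (unitsIncl F u))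
    (hχ₁ : ∀ u, χ₁ (unitsRed F u) = μ₁ (unitsIncl F u))
    (hχ₂ : ∀ u, χ₂ (unitsRed F u) = μ₂ (unitsIncl F u)) :
    IsBracketInd (pairInd χ₀ χ₁ χ₂) ρ₀ ρ₁ ρ₂ :=
  (h₀.exists_equiv χ₀ hχ₀).elim fun e₀ he₀ => (h₁.exists_equiv χ₁ hχ₁).elim fun e₁ he₁ =>
    (h₂.exists_equiv χ₂ hχ₂).elim fun e₂ he₂ => nonempty_equiv_symm
      (nonempty_bracketInd_equiv (k := 𝓀[F]) (χ₀ := χ₀) (χ₁ := χ₁) (χ₂ := χ₂) e₀ he₀ e₁ he₁ e₂ he₂)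

theorem IsTameRestriction.subsingleton_or (h₀ : IsTameRestriction μ₀ ρ₀)
    (h₁ : IsTameRestriction μ₁ ρ₁) (h₂ : IsTameRestriction μ₂ ρ₂)
    (h : ¬ (IsTame μ₀ ∧ IsTame μ₁ ∧ IsTame μ₂)) :
    Subsingleton A₀ ∨ Subsingleton A₁ ∨ Subsingleton A₂ := by
  rw [not_and_or, not_and_or] at h
  exact h.imp h₀.subsingleton (Or.imp h₁.subsingleton h₂.subsingleton)

theorem fixed_eq_zero_of_equiv {W : Type*} [AddCommGroup W] [Module ℂ W]
    {σ' : Representation ℂ (GL2 F) W} (E : σ.Equiv σ')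
    (h : ∀ w, (∀ k ∈ proIwahori F, σ' k w = w) → w = 0) (v : V)
    (hv : ∀ k ∈ proIwahori F, σ k v = v) : v = 0 :=
  E.toLinearEquiv.map_eq_zero_iff.1 (h _ (equiv_fixed E hv))

/-- If all characters are tame, the eigenvectors of the model σ' are carried to σ by E and give the
two summands. Otherwise both sides are zero: the right because a tensor factor is, the left because
of μ₀ or for lack of fixed vectors. -/
theorem isBracketIndSum_siegelParInd {W : Type*} [AddCommGroup W] [Module ℂ W]
    {σ' : Representation ℂ (GL2 F) W} (E : σ.Equiv σ') (hρ₀ : IsTameRestriction μ₀ ρ₀)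
    (hρ₁ : IsTameRestriction μ₁ ρ₁) (hρ₂ : IsTameRestriction μ₂ ρ₂)
    (h : ¬ (IsTame μ₁ ∧ IsTame μ₂) → ∀ w, (∀ k ∈ proIwahori F, σ' k w = w) → w = 0)
    (h' : ∀ χ₁ χ₂ : 𝓀[F]ˣ →* ℂˣ, (∀ u, χ₁ (unitsRed F u) = μ₁ (unitsIncl F u)) →
      (∀ u, χ₂ (unitsRed F u) = μ₂ (unitsIncl F u)) → IsTame μ₁ → IsTame μ₂ →
      ∃ e e', IsTorusEigenvector σ' e χ₁ χ₂ ∧ IsTorusEigenvector σ' e' χ₂ χ₁ ∧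
        (∀ v, (∀ k ∈ proIwahori F, σ' k v = v) → ∃ z z' : ℂ, v = z • e + z' • e') ∧
        (∀ z z' : ℂ, z • e + z' • e' = 0 → z = 0 ∧ z' = 0)) :
    IsBracketIndSum (Representation.coind (siegelParMap ϖ) (siegelParRep ϖ σ μ₀)) ρ₀ ρ₁ ρ₂ := by
  by_cases ht : IsTame μ₀ ∧ IsTame μ₁ ∧ IsTame μ₂
  · refine ht.1.exists_char.elim fun χ₀ hχ₀ => ht.2.1.exists_char.elim fun χ₁ hχ₁ =>
      ht.2.2.exists_char.elim fun χ₂ hχ₂ => ?_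
    refine (h' χ₁ χ₂ hχ₁ hχ₂ ht.2.1 ht.2.2).elim fun e h' => h'.elim
      fun e' ⟨he, he', hspan, hind⟩ => ?_
    refine nonempty_equiv_trans (nonempty_siegelParInd_equiv_prod hχ₀ (he.map E.symm)
      (he'.map E.symm) (fun v hv => ?_) fun z z' hz => ?_)
      (nonempty_equiv_prod (hρ₀.isBracketInd_pairInd hρ₁ hρ₂ hχ₀ hχ₁ hχ₂)
        (hρ₀.isBracketInd_pairInd hρ₂ hρ₁ hχ₀ hχ₂ hχ₁))
    · obtain ⟨z, z', hz⟩ := hspan _ (equiv_fixed E hv)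
      refine ⟨z, z', E.toLinearEquiv.injective (hz.trans ?_)⟩
      rw [map_add, map_smul, map_smul]
      exact congrArg₂ _ (congrArg _ (E.toLinearEquiv.apply_symm_apply e).symm)
        (congrArg _ (E.toLinearEquiv.apply_symm_apply e').symm)
    · refine hind z z' (E.toLinearEquiv.symm.injective ?_)
      rw [map_zero, map_add, map_smul, map_smul]
      exact hz
  · refine isBracketIndSum_of_subsingleton ?_ _ _ _
      (hρ₀.subsingleton_or hρ₁ hρ₂ ht)
    by_cases h₀ : IsTame μ₀
    · exact subsingleton_siegelParInd_of_fixed (fixed_eq_zero_of_equiv E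
        (h fun h' => ht ⟨h₀, h'⟩))
    · exact subsingleton_siegelParInd_of_not_isTame h₀

/-- The analogue for a single eigenvector, on which both torus entries act by the same character. -/
theorem isBracketInd_siegelParInd {W : Type*} [AddCommGroup W] [Module ℂ W]
    {σ' : Representation ℂ (GL2 F) W} (E : σ.Equiv σ') (hρ₀ : IsTameRestriction μ₀ ρ₀)
    (hρ₁ : IsTameRestriction μ₁ ρ₁)
    (h : ¬ IsTame μ₁ → ∀ w, (∀ k ∈ proIwahori F, σ' k w = w) → w = 0)
    (h' : ∀ χ : 𝓀[F]ˣ →* ℂˣ, (∀ u, χ (unitsRed F u) = μ₁ (unitsIncl F u)) → IsTame μ₁ →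
      ∃ e, IsTorusEigenvector σ' e χ χ ∧
        (∀ v, (∀ k ∈ proIwahori F, σ' k v = v) → ∃ z : ℂ, v = z • e) ∧ e ≠ 0) :
    IsBracketInd (Representation.coind (siegelParMap ϖ) (siegelParRep ϖ σ μ₀)) ρ₀ ρ₁ ρ₁ := by
  by_cases ht : IsTame μ₀ ∧ IsTame μ₁ ∧ IsTame μ₁
  · refine ht.1.exists_char.elim fun χ₀ hχ₀ => ht.2.1.exists_char.elim fun χ₁ hχ₁ => ?_
    refine (h' χ₁ hχ₁ ht.2.1).elim fun e ⟨he, hspan, hne⟩ => ?_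
    refine nonempty_equiv_trans (nonempty_siegelParInd_equiv hχ₀ (he.map E.symm)
      (fun v hv => ?_) fun h0 => hne (E.toLinearEquiv.symm.map_eq_zero_iff.1 h0))
      (hρ₀.isBracketInd_pairInd hρ₁ hρ₁ hχ₀ hχ₁ hχ₁)
    obtain ⟨z, hz⟩ := hspan _ (equiv_fixed E hv)
    refine ⟨z, E.toLinearEquiv.injective (hz.trans ?_)⟩
    rw [map_smul]
    exact congrArg _ (E.toLinearEquiv.apply_symm_apply e).symm
  · refine isBracketInd_of_subsingleton ?_ _ _ _ (hρ₀.subsingleton_or hρ₁ hρ₁ ht)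
    by_cases h₀ : IsTame μ₀
    · exact subsingleton_siegelParInd_of_fixed (fixed_eq_zero_of_equiv E
        (h fun h₁ => ht ⟨h₀, h₁, h₁⟩))
    · exact subsingleton_siegelParInd_of_not_isTame h₀

end Siegel

end ParahoricRes

end

/-! ### Assembly of the three cases -/

theorem proposition6 {F : Type*} [Field F] [CharZero F] [ValuativeRel F] [TopologicalSpace F]
    [IsNonarchimedeanLocalField F] (ϖ : ParahoricRes.Uniformizer F) (μ₀ μ₁ μ₂ : Fˣ →* ℂˣ)
    (hμ₀ : ParahoricRes.IsSmoothChar μ₀) (hμ₁ : ParahoricRes.IsSmoothChar μ₁)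
    (hμ₂ : ParahoricRes.IsSmoothChar μ₂) {V : Type*} [AddCommGroup V] [Module ℂ V]
    (σ : Representation ℂ (ParahoricRes.GL2 F) V) (hirr : σ.IsIrreducible)
    (hadm : ParahoricRes.IsAdmissible σ) :
    (Nonempty (σ.Equiv (ParahoricRes.principalSeries μ₁ μ₂)) →
      Nonempty ((ParahoricRes.paramodularRes ϖ (ParahoricRes.siegelInd σ μ₀)).Equiv
        ((ParahoricRes.bracketInd (ParahoricRes.tameRes μ₀) (ParahoricRes.tameRes μ₁)
            (ParahoricRes.tameRes μ₂)).prod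
          (ParahoricRes.bracketInd (ParahoricRes.tameRes μ₀) (ParahoricRes.tameRes μ₂)
            (ParahoricRes.tameRes μ₁))))) ∧
    ((Nonempty (σ.Equiv (ParahoricRes.twistedSteinberg μ₁)) ∨
        Nonempty (σ.Equiv (ParahoricRes.detRep μ₁))) →
      Nonempty ((ParahoricRes.paramodularRes ϖ (ParahoricRes.siegelInd σ μ₀)).Equiv
        (ParahoricRes.bracketInd (ParahoricRes.tameRes μ₀) (ParahoricRes.tameRes μ₁)
          (ParahoricRes.tameRes μ₁)))) ∧
    (ParahoricRes.IsCuspidal σ →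
      Subsingleton (Representation.invariants
        (((ParahoricRes.siegelInd σ μ₀).comp (ParahoricRes.paramodular ϖ).subtype).comp
          (ParahoricRes.paramodularPlus ϖ).subtype))) := by
  have h₀ := ParahoricRes.isTameRestriction_tameRes μ₀
  have h₁ := ParahoricRes.isTameRestriction_tameRes μ₁
  have h₂ := ParahoricRes.isTameRestriction_tameRes μ₂
  refine ⟨fun ⟨E⟩ => ?_, fun h => ?_, fun h => ?_⟩
  · exact ParahoricRes.nonempty_equiv_trans
      (ParahoricRes.isParamodularRes_siegelParInd ϖ σ μ₀)
      (ParahoricRes.isBracketIndSum_siegelParInd ϖ E h₀ h₁ h₂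
        ParahoricRes.principalSeries_eq_zero_of_fixed
        fun _ _ => ParahoricRes.exists_principalSeries_eigenvectors)
  · refine ParahoricRes.nonempty_equiv_trans
      (ParahoricRes.isParamodularRes_siegelParInd ϖ σ μ₀) ?_
    rcases h with ⟨⟨E⟩⟩ | ⟨⟨E⟩⟩
    · exact ParahoricRes.isBracketInd_siegelParInd ϖ E h₀ h₁
        ParahoricRes.twistedSteinberg_eq_zero_of_fixed
        fun _ => ParahoricRes.exists_twistedSteinberg_eigenvector
    · exact ParahoricRes.isBracketInd_siegelParInd ϖ E h₀ h₁
        ParahoricRes.detRep_eq_zero_of_fixed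
        fun _ hχ h => ⟨1, ParahoricRes.detRep_eigenvector hχ h,
          fun v _ => ⟨v, (mul_one v).symm⟩, one_ne_zero⟩
  · exact ParahoricRes.subsingleton_of_equiv
      (ParahoricRes.isParamodularRes_siegelParInd ϖ σ μ₀)
      (ParahoricRes.subsingleton_siegelParInd_of_fixed (h.eq_zero_of_fixed ϖ hadm.1))
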